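/- **Notation.** For $\varphi\in L^1(\mathbb R)$ let $\varphi^*(t)=\int e^{itx}\varphi(x)\,dx$. Derivatives in $\theta$ are taken at points of the interior $\mathring\Theta$ of $\Theta$ and are understood coordinatewise, and $\sup_\theta h_\theta$ means the pointwise supremum of $|h_\theta|$. **Model.** One observes $(Y_i,Z_i)$, $i\ge 1$, with $$Y_i=f_{\theta^0}(X_i)+\xi_i,\qquad Z_i=X_i+\varepsilon_i,$$ where the triples $(X_i,\xi_i,\varepsilon_i)$ are i.i.d., $X_i,\xi_i,\varepsilon_i$ are independent, $X_i$ has a density $g$, $\varepsilon_i$ has a known density $p_\varepsilon$, $\mathbb E\xi_i=0$, and $\sigma^2_{\xi,2}=\mathrm{Var}(\xi_i)$ is known. We write $(X,Y,Z)$ for $(X_1,Y_1,Z_1)$. The set $\Theta\subset\mathbb R^d$ is compact, $\theta^0\in\mathring\Theta$, and $(w_\theta)_{\theta\in\Theta}$ are nonnegative weight functions. **Estimator.** Let $K^*$ be a measurable, compactly supported function with $K^*(-t)=\overline{K^*(t)}$ and $|1-K^*(t)|\le \mathbf 1_{|t|\ge1}$. For $C>0$ put $K_{n,C}(x)=(2\pi)^{-1}\int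 e^{-itx}K^*(t/C)/p_\varepsilon^*(t)\,dt$. For a sequence $C_n>0$ let $\hat\theta_1=\hat\theta_{1,n}$ be a measurable minimizer over $\Theta$ (almost surely) of $$S_{n,1}(\theta)=\frac1n\sum_{i=1}^n\int\big[(Y_i-f_\theta(x))^2-\sigma_{\xi,2}^2\big]w_\theta(x)K_{n,C_n}(x-Z_i)\,dx .$$ **Assumptions.** * (Noise) $p_\varepsilon\in L^2(\mathbb R)$ and $p_\varepsilon^*$ has no zero. * (Moments) $\mathbb E\,\xi^4<\infty$ and $\mathbb E f_{\theta^0}(X)^4<\infty$. The functions $f_{\theta^0}^2g$ and $f_{\theta^0}g$ are in $L^2(\mathbb R)$. The quantity $\mathbb E[w_\theta^2(X)(Y-f_\theta(X))^4]$ is finite for all $\theta\in\Theta$ and twice differentiable in $\theta\in\mathring\Theta$. * (Smoothness) For every $x$, the functions $\theta\mapsto f_\theta(x)$ and $\theta\mapsto w_\theta(x)$ are continuous on $\Theta$ and, on $\mathring\Theta$, of class $C^3$ and $C^2$ respectively. * (Integrability) $\sup_{\theta\in\Theta}|w_\theta f_\theta|$, $\sup_{\theta\in\Theta}|w_\theta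 f_\theta^2|$ and $w_\theta$ (for each $\theta\in\Theta$) are in $L^1(\mathbb R)$. * (Identifiability) $S(\theta)=\mathbb E[\{(Y-f_\theta(X))^2-\sigma_{\xi,2}^2\}w_\theta(X)]$ has on $\Theta$ its unique minimum at $\theta^0$. It is twice differentiable on $\mathring\Theta$, and its Hessian matrix at $\theta^0$ equals $$J=\mathbb E\Big[2w_{\theta^0}(X)\Big(\tfrac{\partial f_\theta(X)}{\partial\theta}\Big|_{\theta=\theta^0}\Big)\Big(\tfrac{\partial f_\theta(X)}{\partial\theta}\Big|_{\theta=\theta^0}\Big)^{\!\top}\Big],$$ which is positive definite. * (C$_8$) For all $\theta\in\Theta$, $w_\theta,\ w_\theta f_\theta,\ w_\theta f_\theta^2\in L^1(\mathbb R)$ and $w_\theta^*/p_\varepsilon^*\in L^1\cap L^2$. Moreover $\sup_{\theta\in\Theta}(f_\theta w_\theta)^*/p_\varepsilon^*$ and $\sup_{\theta\in\Theta}(f_\theta^2w_\theta)^*/p_\varepsilon^*$ belong to $L^1\cap L^2$. If $\Theta$ is not convex, $\sup_{\theta\in\Theta}w_\theta^*/p_\varepsilon^*\in L^1$ is also required.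 * (C$_9$) For $\psi_\theta\in\{w_\theta,f_\theta w_\theta,f_\theta^2w_\theta\}$ and all $j$: $\partial\psi_\theta/\partial\theta_j\in L^1(\mathbb R)$ for $\theta\in\mathring\Theta$, and $\sup_{\theta\in\mathring\Theta}(\partial\psi_\theta/\partial\theta_j)^*/p_\varepsilon^*\in L^1\cap L^2$. * (C$_{10}$) For the same $\psi_\theta$, all $i,j$ and all $\theta\in\mathring\Theta$: $\partial^2\psi_\theta/\partial\theta_i\partial\theta_j\in L^1(\mathbb R)$ and $(\partial^2\psi_\theta/\partial\theta_i\partial\theta_j)^*/p_\varepsilon^*\in L^1\cap L^2$. **Theorem 6.2.** There are sequences $C_n>0$, $C_n\to\infty$, such that for every $j$ and every $\psi_\theta\in\{w_\theta,f_\theta w_\theta,f_\theta^2w_\theta\}$ $$\sqrt n\int\sup_{\theta\in\mathring\Theta}\Big|\Big(\frac{\partial\psi_\theta}{\partial\theta_j}\Big)^{\!*}(t)\Big|\,|K^*(t/C_n)-1|\,dt\longrightarrow0 .\qquad(\ast)$$ For every sequence $C_n>0$ with $C_n\to\infty$ and $(\ast)$, the estimator $\hat\theta_1$ is $\sqrt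 n$-consistent: $\mathbb E\|\hat\theta_1-\theta^0\|^2=O(1/n)$, and $\sqrt n(\hat\theta_1-\theta^0)$ is bounded in probability. Moreover $$\sqrt n(\hat\theta_1-\theta^0)\xrightarrow{\ \mathcal L\ }\mathcal N(0,\Sigma_1),\qquad \Sigma_1=J^{-1}\Sigma_{0,1}J^{-1},\qquad \Sigma_{0,1}=\mathbb E[VV^\top],$$ where $V$ is the square-integrable random vector $$V=\frac1{2\pi}\int\Big(\frac{\partial[f_\theta^2w_\theta-2Yf_\theta w_\theta+(Y^2-\sigma_{\xi,2}^2)w_\theta]}{\partial\theta}\Big|_{\theta=\theta^0}\Big)^{\!*}(u)\,\frac{e^{-iuZ}}{p_\varepsilon^*(-u)}\,du .$$ -/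

import Mathlib

open MeasureTheory ProbabilityTheory Filter Topology
open scoped ENNReal

namespace EIV

/-- The parameter space `ℝ^d` with the Euclidean norm. -/
abbrev Param (d : ℕ) := EuclideanSpace ℝ (Fin d)

/-! ### Fourier transforms and derivatives in the parameter -/

/-- The Fourier transform `φ^*(t) = ∫ e^{itx} φ(x) dx`. -/
noncomputable def fourier (φ : ℝ → ℝ) (t : ℝ) : ℂ :=
  ∫ x : ℝ, Complex.exp (Complex.I * t * x) * (φ x : ℂ)

/-- The partial derivative `∂F_θ(x)/∂θ_j`. -/
noncomputable def pderiv {d : ℕ} (j : Fin d) (F : Param d → ℝ → ℝ) : Param d → ℝ → ℝ :=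
  fun θ x => fderiv ℝ (fun η => F η x) θ (EuclideanSpace.single j 1)

/-- The ratio `φ^* / p^*`. -/
noncomputable def ratio (p φ : ℝ → ℝ) (t : ℝ) : ℂ := fourier φ t / fourier p t

/-- The pointwise supremum `x ↦ sup_{θ ∈ A} |h_θ(x)|`, with values in `[0, ∞]`. -/
noncomputable def supOver {d : ℕ} {β : Type*} [ENorm β] (A : Set (Param d))
    (h : Param d → ℝ → β) (x : ℝ) : ℝ≥0∞ :=
  ⨆ θ ∈ A, ‖h θ x‖ₑ

/-- `h` belongs to `L¹(ℝ) ∩ L²(ℝ)`. -/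
def InL1L2 {β : Type*} [TopologicalSpace β] [ContinuousENorm β] (h : ℝ → β) : Prop :=
  MemLp h 1 ∧ MemLp h 2

/-- The functions `w_θ f_θ^k`; only `k = 0, 1, 2` is used. -/
def wf {d : ℕ} (w f : Param d → ℝ → ℝ) (k : ℕ) : Param d → ℝ → ℝ :=
  fun θ x => w θ x * f θ x ^ k

/-! ### The model -/

/-- The unobserved variables: `(X_i, ξ_i, ε_i)` are i.i.d. triples of independent variables,
`X_i` has density `g` and `ε_i` has density `p`. -/
structure IsSample {Ω : Type*} [MeasurableSpace Ω] (P : Measure Ω) (g p : ℝ → ℝ)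
    (X ξ ε : ℕ → Ω → ℝ) : Prop where
  measurable_design : ∀ i, Measurable (X i)
  measurable_error : ∀ i, Measurable (ξ i)
  measurable_noise : ∀ i, Measurable (ε i)
  indep_triples : iIndepFun (fun i ω => (X i ω, ξ i ω, ε i ω)) P
  indep_components : ∀ i, iIndepFun ![X i, ξ i, ε i] P
  measurable_g : Measurable g
  g_nonneg : ∀ x, 0 ≤ g x
  law_design : ∀ i, P.map (X i) = volume.withDensity (fun x => ENNReal.ofReal (g x))
  measurable_p : Measurable p
  p_nonneg : ∀ x, 0 ≤ p x
  law_noise : ∀ i, P.map (ε i) = volume.withDensity (fun x => ENNReal.ofReal (p x))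
  law_error : ∀ i, IdentDistrib (ξ i) (ξ 0) P P

/-- The response `Y_i = f_{θ⁰}(X_i) + ξ_i`. -/
def response {d : ℕ} {Ω : Type*} (f : Param d → ℝ → ℝ) (θ₀ : Param d) (X ξ : ℕ → Ω → ℝ)
    (i : ℕ) (ω : Ω) : ℝ := f θ₀ (X i ω) + ξ i ω

/-- The observed covariate `Z_i = X_i + ε_i`. -/
def observed {Ω : Type*} (X ε : ℕ → Ω → ℝ) (i : ℕ) (ω : Ω) : ℝ := X i ω + ε i ω

/-- The noise density is square integrable and its Fourier transform has no zero. -/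
def NoiseCondition (p : ℝ → ℝ) : Prop := MemLp p 2 ∧ ∀ t, fourier p t ≠ 0

/-- The variable `ξ` is centred with variance `s2` and a finite fourth moment,
and `f_{θ⁰}(X)` has a finite fourth moment. -/
structure ErrorMoments {d : ℕ} {Ω : Type*} [MeasurableSpace Ω] (P : Measure Ω)
    (f : Param d → ℝ → ℝ) (θ₀ : Param d) (s2 : ℝ) (X ξ : ℕ → Ω → ℝ) : Prop where
  mean : ∫ ω, ξ 0 ω ∂P = 0
  variance : ∫ ω, ξ 0 ω ^ 2 ∂P = s2
  fourth : MemLp (ξ 0) 4 P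
  fourth_reg : MemLp (fun ω => f θ₀ (X 0 ω)) 4 P

/-! ### Assumptions on the regression function and on the weight -/

/-- The regression functions are measurable in `x`; in `θ` they are continuous on `Θ` and of
class `C³` in the interior. -/
structure SmoothRegression {d : ℕ} (Θ : Set (Param d)) (f : Param d → ℝ → ℝ) : Prop where
  measurable : ∀ θ ∈ Θ, Measurable (f θ)
  continuousOn : ∀ x, ContinuousOn (fun θ => f θ x) Θ
  contDiffOn : ∀ x, ContDiffOn ℝ 3 (fun θ => f θ x) (interior Θ)

/-- The weights are nonnegative, measurable in `x`; in `θ` they are continuous on `Θ` and of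
class `C²` in the interior. -/
structure SmoothWeight {d : ℕ} (Θ : Set (Param d)) (w : Param d → ℝ → ℝ) : Prop where
  nonneg : ∀ θ ∈ Θ, ∀ x, 0 ≤ w θ x
  measurable : ∀ θ ∈ Θ, Measurable (w θ)
  continuousOn : ∀ x, ContinuousOn (fun θ => w θ x) Θ
  contDiffOn : ∀ x, ContDiffOn ℝ 2 (fun θ => w θ x) (interior Θ)

/-- A real function of the parameter is twice differentiable in the interior of `Θ`. -/
def TwiceDifferentiable {d : ℕ} (Θ : Set (Param d)) (M : Param d → ℝ) : Prop :=
  ∀ θ ∈ interior Θ, DifferentiableAt ℝ M θ ∧ DifferentiableAt ℝ (fderiv ℝ M) θ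

/-- `E[w_θ(X)² (Y - f_θ(X))⁴]` is finite on `Θ` and has derivatives in `θ` up to order 2. -/
structure WeightedMoments {d : ℕ} {Ω : Type*} [MeasurableSpace Ω] (P : Measure Ω)
    (Θ : Set (Param d)) (f w : Param d → ℝ → ℝ) (X Y : ℕ → Ω → ℝ) : Prop where
  integrable : ∀ θ ∈ Θ,
    Integrable (fun ω => w θ (X 0 ω) ^ 2 * (Y 0 ω - f θ (X 0 ω)) ^ 4) P
  differentiable : TwiceDifferentiable Θ
    (fun θ => ∫ ω, w θ (X 0 ω) ^ 2 * (Y 0 ω - f θ (X 0 ω)) ^ 4 ∂P)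

/-- `f_{θ⁰}² g` and `f_{θ⁰} g` are square integrable. -/
def DesignL2 {d : ℕ} (f : Param d → ℝ → ℝ) (θ₀ : Param d) (g : ℝ → ℝ) : Prop :=
  MemLp (fun x => f θ₀ x ^ 2 * g x) 2 ∧ MemLp (fun x => f θ₀ x * g x) 2

/-- `sup_θ |w_θ f_θ|`, `|w_θ|` and `sup_θ |w_θ f_θ²|` belong to `L¹(ℝ)`. -/
def WeightIntegrability {d : ℕ} (Θ : Set (Param d)) (f w : Param d → ℝ → ℝ) : Prop :=
  MemLp (supOver Θ (wf w f 1)) 1 ∧ (∀ θ ∈ Θ, Integrable (w θ)) ∧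
    MemLp (supOver Θ (wf w f 2)) 1

/-- The theoretical criterion `S(θ) = E[((Y - f_θ(X))² - s2) w_θ(X)]`. -/
noncomputable def contrast {d : ℕ} {Ω : Type*} [MeasurableSpace Ω] (P : Measure Ω)
    (f w : Param d → ℝ → ℝ) (s2 : ℝ) (X Y : ℕ → Ω → ℝ) (θ : Param d) : ℝ :=
  ∫ ω, ((Y 0 ω - f θ (X 0 ω)) ^ 2 - s2) * w θ (X 0 ω) ∂P

/-- The matrix `E[2 w_θ(X) (∂f_θ(X)/∂θ) (∂f_θ(X)/∂θ)ᵀ]` at `θ = θ⁰`. -/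
noncomputable def hessianMatrix {d : ℕ} {Ω : Type*} [MeasurableSpace Ω] (P : Measure Ω)
    (f w : Param d → ℝ → ℝ) (θ₀ : Param d) (X : ℕ → Ω → ℝ) : Matrix (Fin d) (Fin d) ℝ :=
  Matrix.of fun i j =>
    ∫ ω, 2 * w θ₀ (X 0 ω) * (pderiv i f θ₀ (X 0 ω) * pderiv j f θ₀ (X 0 ω)) ∂P

/-- The criterion has a unique minimum on `Θ`, at `θ⁰`; it is twice differentiable and its
Hessian matrix at `θ⁰` is `E[2 w (∂f)(∂f)ᵀ]`, which is positive definite. -/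
structure Identifiability {d : ℕ} {Ω : Type*} [MeasurableSpace Ω] (P : Measure Ω)
    (Θ : Set (Param d)) (f w : Param d → ℝ → ℝ) (θ₀ : Param d) (s2 : ℝ)
    (X Y : ℕ → Ω → ℝ) : Prop where
  unique_min : ∀ θ ∈ Θ, θ ≠ θ₀ → contrast P f w s2 X Y θ₀ < contrast P f w s2 X Y θ
  differentiable : TwiceDifferentiable Θ (contrast P f w s2 X Y)
  hessian : ∀ i j, fderiv ℝ (fderiv ℝ (contrast P f w s2 X Y)) θ₀
    (EuclideanSpace.single i 1) (EuclideanSpace.single j 1) = hessianMatrix P f w θ₀ X i j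
  posDef : (hessianMatrix P f w θ₀ X).PosDef

/-- The conditions on the ratios `(w_θ f_θ^k)^* / p^*`, `k = 0, 1, 2`, and on those of their
derivatives in `θ` up to order 2. -/
structure RatioConditions {d : ℕ} (Θ : Set (Param d)) (f w : Param d → ℝ → ℝ)
    (p : ℝ → ℝ) : Prop where
  integrable : ∀ k ≤ 2, ∀ θ ∈ Θ, Integrable (wf w f k θ)
  ratio_w : ∀ θ ∈ Θ, InL1L2 (ratio p (w θ))
  sup_ratio_wf : InL1L2 (supOver Θ (fun θ => ratio p (wf w f 1 θ)))
  sup_ratio_wf_sq : InL1L2 (supOver Θ (fun θ => ratio p (wf w f 2 θ)))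
  integrable_deriv : ∀ k ≤ 2, ∀ j, ∀ θ ∈ interior Θ, Integrable (pderiv j (wf w f k) θ)
  sup_ratio_deriv : ∀ k ≤ 2, ∀ j,
    InL1L2 (supOver (interior Θ) (fun θ => ratio p (pderiv j (wf w f k) θ)))
  integrable_deriv₂ : ∀ k ≤ 2, ∀ i j, ∀ θ ∈ interior Θ,
    Integrable (pderiv i (pderiv j (wf w f k)) θ)
  ratio_deriv₂ : ∀ k ≤ 2, ∀ i j, ∀ θ ∈ interior Θ,
    InL1L2 (ratio p (pderiv i (pderiv j (wf w f k)) θ))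

/-! ### The deconvolution kernel and the estimator -/

/-- `κ` is an admissible Fourier transform `K^*` of a real kernel `K`: compactly supported, with
`|1 - K^*(t)| ≤ 1_{|t| ≥ 1}`; the symmetry says that `K` is real. -/
structure IsKernelTransform (κ : ℝ → ℂ) : Prop where
  measurable : Measurable κ
  compactSupport : HasCompactSupport κ
  symm : ∀ t, κ (-t) = (starRingEnd ℂ) (κ t)
  bound : ∀ t, ‖1 - κ t‖ ≤ Set.indicator {s : ℝ | 1 ≤ |s|} (fun _ => (1 : ℝ)) t

/-- The deconvolution kernel `K_{n,C}`, whose Fourier transform is `K^*(t/C) / p^*(t)`: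
`K_{n,C}(x) = (2π)⁻¹ ∫ e^{-itx} K^*(t/C) / p^*(t) dt`, a real number by the symmetry of `K^*`. -/
noncomputable def deconvKernel (κ : ℝ → ℂ) (p : ℝ → ℝ) (C x : ℝ) : ℝ :=
  ((2 * Real.pi : ℂ)⁻¹ *
    ∫ t : ℝ, Complex.exp (-(Complex.I * t * x)) * (κ (t / C) / fourier p t)).re

/-- The empirical criterion
`S_n(θ) = n⁻¹ ∑_{i<n} ∫ [(y_i - f_θ(x))² - s2] w_θ(x) K_{n,C}(x - z_i) dx`. -/
noncomputable def empContrast {d : ℕ} (f w : Param d → ℝ → ℝ) (s2 : ℝ) (κ : ℝ → ℂ)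
    (p : ℝ → ℝ) (C : ℝ) (n : ℕ) (y z : ℕ → ℝ) (θ : Param d) : ℝ :=
  (n : ℝ)⁻¹ * ∑ i ∈ Finset.range n,
    ∫ x : ℝ, ((y i - f θ x) ^ 2 - s2) * w θ x * deconvKernel κ p C (x - z i)

/-- `θhat n` is a minimizer over `Θ` of the empirical criterion built on the first `n`
observations with the bandwidth parameter `C n`. -/
structure IsEstimator {d : ℕ} {Ω : Type*} [MeasurableSpace Ω] (P : Measure Ω)
    (Θ : Set (Param d)) (f w : Param d → ℝ → ℝ) (s2 : ℝ) (κ : ℝ → ℂ) (p : ℝ → ℝ)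
    (C : ℕ → ℝ) (Y Z : ℕ → Ω → ℝ) (θhat : ℕ → Ω → Param d) : Prop where
  aemeasurable : ∀ n, AEMeasurable (θhat n) P
  mem : ∀ n, ∀ᵐ ω ∂P, θhat n ω ∈ Θ
  isMin : ∀ n, ∀ᵐ ω ∂P, ∀ θ ∈ Θ,
    empContrast f w s2 κ p (C n) n (fun i => Y i ω) (fun i => Z i ω) (θhat n ω) ≤
      empContrast f w s2 κ p (C n) n (fun i => Y i ω) (fun i => Z i ω) θ

/-- The sequences `C_n → ∞` for which the smoothing bias of the gradient of the criterion is
negligible: `√n ∫ sup_θ |(∂(w_θ f_θ^k)/∂θ_j)^*(t)| |K^*(t/C_n) - 1| dt → 0`. -/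
structure IsBandwidth {d : ℕ} (Θ : Set (Param d)) (f w : Param d → ℝ → ℝ) (κ : ℝ → ℂ)
    (C : ℕ → ℝ) : Prop where
  pos : ∀ n, 0 < C n
  tendsto : Tendsto C atTop atTop
  bias : ∀ k ≤ 2, ∀ j, Tendsto (fun n : ℕ => ENNReal.ofReal (Real.sqrt n) *
    ∫⁻ t : ℝ, supOver (interior Θ) (fun θ => fourier (pderiv j (wf w f k) θ)) t
      * ‖κ (t / C n) - 1‖ₑ) atTop (𝓝 0)

/-! ### The limit -/

/-- The `j`-th coordinate of
`(2π)⁻¹ ∫ (∂[f_θ² w_θ - 2 y f_θ w_θ + (y² - s2) w_θ]/∂θ at θ⁰)^*(u) e^{-iuz} / p^*(-u) du`;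
the integral is real, as its integrand at `-u` is the conjugate of its integrand at `u`. -/
noncomputable def score {d : ℕ} (f w : Param d → ℝ → ℝ) (θ₀ : Param d) (s2 : ℝ) (p : ℝ → ℝ)
    (y z : ℝ) (j : Fin d) : ℝ :=
  ((2 * Real.pi : ℂ)⁻¹ * ∫ u : ℝ,
    fourier (pderiv j (fun θ x => f θ x ^ 2 * w θ x - 2 * y * (f θ x * w θ x)
      + (y ^ 2 - s2) * w θ x) θ₀) u
      * Complex.exp (-(Complex.I * u * z)) / fourier p (-u)).re

/-- The matrix `Σ_{0,1} = E[V Vᵀ]`, with `V` the score at `(Y, Z)`. -/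
noncomputable def scoreMatrix {d : ℕ} {Ω : Type*} [MeasurableSpace Ω] (P : Measure Ω)
    (f w : Param d → ℝ → ℝ) (θ₀ : Param d) (s2 : ℝ) (p : ℝ → ℝ) (Y Z : ℕ → Ω → ℝ) :
    Matrix (Fin d) (Fin d) ℝ :=
  Matrix.of fun i j =>
    ∫ ω, score f w θ₀ s2 p (Y 0 ω) (Z 0 ω) i * score f w θ₀ s2 p (Y 0 ω) (Z 0 ω) j ∂P

/-- The asymptotic covariance `Σ_1 = J⁻¹ Σ_{0,1} J⁻¹`. -/
noncomputable def asympCov {d : ℕ} {Ω : Type*} [MeasurableSpace Ω] (P : Measure Ω)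
    (f w : Param d → ℝ → ℝ) (θ₀ : Param d) (s2 : ℝ) (p : ℝ → ℝ) (X Y Z : ℕ → Ω → ℝ) :
    Matrix (Fin d) (Fin d) ℝ :=
  (hessianMatrix P f w θ₀ X)⁻¹ * scoreMatrix P f w θ₀ s2 p Y Z * (hessianMatrix P f w θ₀ X)⁻¹

/-- `√n`-consistency: the quadratic risk is `O(1/n)`, and `√n (θhat n - θ⁰)` is bounded in
probability. -/
def SqrtConsistent {d : ℕ} {Ω : Type*} [MeasurableSpace Ω] (P : Measure Ω) (θ₀ : Param d)
    (θhat : ℕ → Ω → Param d) : Prop :=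
  (∃ M : ℝ, ∀ n : ℕ, 1 ≤ n → ∫ ω, ‖θhat n ω - θ₀‖ ^ 2 ∂P ≤ M / n) ∧
  (∀ δ : ℝ, 0 < δ → ∃ M : ℝ, ∀ n : ℕ,
    P {ω | M < Real.sqrt n * ‖θhat n ω - θ₀‖} ≤ ENNReal.ofReal δ)

end EIV

namespace EIV

open scoped SchwartzMap

/-! ### Elementary properties of the Fourier transform -/

/-! Everything is read on the Fourier side. Put `ψ_k = w f^k` and let `c_k(y)` be the coefficients
of `(y - f)² - s2` as a polynomial in `f`. Fourier inversion and the independence of the noise,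
which gives `E[c(Y) e^{-iuZ}] = E[c(Y) e^{-iuX}] p^*(-u)`, turn the criterion into `S(θ) = Re ∑_k ∫
ψ_{k,θ}^*(u) χ(u) E[c_k(Y) e^{-iuZ}] du` with `χ(u) = (2π)⁻¹ / p^*(-u)`. The empirical criterion is
the same expression with the expectation replaced by `K^*(-u/C_n)` times the empirical mean. So `θ`
enters only through the deterministic factor `ψ_θ^* χ` and the randomness only through the
deviations `Δ_n(u)` of empirical characteristic functions, for which `E|Δ_n(u)|² ≤ const / n`. A
dominating integrable function in `u` therefore bounds `S_n - S` uniformly in `θ`, with no chaining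
(`exists_pairingDev_le`, `exists_pairingDev_sub_le`). The smoothing bias of the increments is
`o(n^{-1/2})`: the factor `p^*` in the mean cancels the one in `χ`, leaving the bandwidth condition
(`tendsto_bias`).

Two points need care. First, for fixed `u` nothing allows `ψ_θ^*(u)` to be differentiated in `θ`
under the integral. Tested against a Schwartz function, however, the pairing moves to the `x` side,
where `∂ψ_θ` is bounded because its transform is dominated in `L¹`; so the pairing is differentiable
(`hasFDerivAt_pairing`). The mean value inequality for all tests then returns an almost everywhere
Lipschitz bound for `ψ_θ^*` (`ae_enorm_le_of_schwartz`). By density, `∫ ψ_θ^* χ ζ` has a first order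
expansion at `θ⁰` for each fixed bounded `ζ`.

Second, the expansion is wanted with the random `Δ_n` as `ζ`, uniformly to order `o(‖θ - θ⁰‖ / √n)`,
while the second derivatives have no common bound. Rounding `Z` to finitely many values writes `Δ_n`
as a finite combination of fixed exponentials with coefficients of order `n^{-1/2}`, plus an error
whose weighted norm is a small multiple of `n^{-1/2}` in mean. The expansion is then needed for
finitely many fixed functions only (`exists_pairingDev_taylor_le`).

The rest is minimum contrast estimation without differentiating `S_n`. Quadratic growth of `S` at
`θ⁰`, separation elsewhere by compactness and the Lipschitz bound on `S_n - S` give the mean square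
rate (`exists_lintegral_sq_norm_le`). Near `θ⁰` the increment of `S_n` is `½ B(h, h) - B(T_n, h)` up
to small errors, where `B` is the Hessian form of `S` and `T_n` is the mean of `-J⁻¹ V`. Comparing
the values at the estimator and at `θ⁰ + T_n` shows that the two differ by `o(n^{-1/2})` in
probability (`tendsto_meas_sqrt_mul_norm_sub`). The score is centred because `θ⁰` is an interior
minimum, so the central limit theorem applies to `T_n`. -/

theorem norm_cexp_I_mul (t x : ℝ) : ‖Complex.exp (Complex.I * t * x)‖ = 1 := by
  rw [mul_assoc, ← Complex.ofReal_mul, mul_comm]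
  exact Complex.norm_exp_ofReal_mul_I _

theorem norm_cexp_neg_I_mul (t x : ℝ) : ‖Complex.exp (-(Complex.I * t * x))‖ = 1 := by
  have := norm_cexp_I_mul (-t) x
  simpa using this

theorem continuous_fourier {φ : ℝ → ℝ} (hφ : Integrable φ) : Continuous (fourier φ) := by
  refine continuous_of_dominated (bound := fun x => |φ x|) (fun t => ?_) (fun t => ?_) hφ.abs ?_
  · exact (Continuous.aestronglyMeasurable (by fun_prop)).mul hφ.ofReal.aestronglyMeasurable
  · refine ae_of_all _ fun x => ?_
    rw [norm_mul, norm_cexp_I_mul, one_mul, Complex.norm_real, Real.norm_eq_abs]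
  · exact ae_of_all _ fun x => by fun_prop

theorem fourier_neg (φ : ℝ → ℝ) (t : ℝ) : fourier φ (-t) = (starRingEnd ℂ) (fourier φ t) := by
  rw [fourier, fourier, ← integral_conj]
  congr 1 with x
  rw [map_mul, ← Complex.exp_conj]
  simp

theorem norm_fourier_neg (φ : ℝ → ℝ) (t : ℝ) : ‖fourier φ (-t)‖ = ‖fourier φ t‖ := by
  rw [fourier_neg, RCLike.norm_conj]

theorem fourier_sum_mul {ι : Type*} (s : Finset ι) (c : ι → ℝ) {φ : ι → ℝ → ℝ}
    (hφ : ∀ i ∈ s, Integrable (φ i)) (t : ℝ) :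
    fourier (fun x => ∑ i ∈ s, c i * φ i x) t = ∑ i ∈ s, (c i : ℂ) * fourier (φ i) t := by
  simp only [fourier]
  simp_rw [← integral_const_mul]
  rw [← integral_finsetSum]
  · congr 1 with x
    push_cast
    rw [Finset.mul_sum]
    exact Finset.sum_congr rfl fun i _ => by ring
  · intro i hi
    refine Integrable.const_mul ?_ _
    exact (hφ i hi).ofReal.bdd_mul (c := 1) (Continuous.aestronglyMeasurable (by fun_prop))
      (ae_of_all _ fun x => (norm_cexp_I_mul t x).le)

/-- The Fourier transform `x ↦ ∫ e^{iux} η(u) du` of a complex function. -/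
noncomputable def cfourier (η : ℝ → ℂ) (x : ℝ) : ℂ :=
  ∫ u : ℝ, Complex.exp (Complex.I * u * x) * η u

/-- Fubini. This duality moves a test function from the frequency side to the `x` side, where
regularity in `θ` is assumed. -/
theorem integral_fourier_mul {φ : ℝ → ℝ} (hφ : Integrable φ) {η : ℝ → ℂ} (hη : Integrable η) :
    ∫ u, fourier φ u * η u = ∫ x, (φ x : ℂ) * cfourier η x := by
  have hint : Integrable (Function.uncurry fun u x : ℝ =>
      Complex.exp (Complex.I * u * x) * (φ x : ℂ) * η u) := by
    have h1 : Integrable (fun z : ℝ × ℝ => η z.1 * (φ z.2 : ℂ)) (volume.prod volume) :=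
      hη.mul_prod hφ.ofReal
    refine (h1.bdd_mul (c := 1) (f := fun z : ℝ × ℝ => Complex.exp (Complex.I * z.1 * z.2))
      (Continuous.aestronglyMeasurable (by fun_prop))
      (ae_of_all _ fun z => (norm_cexp_I_mul _ _).le)).congr (ae_of_all _ fun z => ?_)
    simp only [Function.uncurry]
    ring
  calc ∫ u, fourier φ u * η u
      = ∫ u : ℝ, ∫ x : ℝ, Complex.exp (Complex.I * u * x) * (φ x : ℂ) * η u := by
        congr 1 with u
        rw [fourier, integral_mul_const]
    _ = ∫ x : ℝ, ∫ u : ℝ, Complex.exp (Complex.I * u * x) * (φ x : ℂ) * η u :=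
        integral_integral_swap hint
    _ = ∫ x, (φ x : ℂ) * cfourier η x := by
        congr 1 with x
        rw [cfourier, ← integral_const_mul]
        congr 1 with u
        ring

/-- Passage to the normalization `e^{-2πiux}`, so that stability of the Schwartz space and inversion
on it can be used. -/
theorem cfourier_eq (η : ℝ → ℂ) (x : ℝ) :
    cfourier η x = FourierTransform.fourier η (x / (-(2 * Real.pi))) := by
  rw [Real.fourier_real_eq_integral_exp_smul, cfourier]
  refine integral_congr_ae (ae_of_all _ fun u => ?_)
  have : (Real.pi : ℂ) ≠ 0 := by exact_mod_cast Real.pi_ne_zero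
  dsimp only
  rw [smul_eq_mul]
  congr 2
  push_cast
  field_simp

theorem integrable_cfourier (η : 𝓢(ℝ, ℂ)) : Integrable (cfourier η) := by
  have h : Integrable (fun x => (FourierTransform.fourier η : 𝓢(ℝ, ℂ)) x) :=
    SchwartzMap.integrable _
  have h2 := h.comp_div (R := -(2 * Real.pi)) (by simp [Real.pi_ne_zero])
  refine h2.congr (ae_of_all _ fun x => ?_)
  dsimp only
  rw [cfourier_eq, SchwartzMap.fourier_coe]

theorem norm_cfourier_le (η : ℝ → ℂ) (x : ℝ) : ‖cfourier η x‖ ≤ ∫ u, ‖η u‖ := by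
  refine (norm_integral_le_integral_norm _).trans (le_of_eq ?_)
  refine integral_congr_ae (ae_of_all _ fun u => ?_)
  dsimp only
  rw [norm_mul, norm_cexp_I_mul, one_mul]

/-- The inverse Fourier transform `u ↦ (2π)⁻¹ ∫ e^{-iux} g(x) dx`. -/
noncomputable def invFourier (g : ℝ → ℂ) (u : ℝ) : ℂ :=
  (2 * Real.pi : ℂ)⁻¹ * ∫ x : ℝ, Complex.exp (-(Complex.I * u * x)) * g x

theorem invFourier_eq (g : ℝ → ℂ) (u : ℝ) :
    invFourier g u = (2 * Real.pi : ℂ)⁻¹ * FourierTransform.fourier g (u / (2 * Real.pi)) := by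
  rw [Real.fourier_real_eq_integral_exp_smul, invFourier]
  congr 1
  refine integral_congr_ae (ae_of_all _ fun x => ?_)
  have hpi : (Real.pi : ℂ) ≠ 0 := by exact_mod_cast Real.pi_ne_zero
  dsimp only
  rw [smul_eq_mul]
  congr 2
  push_cast
  field_simp

theorem integrable_invFourier (g : 𝓢(ℝ, ℂ)) : Integrable (invFourier g) := by
  have h : Integrable (fun x => (FourierTransform.fourier g : 𝓢(ℝ, ℂ)) x) :=
    SchwartzMap.integrable _
  have h2 := (h.comp_div (R := 2 * Real.pi) (by simp [Real.pi_ne_zero])).const_mul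
    (2 * Real.pi : ℂ)⁻¹
  refine h2.congr (ae_of_all _ fun x => ?_)
  dsimp only
  rw [invFourier_eq, SchwartzMap.fourier_coe]

theorem cfourier_invFourier (g : 𝓢(ℝ, ℂ)) (x : ℝ) : cfourier (invFourier g) x = g x := by
  have hpi : (Real.pi : ℂ) ≠ 0 := by exact_mod_cast Real.pi_ne_zero
  have h1 : FourierTransformInv.fourierInv (FourierTransform.fourier g) x = g x := by
    rw [FourierTransform.fourierInv_fourier_eq]
  rw [← h1, SchwartzMap.fourierInv_coe, Real.fourierInv_eq', SchwartzMap.fourier_coe]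
  have h2 := Measure.integral_comp_div (fun v : ℝ =>
    Complex.exp (((2 * Real.pi * inner ℝ v x : ℝ) : ℂ) * Complex.I) •
      (FourierTransform.fourier (g : ℝ → ℂ)) v) (2 * Real.pi)
  have h3 : |2 * Real.pi| ≠ 0 := by simp [Real.pi_ne_zero]
  have h4 := congrArg (fun z => |2 * Real.pi|⁻¹ • z) h2
  rw [smul_smul, inv_mul_cancel₀ h3, one_smul, ← integral_smul] at h4
  rw [← h4, cfourier]
  refine integral_congr_ae (ae_of_all _ fun u => ?_)
  dsimp only
  rw [invFourier_eq, abs_of_pos Real.two_pi_pos, smul_eq_mul, Complex.real_smul,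
    RCLike.inner_apply, conj_trivial]
  push_cast
  have : Complex.exp (2 * Real.pi * (x * (u / (2 * Real.pi))) * Complex.I)
      = Complex.exp (Complex.I * u * x) := by
    congr 1
    field_simp
  rw [this]
  ring

theorem continuous_invFourier {g : ℝ → ℂ} (hg : Integrable g) : Continuous (invFourier g) := by
  refine continuous_const.mul (continuous_of_dominated (bound := fun x => ‖g x‖)
    (fun t => ?_) (fun t => ?_) hg.norm ?_)
  · exact (Continuous.aestronglyMeasurable (by fun_prop)).mul hg.aestronglyMeasurable
  · refine ae_of_all _ fun x => ?_
    rw [norm_mul, norm_cexp_neg_I_mul, one_mul]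
  · exact ae_of_all _ fun x => by fun_prop

theorem integral_mul_invFourier {h g : ℝ → ℂ} (hh : Integrable h) (hg : Integrable g) :
    ∫ u, h u * invFourier g u = ∫ x, g x * invFourier h x := by
  have hint : Integrable (Function.uncurry fun u x : ℝ =>
      h u * ((2 * Real.pi : ℂ)⁻¹ * (Complex.exp (-(Complex.I * u * x)) * g x))) := by
    have h1 : Integrable (fun z : ℝ × ℝ => h z.1 * g z.2) (volume.prod volume) := hh.mul_prod hg
    refine (((h1.bdd_mul (c := 1)
      (f := fun z : ℝ × ℝ => Complex.exp (-(Complex.I * z.1 * z.2)))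
      (Continuous.aestronglyMeasurable (by fun_prop))
      (ae_of_all _ fun z => (norm_cexp_neg_I_mul _ _).le)).const_mul
        (2 * Real.pi : ℂ)⁻¹)).congr (ae_of_all _ fun z => ?_)
    simp only [Function.uncurry]
    ring
  calc ∫ u, h u * invFourier g u
      = ∫ u : ℝ, ∫ x : ℝ,
          h u * ((2 * Real.pi : ℂ)⁻¹ * (Complex.exp (-(Complex.I * u * x)) * g x)) := by
        refine integral_congr_ae (ae_of_all _ fun u => ?_)
        dsimp only
        rw [integral_const_mul, integral_const_mul, invFourier]
    _ = ∫ x : ℝ, ∫ u : ℝ,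
          h u * ((2 * Real.pi : ℂ)⁻¹ * (Complex.exp (-(Complex.I * u * x)) * g x)) :=
        integral_integral_swap hint
    _ = ∫ x, g x * invFourier h x := by
        refine integral_congr_ae (ae_of_all _ fun x => ?_)
        dsimp only
        rw [invFourier, ← mul_assoc, mul_comm (g x), mul_assoc, ← integral_const_mul,
          ← integral_const_mul]
        refine integral_congr_ae (ae_of_all _ fun u => ?_)
        dsimp only
        rw [show Complex.I * (u : ℂ) * x = Complex.I * x * u by ring]
        ring

/-- Fourier inversion almost everywhere, for integrable functions with integrable transform. -/
theorem ae_eq_invFourier {φ : ℝ → ℝ} (hφ : Integrable φ) (hφ' : Integrable (fourier φ)) :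
    ∀ᵐ x, (φ x : ℂ) = invFourier (fourier φ) x := by
  -- It suffices to test against smooth compactly supported `g`. Such a `g` is Schwartz, hence
  -- equals `cfourier (invFourier g)`, and two uses of duality move the transform from `g` to `φ`
  -- and back.
  refine ae_eq_of_integral_contDiff_smul_eq hφ.ofReal.locallyIntegrable
    (continuous_invFourier hφ').locallyIntegrable fun g hg hgc => ?_
  have hgc' : HasCompactSupport (fun x => (g x : ℂ)) :=
    hgc.comp_left (g := fun y : ℝ => (y : ℂ)) (by simp)
  have hg' : ContDiff ℝ (↑(⊤ : ℕ∞)) (fun x => (g x : ℂ)) := Complex.ofRealCLM.contDiff.comp hg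
  let γ : 𝓢(ℝ, ℂ) := hgc'.toSchwartzMap hg'
  have hγ : ∀ x, γ x = (g x : ℂ) := fun x => rfl
  have h1 := integral_fourier_mul hφ (integrable_invFourier γ)
  have h2 := integral_mul_invFourier hφ' γ.integrable
  rw [h1] at h2
  simp_rw [cfourier_invFourier] at h2
  calc ∫ x, g x • (φ x : ℂ) = ∫ x, (φ x : ℂ) * γ x :=
        integral_congr_ae (ae_of_all _ fun x => by simp [hγ, mul_comm])
    _ = ∫ x, γ x * invFourier (fourier φ) x := h2
    _ = ∫ x, g x • invFourier (fourier φ) x :=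
        integral_congr_ae (ae_of_all _ fun x => by simp [hγ])

theorem norm_invFourier_le (h : ℝ → ℂ) (x : ℝ) : ‖invFourier h x‖ ≤ ∫ u, ‖h u‖ := by
  rw [invFourier, norm_mul]
  have h1 : ‖(2 * Real.pi : ℂ)⁻¹‖ ≤ 1 := by
    rw [norm_inv]
    apply inv_le_one_of_one_le₀
    rw [norm_mul, Complex.norm_real, Real.norm_eq_abs, abs_of_pos Real.pi_pos]
    have := Real.pi_gt_three
    norm_num
    linarith
  have h2 : ‖∫ u : ℝ, Complex.exp (-(Complex.I * x * u)) * h u‖ ≤ ∫ u, ‖h u‖ := by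
    refine (norm_integral_le_integral_norm _).trans (le_of_eq ?_)
    refine integral_congr_ae (ae_of_all _ fun u => ?_)
    dsimp only
    rw [norm_mul, norm_cexp_neg_I_mul, one_mul]
  calc _ ≤ 1 * ∫ u, ‖h u‖ := by gcongr
    _ = _ := one_mul _

/-- By inversion, the sup norm is at most the `L¹` norm of the transform. This converts domination
in frequency into boundedness in `x`. -/
theorem ae_abs_le_of_enorm_fourier_le {φ : ℝ → ℝ} (hφ : Integrable φ) {G : ℝ → ℝ≥0∞}
    (hG : ∫⁻ u, G u ≠ ∞) (h : ∀ᵐ u, ‖fourier φ u‖ₑ ≤ G u) :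
    Integrable (fourier φ) ∧ ∀ᵐ x, |φ x| ≤ (∫⁻ u, G u).toReal := by
  have hle : ∫⁻ u, ‖fourier φ u‖ₑ ≤ ∫⁻ u, G u := lintegral_mono_ae h
  have hint : Integrable (fourier φ) :=
    ⟨(continuous_fourier hφ).aestronglyMeasurable, hle.trans_lt hG.lt_top⟩
  refine ⟨hint, ?_⟩
  filter_upwards [ae_eq_invFourier hφ hint] with x hx
  have h1 := norm_invFourier_le (fourier φ) x
  rw [← hx, Complex.norm_real, Real.norm_eq_abs] at h1
  refine h1.trans ?_
  rw [integral_norm_eq_lintegral_enorm hint.aestronglyMeasurable]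
  exact ENNReal.toReal_mono hG hle

/-! ### Domination tested on Schwartz functions -/

/-- Smooth compactly supported functions are dense in `L¹` of a finite measure. -/
theorem exists_schwartz_lintegral_sub_le {μ : Measure ℝ} [IsFiniteMeasure μ] {χ : ℝ → ℂ}
    (hχ : Integrable χ μ) {ε : ℝ} (hε : 0 < ε) :
    ∃ η : 𝓢(ℝ, ℂ), ∫⁻ u, ‖χ u - η u‖ₑ ∂μ ≤ ENNReal.ofReal ε := by
  obtain ⟨g, hg, hg', h⟩ := MemLp.exist_eLpNorm_sub_le (p := 1) (by simp) le_rfl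
    (memLp_one_iff_integrable.2 hχ) hε
  refine ⟨hg.toSchwartzMap hg', ?_⟩
  rw [eLpNorm_one_eq_lintegral_enorm] at h
  exact h

/-- Duality: by density the inequality extends from Schwartz functions to bounded measurable ones,
and the phase of `D` on an arbitrary measurable set then yields the pointwise bound. -/
theorem ae_enorm_le_of_schwartz {D : ℝ → ℂ} (hDm : Measurable D) (hD : Integrable D)
    {G : ℝ → ℝ≥0∞} (hGm : AEMeasurable G) (hG : ∫⁻ u, G u ≠ ∞)
    (h : ∀ η : 𝓢(ℝ, ℂ), ‖∫ u, D u * η u‖ₑ ≤ ∫⁻ u, G u * ‖η u‖ₑ) :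
    ∀ᵐ u, ‖D u‖ₑ ≤ G u := by
  -- With the density `‖D‖ + G`, a single approximation controls the errors on both sides of the
  -- inequality.
  set W : ℝ → ℝ≥0∞ := fun u => ‖D u‖ₑ + G u with hW
  have hWm : AEMeasurable W := hDm.enorm.aemeasurable.add hGm
  have hWfin : ∫⁻ u, W u ≠ ∞ := by
    rw [hW, lintegral_add_left hDm.enorm]
    exact ENNReal.add_ne_top.2 ⟨hD.2.ne, hG⟩
  have : IsFiniteMeasure (volume.withDensity W) := isFiniteMeasure_withDensity hWfin
  have key : ∀ χ : ℝ → ℂ, Measurable χ → (∀ u, ‖χ u‖ ≤ 1) →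
      ‖∫ u, D u * χ u‖ₑ ≤ ∫⁻ u, G u * ‖χ u‖ₑ := by
    intro χ hχm hχ
    have hχi : Integrable χ (volume.withDensity W) :=
      Integrable.of_bound hχm.aestronglyMeasurable 1 (ae_of_all _ hχ)
    refine ENNReal.le_of_forall_pos_le_add fun ε hε _ => ?_
    obtain ⟨η, hη⟩ := exists_schwartz_lintegral_sub_le hχi (ε := ε) (by exact_mod_cast hε)
    rw [lintegral_withDensity_eq_lintegral_mul₀ hWm (g := fun u => ‖χ u - η u‖ₑ)
      ((hχm.sub η.continuous.measurable).enorm.aemeasurable)] at hη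
    simp only [Pi.mul_apply, hW, add_mul] at hη
    rw [lintegral_add_left (f := fun u => ‖D u‖ₑ * ‖χ u - η u‖ₑ)
      ((hDm.enorm.mul (hχm.sub η.continuous.measurable).enorm))] at hη
    have hDχ : Integrable (fun u => D u * χ u) :=
      hD.mul_bdd (c := 1) hχm.aestronglyMeasurable (ae_of_all _ hχ)
    have hDη : Integrable (fun u => D u * η u) := by
      obtain ⟨c, hc⟩ := η.toBoundedContinuousFunction.isBounded_range.exists_norm_le
      exact hD.mul_bdd (c := c) η.continuous.aestronglyMeasurable
        (ae_of_all _ fun u => hc _ ⟨u, rfl⟩)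
    have e1 : ∫ u, D u * χ u = (∫ u, D u * (χ u - η u)) + ∫ u, D u * η u := by
      rw [← integral_add ((hDχ.sub hDη).congr (ae_of_all _ fun u => by simp [mul_sub])) hDη]
      refine integral_congr_ae (ae_of_all _ fun u => ?_)
      ring
    calc ‖∫ u, D u * χ u‖ₑ ≤ ‖∫ u, D u * (χ u - η u)‖ₑ + ‖∫ u, D u * η u‖ₑ := by
          rw [e1]; exact enorm_add_le _ _
      _ ≤ (∫⁻ u, ‖D u‖ₑ * ‖χ u - η u‖ₑ) + ∫⁻ u, G u * ‖η u‖ₑ := by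
          refine add_le_add ((enorm_integral_le_lintegral_enorm _).trans_eq ?_) (h η)
          simp_rw [enorm_mul]
      _ ≤ (∫⁻ u, ‖D u‖ₑ * ‖χ u - η u‖ₑ) +
          ((∫⁻ u, G u * ‖χ u‖ₑ) + ∫⁻ u, G u * ‖χ u - η u‖ₑ) := by
          rw [← lintegral_add_left' (f := fun u => G u * ‖χ u‖ₑ)
            (hGm.mul hχm.enorm.aemeasurable)]
          gcongr with u
          rw [← mul_add]
          gcongr
          rw [enorm_sub_rev]
          calc ‖η u‖ₑ = ‖χ u + (η u - χ u)‖ₑ := by congr 1; ring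
            _ ≤ _ := enorm_add_le _ _
      _ = (∫⁻ u, G u * ‖χ u‖ₑ) +
          ((∫⁻ u, ‖D u‖ₑ * ‖χ u - η u‖ₑ) + ∫⁻ u, G u * ‖χ u - η u‖ₑ) := by ring
      _ ≤ _ := by
          gcongr
          exact hη.trans_eq ENNReal.ofReal_coe_nnreal
  refine ae_le_of_forall_setLIntegral_le_of_sigmaFinite hDm.enorm fun s hs _ => ?_
  -- The conjugate phase of `D` on `s`, so that `D χ = ‖D‖` there; where `D = 0` the quotient is `0`
  -- by convention, which is harmless.
  set χ : ℝ → ℂ := s.indicator fun u => (starRingEnd ℂ) (D u) / (‖D u‖ : ℂ) with hχdef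
  have hχm : Measurable χ := Measurable.indicator (by fun_prop) hs
  have hχ1 : ∀ u, ‖χ u‖ ≤ s.indicator (fun _ => (1 : ℝ)) u := by
    intro u
    by_cases hu : u ∈ s
    · simp only [hχdef, Set.indicator_of_mem hu, norm_div, RCLike.norm_conj, Complex.norm_real,
        norm_norm]
      exact div_self_le_one _
    · simp [hχdef, hu]
  have hχ : ∀ u, ‖χ u‖ ≤ 1 := fun u => (hχ1 u).trans (Set.indicator_le_self' (by simp) u)
  have hprod : ∀ u, D u * χ u = ((s.indicator (fun u => ‖D u‖) u : ℝ) : ℂ) := by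
    intro u
    by_cases hu : u ∈ s
    · simp only [hχdef, Set.indicator_of_mem hu]
      by_cases h0 : D u = 0
      · simp [h0]
      · have h0' : (‖D u‖ : ℂ) ≠ 0 := by exact_mod_cast norm_ne_zero_iff.2 h0
        rw [mul_div_assoc', Complex.mul_conj, Complex.normSq_eq_norm_sq, div_eq_iff h0']
        push_cast
        ring
    · simp [hχdef, hu]
  have h3 := key χ hχm hχ
  simp_rw [hprod] at h3
  rw [integral_complex_ofReal, integral_indicator hs] at h3
  have e : ‖((∫ u in s, ‖D u‖ : ℝ) : ℂ)‖ₑ = ∫⁻ u in s, ‖D u‖ₑ := by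
    rw [integral_norm_eq_lintegral_enorm hDm.aestronglyMeasurable, ← ofReal_norm,
      Complex.norm_real, Real.norm_eq_abs, abs_of_nonneg ENNReal.toReal_nonneg,
      ENNReal.ofReal_toReal]
    exact (hD.integrableOn (s := s)).2.ne
  rw [e] at h3
  refine h3.trans ?_
  rw [← lintegral_indicator hs]
  refine lintegral_mono fun u => ?_
  by_cases hu : u ∈ s
  · rw [Set.indicator_of_mem hu]
    calc G u * ‖χ u‖ₑ ≤ G u * 1 := by
          gcongr
          rw [← ofReal_norm]
          exact ENNReal.ofReal_le_one.2 (hχ u)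
      _ = G u := mul_one _
  · simp [hχdef, hu]

end EIV

namespace EIV

open scoped SchwartzMap

/-! ### Families of functions with dominated spectral gradient -/

/-- A family `ψ_θ` of integrable functions, of class `C¹` in `θ ∈ interior Θ` and continuous on `Θ`,
such that the Fourier transforms of the partial derivatives in `θ` are dominated by an integrable
function `G`. -/
structure SpectralFamily {d : ℕ} (Θ : Set (Param d)) (ψ : Param d → ℝ → ℝ) (G : ℝ → ℝ≥0∞) :
    Prop where
  contDiffOn : ∀ x, ContDiffOn ℝ 1 (fun θ => ψ θ x) (interior Θ)
  continuousOn : ∀ x, ContinuousOn (fun θ => ψ θ x) Θ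
  integrable : ∀ θ ∈ Θ, Integrable (ψ θ)
  integrable_fourier : ∀ θ ∈ Θ, Integrable (fourier (ψ θ))
  integrable_pderiv : ∀ j, ∀ θ ∈ interior Θ, Integrable (pderiv j ψ θ)
  aemeasurable_bound : AEMeasurable G
  lintegral_bound : ∫⁻ u, G u ≠ ∞
  bound : ∀ θ ∈ interior Θ, ∀ u, ∑ j, ‖fourier (pderiv j ψ θ) u‖ₑ ≤ G u

theorem fderiv_apply_eq_sum {d : ℕ} {F : Type*} [NormedAddCommGroup F] [NormedSpace ℝ F]
    (L : Param d →L[ℝ] F) (v : Param d) :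
    L v = ∑ j, v j • L (EuclideanSpace.single j 1) := by
  conv_lhs => rw [← (EuclideanSpace.basisFun (Fin d) ℝ).sum_repr v]
  simp

theorem integrable_of_forall_apply_single {d : ℕ} {F : Type*} [NormedAddCommGroup F]
    [NormedSpace ℝ F] {T : ℝ → Param d →L[ℝ] F}
    (hT : ∀ j, Integrable (fun x => T x (EuclideanSpace.single j 1))) : Integrable T := by
  let Φ : (Fin d → F) →L[ℝ] (Param d →L[ℝ] F) := ∑ j,
    ((ContinuousLinearMap.smulRightL ℝ (Param d) F)
      (EuclideanSpace.proj j : Param d →L[ℝ] ℝ)).comp (ContinuousLinearMap.proj j)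
  have h : Integrable (fun x => Φ (fun j => T x (EuclideanSpace.single j 1))) :=
    Φ.integrable_comp (Integrable.of_eval hT)
  have e : T = fun x => Φ (fun j => T x (EuclideanSpace.single j 1)) := by
    funext x
    ext v
    rw [fderiv_apply_eq_sum (T x) v]
    simp only [Φ, sum_apply]
    rfl
  rw [e]
  exact h

theorem abs_apply_le_norm {d : ℕ} (v : Param d) (j : Fin d) : |v j| ≤ ‖v‖ := by
  rw [← Real.norm_eq_abs]
  exact PiLp.norm_apply_le v j

namespace SpectralFamily

variable {d : ℕ} {Θ : Set (Param d)} {ψ : Param d → ℝ → ℝ} {G : ℝ → ℝ≥0∞}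

theorem hasFDerivAt (h : SpectralFamily Θ ψ G) {θ : Param d} (hθ : θ ∈ interior Θ) (x : ℝ) :
    HasFDerivAt (fun η => ψ η x) (fderiv ℝ (fun η => ψ η x) θ) θ :=
  (((h.contDiffOn x).differentiableOn (by simp)).differentiableAt
    (isOpen_interior.mem_nhds hθ)).hasFDerivAt

theorem continuousOn_pderiv (h : SpectralFamily Θ ψ G) (j : Fin d) (x : ℝ) :
    ContinuousOn (fun θ => pderiv j ψ θ x) (interior Θ) :=
  ((h.contDiffOn x).continuousOn_fderiv_of_isOpen isOpen_interior le_rfl).clm_apply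
    continuousOn_const

/-- For each `θ` the bound is Fourier inversion, outside a null set that depends on `θ`. A countable
dense set of parameters and continuity of the derivative in `θ` provide one null set for all. -/
theorem ae_abs_pderiv_le (h : SpectralFamily Θ ψ G) :
    ∀ᵐ x, ∀ θ ∈ interior Θ, ∀ j, |pderiv j ψ θ x| ≤ (∫⁻ u, G u).toReal := by
  obtain ⟨s, hs, hsd⟩ := TopologicalSpace.exists_countable_dense (interior Θ)
  have h1 : ∀ᵐ x, ∀ θ ∈ s, ∀ j, |pderiv j ψ θ x| ≤ (∫⁻ u, G u).toReal := by
    rw [ae_ball_iff hs]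
    intro θ _
    rw [ae_all_iff]
    intro j
    refine (ae_abs_le_of_enorm_fourier_le (h.integrable_pderiv j θ θ.2) h.lintegral_bound
      (ae_of_all _ fun u => ?_)).2
    exact (Finset.single_le_sum (f := fun j => ‖fourier (pderiv j ψ θ) u‖ₑ)
      (fun _ _ => zero_le) (Finset.mem_univ j)).trans (h.bound θ θ.2 u)
  filter_upwards [h1] with x hx θ hθ j
  have hc : IsClosed {η : interior Θ | |pderiv j ψ η x| ≤ (∫⁻ u, G u).toReal} := by
    refine isClosed_le ?_ continuous_const
    exact (continuousOn_iff_continuous_domRestrict.1 (h.continuousOn_pderiv j x)).abs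
  have hd : Dense {η : interior Θ | |pderiv j ψ η x| ≤ (∫⁻ u, G u).toReal} :=
    hsd.mono fun η hη => hx η hη j
  have := hc.closure_eq ▸ hd.closure_eq
  have h2 : (⟨θ, hθ⟩ : interior Θ) ∈ {η : interior Θ | |pderiv j ψ η x| ≤ (∫⁻ u, G u).toReal} := by
    rw [this]; trivial
  exact h2

theorem ae_norm_fderiv_le (h : SpectralFamily Θ ψ G) :
    ∀ᵐ x, ∀ θ ∈ interior Θ, ‖fderiv ℝ (fun η => ψ η x) θ‖ ≤ d * (∫⁻ u, G u).toReal := by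
  filter_upwards [h.ae_abs_pderiv_le] with x hx θ hθ
  refine ContinuousLinearMap.opNorm_le_bound _ (by positivity) fun v => ?_
  rw [fderiv_apply_eq_sum]
  calc ‖∑ j, v j • fderiv ℝ (fun η => ψ η x) θ (EuclideanSpace.single j 1)‖
      ≤ ∑ j, ‖v j • fderiv ℝ (fun η => ψ η x) θ (EuclideanSpace.single j 1)‖ := norm_sum_le _ _
    _ ≤ ∑ _j : Fin d, ‖v‖ * (∫⁻ u, G u).toReal := by
        refine Finset.sum_le_sum fun j _ => ?_
        rw [norm_smul, Real.norm_eq_abs, Real.norm_eq_abs]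
        exact mul_le_mul (abs_apply_le_norm v j) (hx θ hθ j) (abs_nonneg _) (norm_nonneg _)
    _ = d * (∫⁻ u, G u).toReal * ‖v‖ := by
        rw [Finset.sum_const, Finset.card_univ, Fintype.card_fin, nsmul_eq_mul]
        ring

/-- The derivative in `θ` of `∫ ψ_θ^* η`. -/
noncomputable def gradPairing (ψ : Param d → ℝ → ℝ) (θ : Param d) (η : ℝ → ℂ) :
    Param d →L[ℝ] ℂ :=
  ∑ j, ((EuclideanSpace.proj j : Param d →L[ℝ] ℝ).smulRight
    (∫ u, fourier (pderiv j ψ θ) u * η u))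

theorem gradPairing_apply (ψ : Param d → ℝ → ℝ) (θ : Param d) (η : ℝ → ℂ) (v : Param d) :
    gradPairing ψ θ η v = ∑ j, (v j : ℂ) * ∫ u, fourier (pderiv j ψ θ) u * η u := by
  simp [gradPairing]

/-- After duality the integrand is `ψ_θ(x)` times the integrable function `cfourier η`. Its
derivative in `θ` is bounded by a constant times `‖cfourier η x‖`, so differentiation under the
integral is licit, although no integrable bound on `∂ψ_θ` itself is available. -/
theorem hasFDerivAt_pairing (h : SpectralFamily Θ ψ G) {θ : Param d} (hθ : θ ∈ interior Θ)
    (η : 𝓢(ℝ, ℂ)) :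
    HasFDerivAt (fun θ => ∫ u, fourier (ψ θ) u * η u) (gradPairing ψ θ η) θ := by
  set c : ℝ → ℂ := cfourier η with hc
  have hci : Integrable c := integrable_cfourier η
  have hcb : ∀ x, ‖c x‖ ≤ ∫ u, ‖η u‖ := norm_cfourier_le η
  have hmul : ∀ φ : ℝ → ℝ, Integrable φ → Integrable (fun x => φ x • c x) := fun φ hφ => by
    refine (hφ.ofReal.mul_bdd hci.aestronglyMeasurable (ae_of_all _ hcb)).congr
      (ae_of_all _ fun x => ?_)
    simp
  have hnhds : interior Θ ∈ 𝓝 θ := isOpen_interior.mem_nhds hθ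
  have hint : ∀ j, Integrable (fun x => pderiv j ψ θ x • c x) := fun j =>
    hmul _ (h.integrable_pderiv j θ hθ)
  have hF'int : Integrable (fun x => (fderiv ℝ (fun η => ψ η x) θ).smulRight (c x)) :=
    integrable_of_forall_apply_single hint
  have k1 : ∀ᶠ θ' in 𝓝 θ, AEStronglyMeasurable (fun x => ψ θ' x • c x) := by
    filter_upwards [hnhds] with θ' hθ'
    exact (hmul _ (h.integrable θ' (interior_subset hθ'))).aestronglyMeasurable
  have k2 : ∀ᵐ x, ∀ θ' ∈ interior Θ, ‖(fderiv ℝ (fun η => ψ η x) θ').smulRight (c x)‖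
      ≤ d * (∫⁻ u, G u).toReal * ‖c x‖ := by
    filter_upwards [h.ae_norm_fderiv_le] with x hx θ' hθ'
    rw [ContinuousLinearMap.norm_smulRight_apply]
    exact mul_le_mul_of_nonneg_right (hx θ' hθ') (norm_nonneg _)
  have k3 : ∀ᵐ x, ∀ θ' ∈ interior Θ, HasFDerivAt (fun θ => ψ θ x • c x)
      ((fderiv ℝ (fun η => ψ η x) θ').smulRight (c x)) θ' :=
    ae_of_all _ fun x θ' hθ' => (h.hasFDerivAt hθ' x).smul_const (c x)
  have main : HasFDerivAt (fun θ => ∫ x, ψ θ x • c x)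
      (∫ x, (fderiv ℝ (fun η => ψ η x) θ).smulRight (c x)) θ :=
    hasFDerivAt_integral_of_dominated_of_fderiv_le (𝕜 := ℝ) (μ := volume)
      (F := fun θ x => ψ θ x • c x)
      (F' := fun θ x => (fderiv ℝ (fun η => ψ η x) θ).smulRight (c x))
      hnhds k1 (hmul _ (h.integrable θ (interior_subset hθ)))
      hF'int.aestronglyMeasurable k2 (hci.norm.const_mul _) k3
  have e : ∫ x, (fderiv ℝ (fun η => ψ η x) θ).smulRight (c x) = gradPairing ψ θ η := by
    ext v
    rw [ContinuousLinearMap.integral_apply hF'int, gradPairing_apply]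
    have e1 : ∀ x, (fderiv ℝ (fun η => ψ η x) θ).smulRight (c x) v
        = ∑ j, v j • (pderiv j ψ θ x • c x) := fun x => by
      rw [fderiv_apply_eq_sum]
      rfl
    simp_rw [e1]
    rw [integral_finsetSum (f := fun j x => v j • (pderiv j ψ θ x • c x)) _
      fun j _ => (hint j).smul (v j)]
    refine Finset.sum_congr rfl fun j _ => ?_
    rw [integral_fourier_mul (h.integrable_pderiv j θ hθ) η.integrable, ← integral_const_mul]
    refine integral_congr_ae (ae_of_all _ fun x => ?_)
    simp [hc]
  rw [e] at main
  refine main.congr_of_eventuallyEq ?_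
  filter_upwards [hnhds] with θ' hθ'
  rw [integral_fourier_mul (h.integrable θ' (interior_subset hθ')) η.integrable]
  refine integral_congr_ae (ae_of_all _ fun x => ?_)
  simp [hc]

theorem enorm_sum_mul_fourier_le (h : SpectralFamily Θ ψ G) {θ : Param d} (hθ : θ ∈ interior Θ)
    (v : Param d) (u : ℝ) :
    ‖∑ j, (v j : ℂ) * fourier (pderiv j ψ θ) u‖ₑ ≤ ‖v‖ₑ * G u := by
  calc ‖∑ j, (v j : ℂ) * fourier (pderiv j ψ θ) u‖ₑ
      ≤ ∑ j, ‖(v j : ℂ) * fourier (pderiv j ψ θ) u‖ₑ := enorm_sum_le _ _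
    _ ≤ ∑ j, ‖v‖ₑ * ‖fourier (pderiv j ψ θ) u‖ₑ := by
        refine Finset.sum_le_sum fun j _ => ?_
        rw [enorm_mul]
        gcongr
        rw [← ofReal_norm, ← ofReal_norm, Complex.norm_real, Real.norm_eq_abs]
        exact ENNReal.ofReal_le_ofReal (abs_apply_le_norm v j)
    _ = ‖v‖ₑ * ∑ j, ‖fourier (pderiv j ψ θ) u‖ₑ := by rw [Finset.mul_sum]
    _ ≤ _ := by gcongr; exact h.bound θ hθ u

theorem integrable_fourier_pderiv (h : SpectralFamily Θ ψ G) {θ : Param d} (hθ : θ ∈ interior Θ)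
    (j : Fin d) : Integrable (fourier (pderiv j ψ θ)) :=
  (ae_abs_le_of_enorm_fourier_le (h.integrable_pderiv j θ hθ) h.lintegral_bound
    (ae_of_all _ fun u => (Finset.single_le_sum (f := fun j => ‖fourier (pderiv j ψ θ) u‖ₑ)
      (fun _ _ => zero_le) (Finset.mem_univ j)).trans (h.bound θ hθ u))).1

theorem norm_schwartz_bdd (η : 𝓢(ℝ, ℂ)) : ∃ c, ∀ u, ‖η u‖ ≤ c := by
  obtain ⟨c, hc⟩ := η.toBoundedContinuousFunction.isBounded_range.exists_norm_le
  exact ⟨c, fun u => hc _ ⟨u, rfl⟩⟩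

theorem integrable_mul_schwartz {D : ℝ → ℂ} (hD : Integrable D) (η : 𝓢(ℝ, ℂ)) :
    Integrable (fun u => D u * η u) := by
  obtain ⟨c, hc⟩ := norm_schwartz_bdd η
  exact hD.mul_bdd η.continuous.aestronglyMeasurable (ae_of_all _ hc)

theorem lintegral_mul_schwartz_ne_top (h : SpectralFamily Θ ψ G) (η : 𝓢(ℝ, ℂ)) :
    ∫⁻ u, G u * ‖η u‖ₑ ≠ ∞ := by
  obtain ⟨c, hc⟩ := norm_schwartz_bdd η
  refine ne_top_of_le_ne_top (ENNReal.mul_ne_top h.lintegral_bound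
    (ENNReal.ofReal_ne_top (r := c))) ?_
  rw [← lintegral_mul_const'' _ h.aemeasurable_bound]
  gcongr with u
  rw [← ofReal_norm]
  exact ENNReal.ofReal_le_ofReal (hc u)

theorem gradPairing_eq_integral (h : SpectralFamily Θ ψ G) {θ : Param d} (hθ : θ ∈ interior Θ)
    (η : 𝓢(ℝ, ℂ)) (v : Param d) :
    gradPairing ψ θ η v = ∫ u, (∑ j, (v j : ℂ) * fourier (pderiv j ψ θ) u) * η u := by
  rw [gradPairing_apply]
  simp_rw [Finset.sum_mul, mul_assoc, ← integral_const_mul]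
  rw [integral_finsetSum]
  exact fun j _ => (integrable_mul_schwartz (h.integrable_fourier_pderiv hθ j) η).const_mul _

theorem norm_gradPairing_le (h : SpectralFamily Θ ψ G) {θ : Param d} (hθ : θ ∈ interior Θ)
    (η : 𝓢(ℝ, ℂ)) : ‖gradPairing ψ θ η‖ ≤ (∫⁻ u, G u * ‖η u‖ₑ).toReal := by
  refine ContinuousLinearMap.opNorm_le_bound _ ENNReal.toReal_nonneg fun v => ?_
  have h1 : ‖gradPairing ψ θ η v‖ₑ ≤ (∫⁻ u, G u * ‖η u‖ₑ) * ‖v‖ₑ := by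
    rw [h.gradPairing_eq_integral hθ]
    calc ‖∫ u, (∑ j, (v j : ℂ) * fourier (pderiv j ψ θ) u) * η u‖ₑ
        ≤ ∫⁻ u, ‖(∑ j, (v j : ℂ) * fourier (pderiv j ψ θ) u) * η u‖ₑ :=
          enorm_integral_le_lintegral_enorm _
      _ ≤ ∫⁻ u, ‖v‖ₑ * (G u * ‖η u‖ₑ) := by
          refine lintegral_mono fun u => ?_
          rw [enorm_mul, ← mul_assoc]
          gcongr
          exact h.enorm_sum_mul_fourier_le hθ v u
      _ = (∫⁻ u, G u * ‖η u‖ₑ) * ‖v‖ₑ := by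
          rw [lintegral_const_mul' _ _ enorm_ne_top, mul_comm]
  have h2 := ENNReal.toReal_mono (ENNReal.mul_ne_top (h.lintegral_mul_schwartz_ne_top η)
    enorm_ne_top) h1
  rwa [ENNReal.toReal_mul, toReal_enorm, toReal_enorm] at h2

/-- Mean value inequality for the Fourier transforms, along segments in the interior. -/
theorem ae_enorm_fourier_sub_le (h : SpectralFamily Θ ψ G) {s : Set (Param d)} (hs : Convex ℝ s)
    (hsΘ : s ⊆ interior Θ) {θ θ' : Param d} (hθ : θ ∈ s) (hθ' : θ' ∈ s) :
    ∀ᵐ u, ‖fourier (ψ θ) u - fourier (ψ θ') u‖ₑ ≤ ‖θ - θ'‖ₑ * G u := by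
  have hi := interior_subset (hsΘ hθ)
  have hi' := interior_subset (hsΘ hθ')
  refine ae_enorm_le_of_schwartz
    ((continuous_fourier (h.integrable θ hi)).sub
      (continuous_fourier (h.integrable θ' hi'))).measurable
    ((h.integrable_fourier θ hi).sub (h.integrable_fourier θ' hi'))
    (h.aemeasurable_bound.const_mul _) ?_ fun η => ?_
  · rw [lintegral_const_mul' _ _ enorm_ne_top]
    exact ENNReal.mul_ne_top enorm_ne_top h.lintegral_bound
  -- The mean value inequality is applied to each Schwartz pairing, a function of `θ` alone; the
  -- passage to almost every `u` comes from the duality lemma.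
  · have h1 := hs.norm_image_sub_le_of_norm_hasFDerivWithin_le (𝕜 := ℝ)
      (f := fun θ => ∫ u, fourier (ψ θ) u * η u)
      (fun θ hθ => (h.hasFDerivAt_pairing (hsΘ hθ) η).hasFDerivWithinAt)
      (fun θ hθ => h.norm_gradPairing_le (hsΘ hθ) η) hθ' hθ
    simp_rw [mul_assoc]
    rw [show (fun u => (fourier (ψ θ) - fourier (ψ θ')) u * η u)
        = fun u => fourier (ψ θ) u * η u - fourier (ψ θ') u * η u from
        funext fun u => sub_mul _ _ _, integral_sub (integrable_mul_schwartz (h.integrable_fourier θ hi) η)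
      (integrable_mul_schwartz (h.integrable_fourier θ' hi') η),
      lintegral_const_mul' _ _ enorm_ne_top, mul_comm, ← ofReal_norm, ← ofReal_norm,
      ← ENNReal.ofReal_toReal (h.lintegral_mul_schwartz_ne_top η),
      ← ENNReal.ofReal_mul ENNReal.toReal_nonneg]
    exact ENNReal.ofReal_le_ofReal h1

theorem ae_abs_sub_le (h : SpectralFamily Θ ψ G) {s : Set (Param d)} (hs : Convex ℝ s)
    (hsΘ : s ⊆ interior Θ) :
    ∀ᵐ x, ∀ θ ∈ s, ∀ θ' ∈ s, |ψ θ x - ψ θ' x| ≤ d * (∫⁻ u, G u).toReal * ‖θ - θ'‖ := by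
  filter_upwards [h.ae_norm_fderiv_le] with x hx θ hθ θ' hθ'
  exact hs.norm_image_sub_le_of_norm_hasFDerivWithin_le (𝕜 := ℝ) (f := fun θ => ψ θ x)
    (fun θ hθ => (h.hasFDerivAt (hsΘ hθ) x).hasFDerivWithinAt)
    (fun θ hθ => hx θ (hsΘ hθ)) hθ' hθ

/-- Mean value inequality for the Fourier transforms on a convex parameter set, up to the
boundary. -/
theorem ae_enorm_fourier_sub_le_of_convex (h : SpectralFamily Θ ψ G) (hΘ : Convex ℝ Θ)
    {θ₀ θ : Param d} (hθ₀ : θ₀ ∈ interior Θ) (hθ : θ ∈ Θ) :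
    ∀ᵐ u, ‖fourier (ψ θ) u - fourier (ψ θ₀) u‖ₑ ≤ ‖θ - θ₀‖ₑ * G u := by
  have hi₀ := interior_subset hθ₀
  -- Points of the segment from `θ` towards `θ₀`. By convexity they are interior, even when `θ` is
  -- on the boundary, and they are no farther from `θ₀` than `θ` is.
  set r : ℕ → ℝ := fun n => 1 / ((n : ℝ) + 1) with hr
  set θn : ℕ → Param d := fun n => θ + r n • (θ₀ - θ) with hθn
  have hr0 : ∀ n, 0 < r n := fun n => by positivity
  have hr1 : ∀ n, r n ≤ 1 := fun n => by
    rw [hr]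
    dsimp only
    rw [div_le_one (by positivity)]
    have : (0 : ℝ) ≤ n := Nat.cast_nonneg n
    linarith
  have hmem : ∀ n, θn n ∈ interior Θ := fun n =>
    hΘ.add_smul_sub_mem_interior hθ hθ₀ ⟨hr0 n, hr1 n⟩
  have hlim : Tendsto θn atTop (𝓝 θ) := by
    have h1 : Tendsto r atTop (𝓝 0) := tendsto_one_div_add_atTop_nhds_zero_nat
    have h2 := (h1.smul_const (θ₀ - θ)).const_add θ
    simpa using h2
  have hdist : ∀ n, ‖θn n - θ₀‖ ≤ ‖θ - θ₀‖ := fun n => by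
    have e : θn n - θ₀ = (1 - r n) • (θ - θ₀) := by
      simp only [hθn]
      module
    rw [e, norm_smul, Real.norm_eq_abs, abs_of_nonneg (by linarith [hr1 n])]
    exact mul_le_of_le_one_left (norm_nonneg _) (by linarith [hr0 n])
  -- Domination on the `x` side: along the segment `ψ` differs from `ψ_{θ₀}` by at most a constant,
  -- uniformly in `x`, and `cfourier η` is integrable and bounded.
  have hconv : ∀ η : 𝓢(ℝ, ℂ), Tendsto (fun n => ∫ u, fourier (ψ (θn n)) u * η u) atTop
      (𝓝 (∫ u, fourier (ψ θ) u * η u)) := by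
    intro η
    have hci : Integrable (cfourier η) := integrable_cfourier η
    have hcb : ∀ x, ‖cfourier η x‖ ≤ ∫ u, ‖η u‖ := norm_cfourier_le η
    rw [integral_fourier_mul (h.integrable θ hθ) η.integrable]
    simp_rw [fun n => integral_fourier_mul (h.integrable _ (interior_subset (hmem n))) η.integrable]
    refine tendsto_integral_of_dominated_convergence
      (fun x => (|ψ θ₀ x| + d * (∫⁻ u, G u).toReal * ‖θ - θ₀‖) * ‖cfourier η x‖)
      (fun n => (h.integrable _ (interior_subset (hmem n))).ofReal.aestronglyMeasurable.mul
        hci.aestronglyMeasurable) ?_ (fun n => ?_) ?_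
    · simp_rw [add_mul]
      refine Integrable.add ?_ (hci.norm.const_mul _)
      exact (h.integrable θ₀ hi₀).abs.mul_bdd (c := ∫ u, ‖η u‖) hci.norm.aestronglyMeasurable
        (ae_of_all _ fun x => by rw [norm_norm]; exact hcb x)
    · filter_upwards [h.ae_abs_sub_le hΘ.interior le_rfl] with x hx
      rw [norm_mul, Complex.norm_real, Real.norm_eq_abs]
      gcongr
      have h1 := hx _ (hmem n) _ hθ₀
      have h2 : d * (∫⁻ u, G u).toReal * ‖θn n - θ₀‖
          ≤ d * (∫⁻ u, G u).toReal * ‖θ - θ₀‖ := by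
        gcongr
        exact hdist n
      have h3 := abs_sub_abs_le_abs_sub (ψ (θn n) x) (ψ θ₀ x)
      linarith
    · refine ae_of_all _ fun x => ?_
      have h1 : Tendsto (fun n => ψ (θn n) x) atTop (𝓝 (ψ θ x)) :=
        ((h.continuousOn x) θ hθ).tendsto.comp (tendsto_nhdsWithin_iff.2
          ⟨hlim, Eventually.of_forall fun n => interior_subset (hmem n)⟩)
      exact ((Complex.continuous_ofReal.tendsto _).comp h1).mul_const _
  refine ae_enorm_le_of_schwartz
    ((continuous_fourier (h.integrable θ hθ)).sub
      (continuous_fourier (h.integrable θ₀ hi₀))).measurable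
    ((h.integrable_fourier θ hθ).sub (h.integrable_fourier θ₀ hi₀))
    (h.aemeasurable_bound.const_mul _) ?_ fun η => ?_
  · rw [lintegral_const_mul' _ _ enorm_ne_top]
    exact ENNReal.mul_ne_top enorm_ne_top h.lintegral_bound
  · have h0 : ∀ n, ‖(∫ u, fourier (ψ (θn n)) u * η u) - ∫ u, fourier (ψ θ₀) u * η u‖
        ≤ (∫⁻ u, G u * ‖η u‖ₑ).toReal * ‖θ - θ₀‖ := fun n =>
      (hΘ.interior.norm_image_sub_le_of_norm_hasFDerivWithin_le (𝕜 := ℝ)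
        (f := fun θ => ∫ u, fourier (ψ θ) u * η u)
        (fun θ hθ => (h.hasFDerivAt_pairing hθ η).hasFDerivWithinAt)
        (fun θ hθ => h.norm_gradPairing_le hθ η) hθ₀ (hmem n)).trans (by
          gcongr
          exact hdist n)
    have h1 := le_of_tendsto ((hconv η).sub_const _).norm (Eventually.of_forall h0)
    simp_rw [mul_assoc]
    rw [show (fun u => (fourier (ψ θ) - fourier (ψ θ₀)) u * η u)
        = fun u => fourier (ψ θ) u * η u - fourier (ψ θ₀) u * η u from
        funext fun u => sub_mul _ _ _, integral_sub
        (integrable_mul_schwartz (h.integrable_fourier θ hθ) η)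
      (integrable_mul_schwartz (h.integrable_fourier θ₀ hi₀) η),
      lintegral_const_mul' _ _ enorm_ne_top, mul_comm, ← ofReal_norm, ← ofReal_norm,
      ← ENNReal.ofReal_toReal (h.lintegral_mul_schwartz_ne_top η),
      ← ENNReal.ofReal_mul ENNReal.toReal_nonneg]
    exact ENNReal.ofReal_le_ofReal h1

/-- The remainder of the first order expansion of `θ ↦ ψ_θ^*(u)` at `θ₀`. -/
noncomputable def taylorRem (ψ : Param d → ℝ → ℝ) (θ₀ θ : Param d) (u : ℝ) : ℂ :=
  fourier (ψ θ) u - fourier (ψ θ₀) u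
    - ∑ j, ((θ - θ₀) j : ℂ) * fourier (pderiv j ψ θ₀) u

theorem continuous_taylorRem (h : SpectralFamily Θ ψ G) {θ₀ θ : Param d} (hθ₀ : θ₀ ∈ interior Θ)
    (hθ : θ ∈ Θ) : Continuous (taylorRem ψ θ₀ θ) :=
  ((continuous_fourier (h.integrable θ hθ)).sub
    (continuous_fourier (h.integrable θ₀ (interior_subset hθ₀)))).sub
    (continuous_finsetSum _ fun j _ => continuous_const.mul
      (continuous_fourier (h.integrable_pderiv j θ₀ hθ₀)))

/-- Only a bound of first order, serving as domination. That the remainder is of smaller order is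
available only after integration against a fixed function. -/
theorem ae_enorm_taylorRem_le (h : SpectralFamily Θ ψ G) {s : Set (Param d)} (hs : Convex ℝ s)
    (hsΘ : s ⊆ interior Θ) {θ₀ θ : Param d} (hθ₀ : θ₀ ∈ s) (hθ : θ ∈ s) :
    ∀ᵐ u, ‖taylorRem ψ θ₀ θ u‖ₑ ≤ 2 * ‖θ - θ₀‖ₑ * G u := by
  filter_upwards [h.ae_enorm_fourier_sub_le hs hsΘ hθ hθ₀] with u hu
  refine (enorm_sub_le).trans ?_
  rw [mul_assoc, two_mul]
  exact add_le_add hu (h.enorm_sum_mul_fourier_le (hsΘ hθ₀) _ u)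

/-- `θ ↦ ∫ ψ_θ^* χ` is differentiable at interior points for every `χ` integrable with respect
to the dominating function. -/
theorem exists_norm_integral_taylorRem_le (h : SpectralFamily Θ ψ G) {θ₀ : Param d}
    (hθ₀ : θ₀ ∈ interior Θ) {χ : ℝ → ℂ} (hχm : Measurable χ)
    (hχ : ∫⁻ u, G u * ‖χ u‖ₑ ≠ ∞) {ε : ℝ} (hε : 0 < ε) :
    ∃ ρ > 0, Metric.ball θ₀ ρ ⊆ interior Θ ∧ ∀ θ ∈ Metric.ball θ₀ ρ,
      ‖∫ u, taylorRem ψ θ₀ θ u * χ u‖ ≤ ε * ‖θ - θ₀‖ := by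
  obtain ⟨ρ₁, hρ₁, hball⟩ := Metric.isOpen_iff.1 isOpen_interior θ₀ hθ₀
  have : IsFiniteMeasure (volume.withDensity G) := isFiniteMeasure_withDensity h.lintegral_bound
  have hχi : Integrable χ (volume.withDensity G) := by
    refine ⟨hχm.aestronglyMeasurable, ?_⟩
    rw [HasFiniteIntegral, lintegral_withDensity_eq_lintegral_mul₀ h.aemeasurable_bound
      hχm.enorm.aemeasurable]
    exact hχ.lt_top
  -- `χ` is replaced by a Schwartz function in `L¹(G du)`. The error costs at most `2 ‖θ - θ₀‖ ·
  -- ε/4` by the first order domination, and differentiability of the Schwartz pairing supplies the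
  -- other `ε/2`.
  obtain ⟨η, hη⟩ := exists_schwartz_lintegral_sub_le hχi (ε := ε / 4) (by positivity)
  have hχη : Measurable fun u => χ u - η u := hχm.sub η.continuous.measurable
  rw [lintegral_withDensity_eq_lintegral_mul₀ h.aemeasurable_bound (g := fun u => ‖χ u - η u‖ₑ)
    hχη.enorm.aemeasurable] at hη
  have hder := (h.hasFDerivAt_pairing hθ₀ η).isLittleO.def (c := ε / 2) (by positivity)
  obtain ⟨ρ₂, hρ₂, hder⟩ := Metric.eventually_nhds_iff_ball.1 hder
  refine ⟨min ρ₁ ρ₂, lt_min hρ₁ hρ₂,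
    (Metric.ball_subset_ball (min_le_left _ _)).trans hball, fun θ hθ => ?_⟩
  have hθ1 : θ ∈ Metric.ball θ₀ ρ₁ := Metric.ball_subset_ball (min_le_left _ _) hθ
  have hθΘ := interior_subset (hball hθ1)
  have hi₀ := interior_subset hθ₀
  have hDle := h.ae_enorm_taylorRem_le (convex_ball θ₀ ρ₁) hball (Metric.mem_ball_self hρ₁) hθ1
  have hDm := (h.continuous_taylorRem hθ₀ hθΘ).measurable
  have hDint : ∀ ζ : ℝ → ℂ, Measurable ζ → ∫⁻ u, G u * ‖ζ u‖ₑ ≠ ∞ →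
      Integrable (fun u => taylorRem ψ θ₀ θ u * ζ u) ∧
      ‖∫ u, taylorRem ψ θ₀ θ u * ζ u‖ₑ ≤ 2 * ‖θ - θ₀‖ₑ * ∫⁻ u, G u * ‖ζ u‖ₑ := by
    intro ζ hζm hζ
    have hle : ∫⁻ u, ‖taylorRem ψ θ₀ θ u * ζ u‖ₑ ≤ 2 * ‖θ - θ₀‖ₑ * ∫⁻ u, G u * ‖ζ u‖ₑ := by
      rw [← lintegral_const_mul' _ _ (ENNReal.mul_ne_top (by simp) enorm_ne_top)]
      refine lintegral_mono_ae ?_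
      filter_upwards [hDle] with u hu
      rw [enorm_mul, ← mul_assoc]
      gcongr
    exact ⟨⟨(hDm.mul hζm).aestronglyMeasurable, hle.trans_lt
      (ENNReal.mul_lt_top (ENNReal.mul_lt_top (by simp) enorm_lt_top) hζ.lt_top)⟩,
      (enorm_integral_le_lintegral_enorm _).trans hle⟩
  have hηfin := h.lintegral_mul_schwartz_ne_top η
  have hdfin : ∫⁻ u, G u * ‖χ u - η u‖ₑ ≠ ∞ := ne_top_of_le_ne_top ENNReal.ofReal_ne_top hη
  obtain ⟨i1, -⟩ := hDint η η.continuous.measurable hηfin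
  obtain ⟨i2, b2⟩ := hDint _ hχη hdfin
  have e1 : ∫ u, taylorRem ψ θ₀ θ u * χ u = (∫ u, taylorRem ψ θ₀ θ u * η u)
      + ∫ u, taylorRem ψ θ₀ θ u * (χ u - η u) := by
    rw [← integral_add i1 i2]
    refine integral_congr_ae (ae_of_all _ fun u => ?_)
    ring
  have e2 : ∫ u, taylorRem ψ θ₀ θ u * η u = (∫ u, fourier (ψ θ) u * η u)
      - (∫ u, fourier (ψ θ₀) u * η u) - gradPairing ψ θ₀ η (θ - θ₀) := by
    have j1 := integrable_mul_schwartz (h.integrable_fourier θ hθΘ) η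
    have j2 := integrable_mul_schwartz (h.integrable_fourier θ₀ hi₀) η
    have j3 : Integrable fun u => (∑ j, ((θ - θ₀) j : ℂ) * fourier (pderiv j ψ θ₀) u) * η u :=
      integrable_mul_schwartz (integrable_finsetSum _ fun j _ =>
        (h.integrable_fourier_pderiv hθ₀ j).const_mul _) η
    have j12 : Integrable fun u => fourier (ψ θ) u * η u - fourier (ψ θ₀) u * η u := j1.sub j2
    rw [h.gradPairing_eq_integral hθ₀, ← integral_sub j1 j2, ← integral_sub j12 j3]
    refine integral_congr_ae (ae_of_all _ fun u => ?_)
    simp only [taylorRem]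
    ring
  have n1 : ‖∫ u, taylorRem ψ θ₀ θ u * η u‖ ≤ ε / 2 * ‖θ - θ₀‖ := by
    rw [e2]
    exact hder θ (Metric.ball_subset_ball (min_le_right _ _) hθ)
  have n2 : ‖∫ u, taylorRem ψ θ₀ θ u * (χ u - η u)‖ ≤ 2 * ‖θ - θ₀‖ * (ε / 4) := by
    have b3 : ‖∫ u, taylorRem ψ θ₀ θ u * (χ u - η u)‖ₑ ≤ 2 * ‖θ - θ₀‖ₑ * ENNReal.ofReal (ε / 4) := by
      refine b2.trans ?_
      gcongr
      exact hη
    have := ENNReal.toReal_mono (ENNReal.mul_ne_top (ENNReal.mul_ne_top (by simp) enorm_ne_top)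
      ENNReal.ofReal_ne_top) b3
    rwa [toReal_enorm, ENNReal.toReal_mul, ENNReal.toReal_mul, toReal_enorm,
      ENNReal.toReal_ofReal (by positivity), ENNReal.toReal_ofNat] at this
  rw [e1]
  refine (norm_add_le _ _).trans ?_
  linarith

end SpectralFamily

end EIV

namespace EIV

/-! ### Deviations of empirical means -/

theorem sq_lintegral_le {α : Type*} [MeasurableSpace α] (μ : Measure α) {F : α → ℝ≥0∞}
    (hF : AEMeasurable F μ) : (∫⁻ a, F a ∂μ) ^ 2 ≤ μ Set.univ * ∫⁻ a, F a ^ 2 ∂μ := by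
  have h := ENNReal.lintegral_mul_le_Lp_mul_Lq μ (Real.HolderConjugate.two_two) hF
    (g := fun _ => 1) aemeasurable_const
  simp only [Pi.mul_apply, mul_one, ENNReal.one_rpow, lintegral_const, one_mul] at h
  calc (∫⁻ a, F a ∂μ) ^ 2
      ≤ ((∫⁻ a, F a ^ (2 : ℝ) ∂μ) ^ (1 / 2 : ℝ) * μ Set.univ ^ (1 / 2 : ℝ)) ^ 2 := by gcongr
    _ = μ Set.univ * ∫⁻ a, F a ^ 2 ∂μ := by
        rw [mul_pow, ← ENNReal.rpow_natCast, ← ENNReal.rpow_natCast, ← ENNReal.rpow_mul,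
          ← ENNReal.rpow_mul]
        norm_num
        rw [mul_comm]

theorem enorm_sq_eq_re_im (z : ℂ) : ‖z‖ₑ ^ 2 = ‖z.re‖ₑ ^ 2 + ‖z.im‖ₑ ^ 2 := by
  rw [← ofReal_norm, ← ofReal_norm, ← ofReal_norm, ← ENNReal.ofReal_pow (norm_nonneg _),
    ← ENNReal.ofReal_pow (norm_nonneg _), ← ENNReal.ofReal_pow (norm_nonneg _),
    ← ENNReal.ofReal_add (by positivity) (by positivity), Complex.sq_norm, Complex.normSq_apply,
    Real.norm_eq_abs, Real.norm_eq_abs, sq_abs, sq_abs]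
  congr 1
  ring

theorem memLp_two_of_lintegral_sq {Ω F : Type*} [MeasurableSpace Ω] {P : Measure Ω} [NormedAddCommGroup F] {X : Ω → F}
    (hX : AEStronglyMeasurable X P) (h : ∫⁻ ω, ‖X ω‖ₑ ^ 2 ∂P ≠ ∞) : MemLp X 2 P := by
  refine ⟨hX, ?_⟩
  rw [eLpNorm_lt_top_iff_lintegral_rpow_enorm_lt_top (by simp) (by simp)]
  simpa using h.lt_top

section IID

variable {Ω : Type*} [MeasurableSpace Ω] {P : Measure Ω} [IsProbabilityMeasure P]
  {𝓦 : Type*} [MeasurableSpace 𝓦] {W : ℕ → Ω → 𝓦}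

theorem lintegral_sq_real_mean_sub_le (hW : iIndepFun W P)
    (hid : ∀ i, IdentDistrib (W i) (W 0) P P) {c : 𝓦 → ℝ} (hc : Measurable c)
    (hc2 : MemLp (fun ω => c (W 0 ω)) 2 P) {n : ℕ} (hn : 1 ≤ n) :
    ∫⁻ ω, ‖(n : ℝ)⁻¹ * ∑ i ∈ Finset.range n, c (W i ω) - ∫ ω, c (W 0 ω) ∂P‖ₑ ^ 2 ∂P
      ≤ (∫⁻ ω, ‖c (W 0 ω)‖ₑ ^ 2 ∂P) / n := by
  have hn0 : (n : ℝ) ≠ 0 := by positivity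
  have hidc : ∀ i, IdentDistrib (fun ω => c (W i ω)) (fun ω => c (W 0 ω)) P P :=
    fun i => (hid i).comp hc
  have hL : ∀ i, MemLp (fun ω => c (W i ω)) 2 P := fun i => (hidc i).memLp_iff.2 hc2
  have hint : ∀ i, Integrable (fun ω => c (W i ω)) P := fun i => (hL i).integrable (by simp)
  set T : Ω → ℝ := fun ω => (n : ℝ)⁻¹ * ∑ i ∈ Finset.range n, c (W i ω) with hT
  have hTL : MemLp T 2 P := (memLp_finsetSum _ fun i _ => hL i).const_mul _
  have hTE : ∫ ω, T ω ∂P = ∫ ω, c (W 0 ω) ∂P := by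
    rw [hT, integral_const_mul, integral_finsetSum _ fun i _ => hint i]
    simp_rw [(hidc _).integral_eq]
    simp
    field_simp
  have hvar : Var[T; P] = Var[fun ω => c (W 0 ω); P] / n := by
    have e : T = fun ω => (n : ℝ)⁻¹ * (∑ i ∈ Finset.range n, fun ω => c (W i ω)) ω := by
      funext ω; simp [hT]
    rw [e, variance_const_mul, IndepFun.variance_sum (fun i _ => hL i) (fun i _ j _ hij =>
      (hW.indepFun hij).comp hc hc)]
    simp_rw [(hidc _).variance_eq]
    simp
    field_simp
  calc ∫⁻ ω, ‖T ω - ∫ ω, c (W 0 ω) ∂P‖ₑ ^ 2 ∂P = eVar[T; P] := by rw [evariance, hTE]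
    _ = ENNReal.ofReal (Var[fun ω => c (W 0 ω); P] / n) := by rw [← ofReal_variance hTL, hvar]
    _ ≤ ENNReal.ofReal ((∫ ω, c (W 0 ω) ^ 2 ∂P) / n) := by
        gcongr
        exact variance_le_expectation_sq hc2.aestronglyMeasurable
    _ = (∫⁻ ω, ‖c (W 0 ω)‖ₑ ^ 2 ∂P) / n := by
        rw [ENNReal.ofReal_div_of_pos (by positivity), ENNReal.ofReal_natCast,
          ofReal_integral_eq_lintegral_ofReal hc2.integrable_sq (ae_of_all _ fun _ => sq_nonneg _)]
        congr 1
        refine lintegral_congr fun ω => ?_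
        rw [← ofReal_norm, ← ENNReal.ofReal_pow (norm_nonneg _), Real.norm_eq_abs, sq_abs]

/-- The deviation of the empirical mean of `b (W i)`, `i < n`, from its expectation. -/
noncomputable def empDev (P : Measure Ω) (W : ℕ → Ω → 𝓦) (b : 𝓦 → ℂ) (n : ℕ) (ω : Ω) : ℂ :=
  (n : ℂ)⁻¹ * ∑ i ∈ Finset.range n, b (W i ω) - ∫ ω, b (W 0 ω) ∂P

theorem lintegral_sq_empDev_le (hWm : ∀ i, Measurable (W i)) (hW : iIndepFun W P)
    (hid : ∀ i, IdentDistrib (W i) (W 0) P P) {b : 𝓦 → ℂ} (hb : Measurable b)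
    (hb2 : ∫⁻ ω, ‖b (W 0 ω)‖ₑ ^ 2 ∂P ≠ ∞) {n : ℕ} (hn : 1 ≤ n) :
    ∫⁻ ω, ‖empDev P W b n ω‖ₑ ^ 2 ∂P ≤ (∫⁻ ω, ‖b (W 0 ω)‖ₑ ^ 2 ∂P) / n := by
  have hbL : MemLp (fun ω => b (W 0 ω)) 2 P :=
    memLp_two_of_lintegral_sq (hb.comp (hWm 0)).aestronglyMeasurable hb2
  have hbi : Integrable (fun ω => b (W 0 ω)) P := hbL.integrable (by simp)
  have hre := lintegral_sq_real_mean_sub_le hW hid (Complex.measurable_re.comp hb) hbL.re hn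
  have him := lintegral_sq_real_mean_sub_le hW hid (Complex.measurable_im.comp hb) hbL.im hn
  have ere : ∀ ω, (empDev P W b n ω).re = (n : ℝ)⁻¹ * ∑ i ∈ Finset.range n, (b (W i ω)).re
      - ∫ ω, (b (W 0 ω)).re ∂P := fun ω => by
    rw [empDev, Complex.sub_re, ← Complex.ofReal_natCast, ← Complex.ofReal_inv,
      Complex.re_ofReal_mul, Complex.re_sum]
    congr 1
    exact (integral_re hbi).symm
  have eim : ∀ ω, (empDev P W b n ω).im = (n : ℝ)⁻¹ * ∑ i ∈ Finset.range n, (b (W i ω)).im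
      - ∫ ω, (b (W 0 ω)).im ∂P := fun ω => by
    rw [empDev, Complex.sub_im, ← Complex.ofReal_natCast, ← Complex.ofReal_inv,
      Complex.im_ofReal_mul, Complex.im_sum]
    congr 1
    exact (integral_im hbi).symm
  have hm1 : Measurable fun ω => ‖(b (W 0 ω)).re‖ₑ ^ 2 :=
    (Complex.measurable_re.comp (hb.comp (hWm 0))).enorm.pow_const 2
  have hm2 : Measurable fun ω => ‖(empDev P W b n ω).re‖ₑ ^ 2 := by
    refine (Complex.measurable_re.comp ?_).enorm.pow_const 2
    exact (Measurable.const_mul (Finset.measurable_fun_sum _ fun i _ => hb.comp (hWm i)) _).sub_const _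
  simp_rw [enorm_sq_eq_re_im]
  rw [lintegral_add_left hm1, lintegral_add_left hm2, ENNReal.add_div]
  simp_rw [ere, eim]
  exact add_le_add hre him

theorem measurable_empDev_uncurry (hWm : ∀ i, Measurable (W i)) {b : ℝ → 𝓦 → ℂ}
    (hb : Measurable (Function.uncurry b)) (n : ℕ) :
    Measurable fun z : ℝ × Ω => empDev P W (b z.1) n z.2 := by
  refine Measurable.sub (Measurable.const_mul (Finset.measurable_fun_sum _ fun i _ =>
    hb.comp (measurable_fst.prodMk ((hWm i).comp measurable_snd))) _) ?_
  have h : StronglyMeasurable (Function.uncurry fun (u : ℝ) (ω : Ω) => b u (W 0 ω)) :=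
    (hb.comp (measurable_fst.prodMk ((hWm 0).comp measurable_snd))).stronglyMeasurable
  exact (h.integral_prod_right (ν := P)).measurable.comp measurable_fst

theorem measurable_empDev_left (hWm : ∀ i, Measurable (W i)) {b : ℝ → 𝓦 → ℂ}
    (hb : Measurable (Function.uncurry b)) (n : ℕ) (ω : Ω) :
    Measurable fun u => empDev P W (b u) n ω := by
  have h := (measurable_empDev_uncurry (P := P) hWm hb n)
  have h2 : Measurable fun u : ℝ => (u, ω) := measurable_prodMk_right
  have h3 := Measurable.comp h h2
  simpa only [Function.comp_def] using h3

/-- Mean square bound for the integral of a family of deviations of empirical means. -/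
theorem lintegral_sq_lintegral_empDev_le (hWm : ∀ i, Measurable (W i)) (hW : iIndepFun W P)
    (hid : ∀ i, IdentDistrib (W i) (W 0) P P) {b : ℝ → 𝓦 → ℂ}
    (hb : Measurable (Function.uncurry b)) (hb2 : ∀ u, ∫⁻ ω, ‖b u (W 0 ω)‖ₑ ^ 2 ∂P ≠ ∞)
    (ν : Measure ℝ) [SFinite ν] {n : ℕ} (hn : 1 ≤ n) :
    ∫⁻ ω, (∫⁻ u, ‖empDev P W (b u) n ω‖ₑ ∂ν) ^ 2 ∂P
      ≤ ν Set.univ * (∫⁻ u, ∫⁻ ω, ‖b u (W 0 ω)‖ₑ ^ 2 ∂P ∂ν) / n := by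
  have hm := measurable_empDev_uncurry (P := P) hWm hb n
  have hmω := fun ω => measurable_empDev_left (P := P) hWm hb n ω
  have hm2 : Measurable fun z : Ω × ℝ => ‖empDev P W (b z.2) n z.1‖ₑ ^ 2 := by
    have h := Measurable.comp hm (measurable_swap (α := Ω) (β := ℝ))
    simp only [Function.comp_def, Prod.fst_swap, Prod.snd_swap] at h
    exact h.enorm.pow_const 2
  -- Cauchy–Schwarz in `u`, then Tonelli, reduce the claim to the variance bound at each fixed `u`.
  have h1 : ∫⁻ ω, (∫⁻ u, ‖empDev P W (b u) n ω‖ₑ ∂ν) ^ 2 ∂P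
      ≤ ∫⁻ ω, ν Set.univ * ∫⁻ u, ‖empDev P W (b u) n ω‖ₑ ^ 2 ∂ν ∂P :=
    lintegral_mono fun ω => sq_lintegral_le ν (hmω ω).enorm.aemeasurable
  have h2 : ∫⁻ ω, ν Set.univ * ∫⁻ u, ‖empDev P W (b u) n ω‖ₑ ^ 2 ∂ν ∂P
      = ν Set.univ * ∫⁻ ω, ∫⁻ u, ‖empDev P W (b u) n ω‖ₑ ^ 2 ∂ν ∂P :=
    lintegral_const_mul _ hm2.lintegral_prod_right'
  have h3 : ∫⁻ ω, ∫⁻ u, ‖empDev P W (b u) n ω‖ₑ ^ 2 ∂ν ∂P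
      = ∫⁻ u, ∫⁻ ω, ‖empDev P W (b u) n ω‖ₑ ^ 2 ∂P ∂ν :=
    lintegral_lintegral_swap hm2.aemeasurable
  have h4 : ∫⁻ u, ∫⁻ ω, ‖empDev P W (b u) n ω‖ₑ ^ 2 ∂P ∂ν
      ≤ ∫⁻ u, (∫⁻ ω, ‖b u (W 0 ω)‖ₑ ^ 2 ∂P) * (n : ℝ≥0∞)⁻¹ ∂ν :=
    lintegral_mono fun u =>
      lintegral_sq_empDev_le hWm hW hid (hb.comp measurable_prodMk_left) (hb2 u) hn
  rw [lintegral_mul_const' _ _ (by simp; omega)] at h4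
  rw [h2, h3] at h1
  refine h1.trans ?_
  rw [mul_div_assoc]
  exact mul_le_mul_right h4 _

theorem lintegral_le_rpow_of_sq_le {X : Ω → ℝ≥0∞} (hX : AEMeasurable X P) {c : ℝ≥0∞}
    (h : ∫⁻ ω, X ω ^ 2 ∂P ≤ c) : ∫⁻ ω, X ω ∂P ≤ c ^ (1 / 2 : ℝ) := by
  have h1 := sq_lintegral_le P hX
  rw [measure_univ, one_mul] at h1
  have h2 := ENNReal.rpow_le_rpow (h1.trans h) (z := 1 / 2) (by norm_num)
  rw [← ENNReal.rpow_natCast, ← ENNReal.rpow_mul] at h2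
  norm_num at h2
  simpa using h2

end IID

end EIV

namespace EIV

/-! ### Minimum contrast estimation -/

/-- The minimum of `S` over the compact set of parameters at distance at least `ρ` is attained and
exceeds `S θ₀`; if that set is empty, any gap will do. -/
theorem exists_separation {E : Type*} [NormedAddCommGroup E] {Θ : Set E} (hΘ : IsCompact Θ) {S : E → ℝ} (hS : ContinuousOn S Θ)
    {θ₀ : E} (hmin : ∀ θ ∈ Θ, θ ≠ θ₀ → S θ₀ < S θ) {ρ : ℝ} (hρ : 0 < ρ) :
    ∃ κ > 0, ∀ θ ∈ Θ, ρ ≤ ‖θ - θ₀‖ → S θ₀ + κ ≤ S θ := by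
  have hK : IsCompact (Θ ∩ {θ | ρ ≤ ‖θ - θ₀‖}) :=
    hΘ.inter_right (isClosed_le continuous_const (by fun_prop))
  by_cases hne : (Θ ∩ {θ | ρ ≤ ‖θ - θ₀‖}).Nonempty
  · obtain ⟨θ₁, hθ₁, h⟩ := hK.exists_isMinOn hne (hS.mono Set.inter_subset_left)
    have hpos : S θ₀ < S θ₁ := hmin θ₁ hθ₁.1 (by
      rintro rfl
      have := hθ₁.2
      simp only [Set.mem_ofPred_eq, sub_self, norm_zero] at this
      linarith)
    refine ⟨S θ₁ - S θ₀, by linarith, fun θ hθ hd => ?_⟩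
    have : S θ₁ ≤ S θ := h ⟨hθ, hd⟩
    linarith
  · exact ⟨1, one_pos, fun θ hθ hd => absurd ⟨θ, hθ, hd⟩ hne⟩

/-! ### Rate of convergence and asymptotic linearity -/

section Contrast

variable {E : Type*} [NormedAddCommGroup E] [NormedSpace ℝ E]

/-- Second order Taylor expansion, with Peano remainder, at a critical point. -/
theorem taylor_two_of_isLocalMin {S : E → ℝ} {θ₀ : E} (hd : ∀ᶠ θ in 𝓝 θ₀, DifferentiableAt ℝ S θ)
    (hd2 : DifferentiableAt ℝ (fderiv ℝ S) θ₀) (hmin : IsLocalMin S θ₀) {ε : ℝ} (hε : 0 < ε) :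
    ∃ ρ > 0, ∀ θ ∈ Metric.ball θ₀ ρ,
      |S θ - S θ₀ - 1 / 2 * fderiv ℝ (fderiv ℝ S) θ₀ (θ - θ₀) (θ - θ₀)| ≤ ε * ‖θ - θ₀‖ ^ 2 := by
  set B := fderiv ℝ (fderiv ℝ S) θ₀ with hB
  have hsymm : ∀ v w, B v w = B w v := second_derivative_symmetric_of_eventually
    (hd.mono fun θ h => h.hasFDerivAt) hd2.hasFDerivAt
  have hder := hd2.hasFDerivAt.isLittleO.def hε
  rw [hmin.fderiv_eq_zero] at hder
  obtain ⟨ρ, hρ, hball⟩ := Metric.eventually_nhds_iff_ball.1 (hd.and hder)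
  refine ⟨ρ, hρ, fun θ hθ => ?_⟩
  have hsub : Metric.closedBall θ₀ ‖θ - θ₀‖ ⊆ Metric.ball θ₀ ρ := by
    intro x hx
    rw [Metric.mem_closedBall] at hx
    rw [Metric.mem_ball] at hθ ⊢
    rw [dist_eq_norm] at hθ
    linarith
  -- The mean value inequality is applied to `S` minus its quadratic part. By symmetry of `B` the
  -- derivative is `∇S(x) - B (x - θ₀)`, which is `o(‖x - θ₀‖)` because the gradient vanishes at
  -- `θ₀` and is differentiable there.
  have hφ : ∀ x ∈ Metric.closedBall θ₀ ‖θ - θ₀‖,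
      HasFDerivWithinAt (fun x => S x - S θ₀ - 1 / 2 * B (x - θ₀) (x - θ₀))
        (fderiv ℝ S x - B (x - θ₀)) (Metric.closedBall θ₀ ‖θ - θ₀‖) x := by
    intro x hx
    have h1 := ((hball x (hsub hx)).1.hasFDerivAt).sub_const (S θ₀)
    have h2 : HasFDerivAt (fun x => x - θ₀) (ContinuousLinearMap.id ℝ E) x :=
      (hasFDerivAt_id x).sub_const θ₀
    have h3 := (B.hasFDerivAt_of_bilinear h2 h2).const_mul (1 / 2 : ℝ)
    refine ((h1.sub h3).congr_fderiv ?_).hasFDerivWithinAt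
    ext v
    simp only [sub_apply, smul_apply, add_apply, ContinuousLinearMap.precompR_apply,
      ContinuousLinearMap.precompL_apply, ContinuousLinearMap.id_apply, smul_eq_mul,
      ContinuousLinearMap.compL_apply, ContinuousLinearMap.comp_apply]
    rw [hsymm v]
    ring
  have hle : ∀ x ∈ Metric.closedBall θ₀ ‖θ - θ₀‖, ‖fderiv ℝ S x - B (x - θ₀)‖
      ≤ ε * ‖θ - θ₀‖ := by
    intro x hx
    have := (hball x (hsub hx)).2
    rw [sub_zero] at this
    refine this.trans ?_
    rw [mem_closedBall_iff_norm] at hx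
    gcongr
  have := (convex_closedBall θ₀ ‖θ - θ₀‖).norm_image_sub_le_of_norm_hasFDerivWithin_le hφ hle
    (Metric.mem_closedBall_self (norm_nonneg _)) (mem_closedBall_iff_norm.2 le_rfl : θ ∈ _)
  simp only [sub_self, map_zero, mul_zero, sub_zero, Real.norm_eq_abs] at this
  rw [pow_two, ← mul_assoc]
  exact this

theorem exists_pos_le_of_pos [FiniteDimensional ℝ E] (B : E →L[ℝ] E →L[ℝ] ℝ)
    (hB : ∀ v, v ≠ 0 → 0 < B v v) : ∃ c > 0, ∀ v, c * ‖v‖ ^ 2 ≤ B v v := by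
  have : ProperSpace E := FiniteDimensional.proper_real E
  have hc : Continuous fun v => B v v := by fun_prop
  by_cases hne : (Metric.sphere (0 : E) 1).Nonempty
  · obtain ⟨v₀, hv₀, hmin⟩ := (isCompact_sphere (0 : E) 1).exists_isMinOn hne hc.continuousOn
    have hv₀' : ‖v₀‖ = 1 := by simpa using hv₀
    refine ⟨B v₀ v₀, hB v₀ (by rintro rfl; simp at hv₀'), fun v => ?_⟩
    by_cases hv : v = 0
    · simp [hv]
    · have hv' : ‖v‖ ≠ 0 := norm_ne_zero_iff.2 hv
      have h1 : B v₀ v₀ ≤ B (‖v‖⁻¹ • v) (‖v‖⁻¹ • v) := hmin (by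
        rw [mem_sphere_zero_iff_norm, norm_smul, norm_inv, norm_norm, inv_mul_cancel₀ hv'])
      simp only [map_smul, smul_apply, smul_eq_mul] at h1
      have h2 : 0 < ‖v‖ ^ 2 := by positivity
      calc B v₀ v₀ * ‖v‖ ^ 2 ≤ ‖v‖⁻¹ * (‖v‖⁻¹ * B v v) * ‖v‖ ^ 2 := by gcongr
        _ = B v v := by field_simp
  -- An empty unit sphere means that the space is trivial.
  · refine ⟨1, one_pos, fun v => ?_⟩
    by_cases hv : v = 0
    · simp [hv]
    · exact absurd ⟨‖v‖⁻¹ • v, by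
        rw [mem_sphere_zero_iff_norm, norm_smul, norm_inv, norm_norm,
          inv_mul_cancel₀ (norm_ne_zero_iff.2 hv)]⟩ hne

variable {Ω : Type*} [MeasurableSpace Ω] {P : Measure Ω} [IsProbabilityMeasure P]

/-- Mean square rate of convergence of minimum contrast estimators. -/
theorem exists_lintegral_sq_norm_le {Θ : Set E} (hΘ : IsCompact Θ) {θ₀ : E} (hθ₀ : θ₀ ∈ Θ)
    {S : E → ℝ} (hS : ContinuousOn S Θ) (hmin : ∀ θ ∈ Θ, θ ≠ θ₀ → S θ₀ < S θ)
    {c ρ₀ : ℝ} (hc : 0 < c) (hρ₀ : 0 < ρ₀)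
    (hquad : ∀ θ ∈ Metric.ball θ₀ ρ₀, c * ‖θ - θ₀‖ ^ 2 ≤ S θ - S θ₀)
    {Sn : ℕ → Ω → E → ℝ} {θhat : ℕ → Ω → E} (hmem : ∀ n, ∀ᵐ ω ∂P, θhat n ω ∈ Θ)
    (hest : ∀ n, ∀ᵐ ω ∂P, ∀ θ ∈ Θ, Sn n ω (θhat n ω) ≤ Sn n ω θ)
    {M L : ℕ → Ω → ℝ≥0∞} {β : ℕ → ℝ≥0∞} {C₁ C₂ : ℝ≥0∞} (hC₁ : C₁ ≠ ∞) (hC₂ : C₂ ≠ ∞)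
    (hMm : ∀ n, Measurable (M n)) (hM2 : ∀ n, 1 ≤ n → ∫⁻ ω, M n ω ^ 2 ∂P ≤ C₁ / n)
    (hL2 : ∀ n, 1 ≤ n → ∫⁻ ω, L n ω ^ 2 ∂P ≤ C₂ / n) (hβ : Tendsto β atTop (𝓝 0))
    (hM : ∀ n ω, ∀ θ ∈ Θ, ‖Sn n ω θ - S θ‖ₑ ≤ M n ω + β n)
    (hL : ∀ n, 1 ≤ n → ∀ ω, ∀ θ ∈ Metric.ball θ₀ ρ₀,
      ‖(Sn n ω θ - S θ) - (Sn n ω θ₀ - S θ₀)‖ₑ ≤ L n ω * ‖θ - θ₀‖ₑ) :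
    ∃ C : ℝ≥0∞, C ≠ ∞ ∧ ∀ n, 1 ≤ n → ∫⁻ ω, ‖θhat n ω - θ₀‖ₑ ^ 2 ∂P ≤ C / n := by
  obtain ⟨κ, hκ, hsep⟩ := exists_separation hΘ hS hmin hρ₀
  obtain ⟨D, hD⟩ := hΘ.isBounded.exists_norm_le
  set D' : ℝ := D + ‖θ₀‖ with hD'
  have hdist : ∀ θ ∈ Θ, ‖θ - θ₀‖ ≤ D' := fun θ hθ =>
    (norm_sub_le _ _).trans (by rw [hD']; gcongr; exact hD θ hθ)
  have hdiste : ∀ θ ∈ Θ, ‖θ - θ₀‖ₑ ^ 2 ≤ ENNReal.ofReal D' ^ 2 := fun θ hθ => by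
    rw [← ofReal_norm]
    gcongr
    exact hdist θ hθ
  have hev : ∀ᶠ n in atTop, β n < ENNReal.ofReal (κ / 8) :=
    hβ.eventually_lt_const (by simpa using hκ)
  obtain ⟨N, hN⟩ := eventually_atTop.1 hev
  -- `A₁` pays for the event `M ≥ κ/8`, where the squared error is at most `D'² ≤ D'² (8M/κ)²`. `A₂`
  -- comes from `c ‖h‖² ≤ L ‖h‖` off this event. The last term of the constant covers the finitely
  -- many `n < N` for which `β n` is not yet small.
  set A₁ : ℝ≥0∞ := ENNReal.ofReal D' ^ 2 * ENNReal.ofReal (8 / κ) ^ 2 with hA₁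
  set A₂ : ℝ≥0∞ := ENNReal.ofReal (1 / c) ^ 2 with hA₂
  have hA₁' : A₁ ≠ ∞ := ENNReal.mul_ne_top (ENNReal.pow_ne_top ENNReal.ofReal_ne_top)
    (ENNReal.pow_ne_top ENNReal.ofReal_ne_top)
  have hA₂' : A₂ ≠ ∞ := ENNReal.pow_ne_top ENNReal.ofReal_ne_top
  refine ⟨A₁ * C₁ + A₂ * C₂ + ENNReal.ofReal D' ^ 2 * N,
    by finiteness, fun n hn => ?_⟩
  by_cases hnN : n < N
  · calc ∫⁻ ω, ‖θhat n ω - θ₀‖ₑ ^ 2 ∂P ≤ ∫⁻ _, ENNReal.ofReal D' ^ 2 ∂P := by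
          refine lintegral_mono_ae ?_
          filter_upwards [hmem n] with ω hω using hdiste _ hω
      _ = ENNReal.ofReal D' ^ 2 := by simp
      _ ≤ ENNReal.ofReal D' ^ 2 * N / n := by
          rw [ENNReal.le_div_iff_mul_le (by left; simp; omega) (by left; simp)]
          gcongr
      _ ≤ _ := by gcongr; exact le_add_self
  · have key : ∀ᵐ ω ∂P, ‖θhat n ω - θ₀‖ₑ ^ 2 ≤ A₁ * M n ω ^ 2 + A₂ * L n ω ^ 2 := by
      filter_upwards [hmem n, hest n] with ω hω hmin'
      have hle : Sn n ω (θhat n ω) ≤ Sn n ω θ₀ := hmin' θ₀ hθ₀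
      by_cases hMκ : ENNReal.ofReal (κ / 8) ≤ M n ω
      · refine le_trans ?_ (le_add_right (a := A₁ * M n ω ^ 2) le_rfl)
        have h1 : 1 ≤ ENNReal.ofReal (8 / κ) * M n ω := by
          calc (1 : ℝ≥0∞) = ENNReal.ofReal (8 / κ) * ENNReal.ofReal (κ / 8) := by
                rw [← ENNReal.ofReal_mul (by positivity)]
                field_simp
                simp
            _ ≤ _ := by gcongr
        calc ‖θhat n ω - θ₀‖ₑ ^ 2 ≤ ENNReal.ofReal D' ^ 2 * 1 ^ 2 := by
              simpa using hdiste _ hω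
          _ ≤ ENNReal.ofReal D' ^ 2 * (ENNReal.ofReal (8 / κ) * M n ω) ^ 2 := by gcongr
          _ = _ := by rw [hA₁]; ring
      · refine le_trans ?_ (le_add_left (a := A₂ * L n ω ^ 2) le_rfl)
        push Not at hMκ
        -- Two deviations of at most `κ/4` cannot compensate the gap `κ`, so the minimizer lies in
        -- the ball where `S` grows quadratically.
        have hsmall : ∀ θ ∈ Θ, |Sn n ω θ - S θ| ≤ κ / 4 := fun θ hθ => by
          have h1 : ‖Sn n ω θ - S θ‖ₑ ≤ ENNReal.ofReal (κ / 8) + ENNReal.ofReal (κ / 8) :=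
            (hM n ω θ hθ).trans (add_le_add hMκ.le (hN n (by omega)).le)
          rw [← ENNReal.ofReal_add (by positivity) (by positivity), ← ofReal_norm,
            ENNReal.ofReal_le_ofReal_iff (by positivity), Real.norm_eq_abs] at h1
          linarith
        have hball : θhat n ω ∈ Metric.ball θ₀ ρ₀ := by
          rw [mem_ball_iff_norm]
          by_contra hcon
          push Not at hcon
          have h1 := hsep _ hω hcon
          have h2 := abs_le.1 (hsmall _ hω)
          have h3 := abs_le.1 (hsmall _ hθ₀)
          linarith [h2.1, h3.2]
        have h1 := hquad _ hball
        have h2 := hL n hn ω _ hball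
        have h3 : c * ‖θhat n ω - θ₀‖ ^ 2
            ≤ ‖(Sn n ω (θhat n ω) - S (θhat n ω)) - (Sn n ω θ₀ - S θ₀)‖ := by
          rw [Real.norm_eq_abs]
          have := neg_abs_le ((Sn n ω (θhat n ω) - S (θhat n ω)) - (Sn n ω θ₀ - S θ₀))
          linarith
        have h4 : ENNReal.ofReal c * ‖θhat n ω - θ₀‖ₑ ^ 2 ≤ L n ω * ‖θhat n ω - θ₀‖ₑ := by
          refine le_trans ?_ h2
          rw [← ofReal_norm, ← ofReal_norm, ← ENNReal.ofReal_pow (norm_nonneg _),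
            ← ENNReal.ofReal_mul hc.le]
          exact ENNReal.ofReal_le_ofReal h3
        have h5 : ‖θhat n ω - θ₀‖ₑ ≤ ENNReal.ofReal (1 / c) * L n ω := by
          by_cases h0 : ‖θhat n ω - θ₀‖ₑ = 0
          · rw [h0]; exact zero_le
          · rw [pow_two, ← mul_assoc, ENNReal.mul_le_mul_iff_left h0 enorm_ne_top] at h4
            calc ‖θhat n ω - θ₀‖ₑ
                = ENNReal.ofReal (1 / c) * (ENNReal.ofReal c * ‖θhat n ω - θ₀‖ₑ) := by
                  rw [← mul_assoc, ← ENNReal.ofReal_mul (by positivity)]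
                  field_simp
                  simp
              _ ≤ _ := by gcongr
        calc ‖θhat n ω - θ₀‖ₑ ^ 2 ≤ (ENNReal.ofReal (1 / c) * L n ω) ^ 2 := by gcongr
          _ = _ := by rw [hA₂]; ring
    calc ∫⁻ ω, ‖θhat n ω - θ₀‖ₑ ^ 2 ∂P
        ≤ ∫⁻ ω, A₁ * M n ω ^ 2 + A₂ * L n ω ^ 2 ∂P := lintegral_mono_ae key
      _ = A₁ * ∫⁻ ω, M n ω ^ 2 ∂P + A₂ * ∫⁻ ω, L n ω ^ 2 ∂P := by
          rw [lintegral_add_left (((hMm n).pow_const 2).const_mul _),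
            lintegral_const_mul' _ _ hA₁', lintegral_const_mul' _ _ hA₂']
      _ ≤ A₁ * (C₁ / n) + A₂ * (C₂ / n) := by
          gcongr
          · exact hM2 n hn
          · exact hL2 n hn
      _ = (A₁ * C₁ + A₂ * C₂) / n := by
          rw [ENNReal.add_div, mul_div_assoc, mul_div_assoc]
      _ ≤ _ := ENNReal.div_le_div_right le_self_add _

/-- Completing the square: up to errors the criterion at displacement `v` is `½ B(v, v) - B(T, v) =
½ B(v - T, v - T) - ½ B(T, T)`. If `h` does at least as well as `T`, then `½ B(h - T, h - T)` is
bounded by the errors alone. -/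
theorem norm_sub_sq_le_of_le {B : E →L[ℝ] E →L[ℝ] ℝ} (hsymm : ∀ v w, B v w = B w v) {c : ℝ}
    (hB : ∀ v, c * ‖v‖ ^ 2 ≤ B v v) {h T : E} {Δh ΔT Qh QT r ε : ℝ} (hle : Qh + Δh ≤ QT + ΔT)
    (hQh : |Qh - 1 / 2 * B h h| ≤ ε * ‖h‖ ^ 2) (hQT : |QT - 1 / 2 * B T T| ≤ ε * ‖T‖ ^ 2)
    (hΔh : |Δh + B T h| ≤ r * ‖h‖) (hΔT : |ΔT + B T T| ≤ r * ‖T‖) :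
    c / 2 * ‖h - T‖ ^ 2 ≤ r * (‖h‖ + ‖T‖) + ε * (‖h‖ ^ 2 + ‖T‖ ^ 2) := by
  have e : B (h - T) (h - T) = B h h - 2 * B T h + B T T := by
    simp only [map_sub, sub_apply]
    rw [hsymm h T]
    ring
  have h0 := hB (h - T)
  have h1 := abs_le.1 hQh
  have h2 := abs_le.1 hQT
  have h3 := abs_le.1 hΔh
  have h4 := abs_le.1 hΔT
  linarith [h1.1, h2.2, h3.1, h4.2]

theorem meas_norm_ge_le {X : Ω → E} (hX : AEMeasurable (fun ω => ‖X ω‖ₑ) P) {C : ℝ≥0∞} {n : ℕ}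
    (hn : 1 ≤ n) (h : ∫⁻ ω, ‖X ω‖ₑ ^ 2 ∂P ≤ C / n) {K : ℝ} (hK : 0 < K) :
    P {ω | K ≤ Real.sqrt n * ‖X ω‖} ≤ C / ENNReal.ofReal (K ^ 2) := by
  have hn0 : (0 : ℝ) < n := by exact_mod_cast hn
  have hsub : {ω | K ≤ Real.sqrt n * ‖X ω‖} ⊆ {ω | ENNReal.ofReal (K ^ 2 / n) ≤ ‖X ω‖ₑ ^ 2} := by
    intro ω hω
    simp only [Set.mem_ofPred_eq] at hω ⊢
    rw [← ofReal_norm, ← ENNReal.ofReal_pow (norm_nonneg _)]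
    refine ENNReal.ofReal_le_ofReal ?_
    rw [div_le_iff₀ hn0]
    calc K ^ 2 ≤ (Real.sqrt n * ‖X ω‖) ^ 2 := by gcongr
      _ = ‖X ω‖ ^ 2 * n := by rw [mul_pow, Real.sq_sqrt hn0.le, mul_comm]
  have hpos : ENNReal.ofReal (K ^ 2 / n) ≠ 0 := (ENNReal.ofReal_pos.2 (by positivity)).ne'
  refine (measure_mono hsub).trans ((meas_ge_le_lintegral_div (hX.pow_const 2) hpos
    ENNReal.ofReal_ne_top).trans ?_)
  calc (∫⁻ ω, ‖X ω‖ₑ ^ 2 ∂P) / ENNReal.ofReal (K ^ 2 / n)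
      ≤ C / n / ENNReal.ofReal (K ^ 2 / n) := ENNReal.div_le_div_right h _
    _ = C / ENNReal.ofReal (K ^ 2) := by
        rw [ENNReal.ofReal_div_of_pos hn0, ENNReal.ofReal_natCast, div_eq_mul_inv, div_eq_mul_inv,
          div_eq_mul_inv, div_eq_mul_inv, ENNReal.mul_inv (by right; simp; omega) (by left; simp), inv_inv, mul_assoc,
          mul_comm _ (n : ℝ≥0∞), ← mul_assoc _ (n : ℝ≥0∞), ENNReal.inv_mul_cancel
            (by simp; omega) (by simp), one_mul]

/-- Asymptotic linearity of minimum contrast estimators. -/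
theorem tendsto_meas_sqrt_mul_norm_sub {Θ : Set E} {θ₀ : E} (hθ₀ : θ₀ ∈ interior Θ) {S : E → ℝ}
    {B : E →L[ℝ] E →L[ℝ] ℝ} (hsymm : ∀ v w, B v w = B w v) {c : ℝ} (hc : 0 < c)
    (hB : ∀ v, c * ‖v‖ ^ 2 ≤ B v v)
    (htaylor : ∀ ε > 0, ∃ ρ > 0, ∀ θ ∈ Metric.ball θ₀ ρ,
      |S θ - S θ₀ - 1 / 2 * B (θ - θ₀) (θ - θ₀)| ≤ ε * ‖θ - θ₀‖ ^ 2)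
    {Sn : ℕ → Ω → E → ℝ} {θhat : ℕ → Ω → E}
    (hest : ∀ n, ∀ᵐ ω ∂P, ∀ θ ∈ Θ, Sn n ω (θhat n ω) ≤ Sn n ω θ)
    (hθm : ∀ n, AEMeasurable (fun ω => ‖θhat n ω - θ₀‖ₑ) P)
    {T : ℕ → Ω → E} (hTm : ∀ n, AEMeasurable (fun ω => ‖T n ω‖ₑ) P)
    {C₁ C₂ : ℝ≥0∞} (hC₁ : C₁ ≠ ∞) (hC₂ : C₂ ≠ ∞)
    (hθ2 : ∀ n, 1 ≤ n → ∫⁻ ω, ‖θhat n ω - θ₀‖ₑ ^ 2 ∂P ≤ C₁ / n)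
    (hT2 : ∀ n, 1 ≤ n → ∫⁻ ω, ‖T n ω‖ₑ ^ 2 ∂P ≤ C₂ / n)
    (hR : ∀ ε : ℝ, 0 < ε → ∃ ρ > 0, ∃ N : ℕ, ∀ n ≥ N, ∃ R : Ω → ℝ≥0∞, AEMeasurable R P ∧
      ∫⁻ ω, R ω ∂P ≤ ENNReal.ofReal (ε / Real.sqrt n) ∧
      ∀ ω, ∀ θ ∈ Metric.ball θ₀ ρ, ‖(Sn n ω θ - S θ) - (Sn n ω θ₀ - S θ₀)
        + B (T n ω) (θ - θ₀)‖ₑ ≤ R ω * ‖θ - θ₀‖ₑ)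
    {δ : ℝ} (hδ : 0 < δ) :
    Tendsto (fun n : ℕ => P {ω | δ ≤ Real.sqrt n * ‖θhat n ω - θ₀ - T n ω‖}) atTop (𝓝 0) := by
  refine ENNReal.tendsto_nhds_zero.2 fun η hη => ?_
  obtain ⟨η₁, hη₁, hη₁η⟩ : ∃ η₁ : ℝ, 0 < η₁ ∧ ENNReal.ofReal (3 * η₁) ≤ η := by
    obtain ⟨q, hq, hqη⟩ := ENNReal.lt_iff_exists_nnreal_btwn.1 hη
    refine ⟨q / 3, by have : 0 < q := by exact_mod_cast hq
                      positivity, ?_⟩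
    rw [mul_div_cancel₀ _ (by norm_num : (3 : ℝ) ≠ 0), ENNReal.ofReal_coe_nnreal]
    exact hqη.le
  -- Large enough that the scaled norms of the error and of `T n` each reach `K` with probability at
  -- most `η₁`; the added `1` gives `K ≤ K²`.
  set K : ℝ := 1 + (C₁.toReal + C₂.toReal) / η₁ with hK
  have hK1 : 1 ≤ K := by
    rw [hK]; linarith [show 0 ≤ (C₁.toReal + C₂.toReal) / η₁ by positivity]
  have hK0 : 0 < K := by linarith
  have hCK : ∀ C : ℝ≥0∞, C ≠ ∞ → C.toReal ≤ C₁.toReal + C₂.toReal →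
      C / ENNReal.ofReal (K ^ 2) ≤ ENNReal.ofReal η₁ := by
    intro C hC hCle
    rw [← ENNReal.ofReal_toReal hC, ← ENNReal.ofReal_div_of_pos (by positivity)]
    refine ENNReal.ofReal_le_ofReal ?_
    rw [div_le_iff₀ (by positivity)]
    have h1 : (C₁.toReal + C₂.toReal) / η₁ ≤ K ^ 2 := by nlinarith
    rw [div_le_iff₀ hη₁] at h1
    linarith
  -- The constants in `lam` and in the Taylor precision make each of the two errors of the quadratic
  -- comparison at most `c δ² / (8 n)`. Their sum `c δ² / (4 n)` is less than the value `c δ² / (2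
  -- n)` that a distance of `δ / √n` would force. The factor `η₁` in the call of `hR` is what
  -- Markov's inequality consumes.
  set lam : ℝ := c * δ ^ 2 / (16 * K) with hlam
  have hlam0 : 0 < lam := by positivity
  obtain ⟨ρ₁, hρ₁, hty⟩ := htaylor (c * δ ^ 2 / (16 * K ^ 2)) (by positivity)
  obtain ⟨ρ₂, hρ₂, N, hN⟩ := hR (lam * η₁) (by positivity)
  obtain ⟨ρ₃, hρ₃, hball⟩ := Metric.isOpen_iff.1 isOpen_interior θ₀ hθ₀
  set ρ := min ρ₁ (min ρ₂ ρ₃) with hρdef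
  have hρ : 0 < ρ := lt_min hρ₁ (lt_min hρ₂ hρ₃)
  have hsqrt : Tendsto (fun n : ℕ => Real.sqrt n) atTop atTop :=
    Real.tendsto_sqrt_atTop.comp tendsto_natCast_atTop_atTop
  filter_upwards [eventually_ge_atTop (max N 1), hsqrt.eventually_gt_atTop (K / ρ)] with n hn hnρ
  have hnN : N ≤ n := le_trans (le_max_left _ _) hn
  have hn1 : 1 ≤ n := le_trans (le_max_right _ _) hn
  obtain ⟨R, hRm, hRle, hRb⟩ := hN n hnN
  have hs0 : 0 < Real.sqrt n := Real.sqrt_pos.2 (by exact_mod_cast hn1)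
  have hKρ : K / Real.sqrt n < ρ := by
    rw [div_lt_iff₀ hs0]; rwa [div_lt_iff₀ hρ, mul_comm] at hnρ
  have hA1 := (meas_norm_ge_le (hθm n) hn1 (hθ2 n hn1) hK0).trans
    (hCK C₁ hC₁ (by linarith [C₂.toReal_nonneg]))
  have hA2 := (meas_norm_ge_le (hTm n) hn1 (hT2 n hn1) hK0).trans
    (hCK C₂ hC₂ (by linarith [C₁.toReal_nonneg]))
  have hA3 : P {ω | ENNReal.ofReal (lam / Real.sqrt n) ≤ R ω} ≤ ENNReal.ofReal η₁ := by
    refine (meas_ge_le_lintegral_div hRm (by simp; positivity) ENNReal.ofReal_ne_top).trans ?_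
    refine (ENNReal.div_le_div_right hRle _).trans (le_of_eq ?_)
    rw [← ENNReal.ofReal_div_of_pos (by positivity)]
    congr 1
    field_simp
  have hsub : ∀ᵐ ω ∂P, ω ∈ {ω | δ ≤ Real.sqrt n * ‖θhat n ω - θ₀ - T n ω‖} →
      ω ∈ ({ω | K ≤ Real.sqrt n * ‖θhat n ω - θ₀‖} ∪ {ω | K ≤ Real.sqrt n * ‖T n ω‖})
        ∪ {ω | ENNReal.ofReal (lam / Real.sqrt n) ≤ R ω} := by
    filter_upwards [hest n] with ω hmin hω
    by_contra hcon
    simp only [Set.mem_union, Set.mem_ofPred_eq, not_or, not_le] at hcon hω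
    obtain ⟨⟨ha, ht⟩, hr⟩ := hcon
    have ha' : ‖θhat n ω - θ₀‖ < K / Real.sqrt n := by rwa [lt_div_iff₀ hs0, mul_comm]
    have ht' : ‖T n ω‖ < K / Real.sqrt n := by rwa [lt_div_iff₀ hs0, mul_comm]
    have hRfin : R ω ≠ ∞ := (hr.trans ENNReal.ofReal_lt_top).ne
    have hr' : (R ω).toReal ≤ lam / Real.sqrt n :=
      ENNReal.toReal_le_of_le_ofReal (by positivity) hr.le
    have hb1 : θhat n ω ∈ Metric.ball θ₀ ρ := by
      rw [mem_ball_iff_norm]; exact ha'.trans hKρ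
    have hb2 : θ₀ + T n ω ∈ Metric.ball θ₀ ρ := by
      rw [mem_ball_iff_norm, add_sub_cancel_left]; exact ht'.trans hKρ
    have hρ1 : Metric.ball θ₀ ρ ⊆ Metric.ball θ₀ ρ₁ := Metric.ball_subset_ball (min_le_left _ _)
    have hρ2 : Metric.ball θ₀ ρ ⊆ Metric.ball θ₀ ρ₂ :=
      Metric.ball_subset_ball ((min_le_right _ _).trans (min_le_left _ _))
    have hρ3 : Metric.ball θ₀ ρ ⊆ Metric.ball θ₀ ρ₃ :=
      Metric.ball_subset_ball ((min_le_right _ _).trans (min_le_right _ _))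
    -- Off the exceptional events `θ₀ + T n` belongs to `Θ`, so it is an admissible competitor of
    -- the minimizer.
    have hle := hmin (θ₀ + T n ω) (interior_subset (hball (hρ3 hb2)))
    have q1 := hty _ (hρ1 hb1)
    have q2 := hty _ (hρ1 hb2)
    have real : ∀ θ ∈ Metric.ball θ₀ ρ₂, |(Sn n ω θ - S θ) - (Sn n ω θ₀ - S θ₀)
        + B (T n ω) (θ - θ₀)| ≤ (R ω).toReal * ‖θ - θ₀‖ := fun θ hθ => by
      have := ENNReal.toReal_mono (ENNReal.mul_ne_top hRfin enorm_ne_top) (hRb ω θ hθ)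
      rwa [toReal_enorm, ENNReal.toReal_mul, toReal_enorm, Real.norm_eq_abs] at this
    have d1 := real _ (hρ2 hb1)
    have d2 := real _ (hρ2 hb2)
    rw [add_sub_cancel_left] at q2 d2
    have main := norm_sub_sq_le_of_le hsymm hB
      (Qh := S (θhat n ω) - S θ₀) (QT := S (θ₀ + T n ω) - S θ₀)
      (Δh := (Sn n ω (θhat n ω) - S (θhat n ω)) - (Sn n ω θ₀ - S θ₀))
      (ΔT := (Sn n ω (θ₀ + T n ω) - S (θ₀ + T n ω)) - (Sn n ω θ₀ - S θ₀))
      (by linarith) q1 q2 d1 d2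
    set x := ‖θhat n ω - θ₀ - T n ω‖ with hx
    set a := ‖θhat n ω - θ₀‖ with hadef
    set t := ‖T n ω‖ with htdef
    set s := Real.sqrt n with hsdef
    have ha0 : 0 ≤ a := norm_nonneg _
    have ht0 : 0 ≤ t := norm_nonneg _
    have b1 : (R ω).toReal * (a + t) ≤ lam / s * (K / s + K / s) := by gcongr
    have b2 : c * δ ^ 2 / (16 * K ^ 2) * (a ^ 2 + t ^ 2)
        ≤ c * δ ^ 2 / (16 * K ^ 2) * ((K / s) ^ 2 + (K / s) ^ 2) := by gcongr
    have b3 : lam / s * (K / s + K / s) + c * δ ^ 2 / (16 * K ^ 2) * ((K / s) ^ 2 + (K / s) ^ 2)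
        = c * δ ^ 2 / 4 / s ^ 2 := by
      rw [hlam]
      field_simp
      ring
    have b4 : c / 2 * x ^ 2 ≤ c * δ ^ 2 / 4 / s ^ 2 := by linarith
    rw [le_div_iff₀ (by positivity)] at b4
    have b5 : δ ^ 2 ≤ (s * x) ^ 2 := by gcongr
    have b6 : c * δ ^ 2 ≤ c * (s * x) ^ 2 := by gcongr
    have b7 : 0 < c * δ ^ 2 := by positivity
    nlinarith
  calc P {ω | δ ≤ Real.sqrt n * ‖θhat n ω - θ₀ - T n ω‖}
      ≤ P (({ω | K ≤ Real.sqrt n * ‖θhat n ω - θ₀‖} ∪ {ω | K ≤ Real.sqrt n * ‖T n ω‖})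
        ∪ {ω | ENNReal.ofReal (lam / Real.sqrt n) ≤ R ω}) := measure_mono_ae hsub
    _ ≤ ENNReal.ofReal η₁ + ENNReal.ofReal η₁ + ENNReal.ofReal η₁ :=
        (measure_union_le _ _).trans (add_le_add ((measure_union_le _ _).trans
          (add_le_add hA1 hA2)) hA3)
    _ = ENNReal.ofReal (3 * η₁) := by
        rw [← ENNReal.ofReal_add hη₁.le hη₁.le, ← ENNReal.ofReal_add (by positivity) hη₁.le]
        congr 1
        ring
    _ ≤ η := hη₁η

end Contrast

end EIV

namespace EIV

/-! ### The multivariate central limit theorem -/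

section CLT

variable {Ω : Type*} [MeasurableSpace Ω] {P : Measure Ω} [IsProbabilityMeasure P]
  {𝓦 : Type*} [MeasurableSpace 𝓦] {W : ℕ → Ω → 𝓦} {d : ℕ}

omit [IsProbabilityMeasure P] in
theorem integral_inner_sq {u : Ω → Param d} (hu : ∀ j, MemLp (fun ω => u ω j) 2 P) (t : Param d) :
    ∫ ω, inner ℝ t (u ω) ^ 2 ∂P
      = dotProduct t ((Matrix.of fun i j => ∫ ω, u ω i * u ω j ∂P).mulVec t) := by
  have hint : ∀ i j, Integrable (fun ω => u ω i * u ω j) P := fun i j =>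
    (hu i).integrable_mul (hu j)
  have e : ∀ ω, inner ℝ t (u ω) ^ 2 = ∑ i, ∑ j, t i * (t j * (u ω i * u ω j)) := fun ω => by
    rw [PiLp.inner_apply, pow_two, Finset.sum_mul_sum]
    refine Finset.sum_congr rfl fun i _ => Finset.sum_congr rfl fun j _ => ?_
    simp only [RCLike.inner_apply, conj_trivial]
    ring
  simp_rw [e]
  rw [integral_finsetSum _ fun i _ => integrable_finsetSum _ fun j _ =>
    ((hint i j).const_mul _).const_mul _]
  simp only [dotProduct, Matrix.mulVec, Matrix.of_apply]
  refine Finset.sum_congr rfl fun i _ => ?_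
  rw [integral_finsetSum _ fun j _ => ((hint i j).const_mul _).const_mul _, Finset.mul_sum]
  refine Finset.sum_congr rfl fun j _ => ?_
  rw [integral_const_mul, integral_const_mul]
  ring

theorem posSemidef_second_moment {u : Ω → Param d} (hu : ∀ j, MemLp (fun ω => u ω j) 2 P) :
    (Matrix.of fun i j => ∫ ω, u ω i * u ω j ∂P).PosSemidef := by
  refine Matrix.PosSemidef.of_dotProduct_mulVec_nonneg ?_ fun x => ?_
  · ext i j
    simp [mul_comm]
  · have := integral_inner_sq hu (WithLp.toLp 2 x)
    simp only [star_trivial]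
    calc 0 ≤ ∫ ω, inner ℝ (WithLp.toLp 2 x) (u ω) ^ 2 ∂P := integral_nonneg fun _ => sq_nonneg _
      _ = _ := this

omit [IsProbabilityMeasure P] in
theorem aemeasurable_sqrt_smul_mean {U : ℕ → Ω → Param d} (hU : ∀ i, AEMeasurable (U i) P)
    (n : ℕ) : AEMeasurable (fun ω =>
      Real.sqrt n • ((n : ℝ)⁻¹ • ∑ i ∈ Finset.range n, U i ω)) P := by
  have h : AEMeasurable (fun ω => ∑ i ∈ Finset.range n, U i ω) P :=
    Finset.aemeasurable_fun_sum _ fun i _ => hU i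
  have h2 : Measurable fun x : Param d => Real.sqrt n • ((n : ℝ)⁻¹ • x) := by fun_prop
  exact h2.comp_aemeasurable h

omit [IsProbabilityMeasure P] in
-- Cramér–Wold reduction to the real projections evaluated at `1`; at `n = 0` both variables are
-- `0`.
theorem charFun_map_sqrt_smul_mean {U : ℕ → Ω → Param d} (hU : ∀ i, AEMeasurable (U i) P)
    (n : ℕ) (t : Param d) :
    charFun (P.map fun ω => Real.sqrt n • ((n : ℝ)⁻¹ • ∑ i ∈ Finset.range n, U i ω)) t
      = charFun (P.map fun ω => (Real.sqrt n)⁻¹ * ∑ i ∈ Finset.range n, (inner ℝ t (U i ω) : ℝ))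
        1 := by
  have hm : AEMeasurable (fun ω => (Real.sqrt n)⁻¹ *
      ∑ i ∈ Finset.range n, (inner ℝ t (U i ω) : ℝ)) P := by
    refine (Finset.aemeasurable_fun_sum _ fun i _ => ?_).const_mul _
    have h2 : Measurable fun x : Param d => (inner ℝ t x : ℝ) := by fun_prop
    exact h2.comp_aemeasurable (hU i)
  rw [charFun_apply, charFun_apply, integral_map (aemeasurable_sqrt_smul_mean hU n)
    (by fun_prop), integral_map hm (by fun_prop)]
  refine integral_congr_ae (ae_of_all _ fun ω => ?_)
  have e : (inner ℝ (Real.sqrt n • ((n : ℝ)⁻¹ • ∑ i ∈ Finset.range n, U i ω)) t : ℝ)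
      = inner ℝ ((Real.sqrt n)⁻¹ * ∑ i ∈ Finset.range n, (inner ℝ t (U i ω) : ℝ)) (1 : ℝ) := by
    rw [real_inner_smul_left, real_inner_smul_left, sum_inner]
    simp only [RCLike.inner_apply, conj_trivial, one_mul]
    simp_rw [real_inner_comm t]
    rw [← mul_assoc]
    congr 1
    rcases Nat.eq_zero_or_pos n with rfl | hn
    · simp
    · have : (0 : ℝ) < n := by exact_mod_cast hn
      have h2 : Real.sqrt n ≠ 0 := (Real.sqrt_pos.2 this).ne'
      field_simp
      rw [Real.sq_sqrt this.le]
  simp only [e]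

/-- The central limit theorem for the linear forms of random vectors. -/
theorem tendsto_charFun_inner (hW : iIndepFun W P)
    (hid : ∀ i, IdentDistrib (W i) (W 0) P P) {u : 𝓦 → Param d} (hu : Measurable u)
    (hu2 : ∀ j, MemLp (fun ω => u (W 0 ω) j) 2 P) (hu0 : ∀ j, ∫ ω, u (W 0 ω) j ∂P = 0)
    (t : Param d) :
    Tendsto (fun n : ℕ => charFun (P.map fun ω => (Real.sqrt n)⁻¹ *
      ∑ i ∈ Finset.range n, (inner ℝ t (u (W i ω)) : ℝ)) 1) atTop
      (𝓝 (charFun (multivariateGaussian 0 (Matrix.of fun i j =>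
          ∫ ω, u (W 0 ω) i * u (W 0 ω) j ∂P)) t)) := by
  set X : ℕ → Ω → ℝ := fun i ω => inner ℝ t (u (W i ω)) with hX
  have hmi : Measurable fun w => (inner ℝ t (u w) : ℝ) := by fun_prop
  have eX : ∀ i ω, X i ω = ∑ j, t j * u (W i ω) j := fun i ω => by
    simp only [hX, PiLp.inner_apply, RCLike.inner_apply, conj_trivial]
    exact Finset.sum_congr rfl fun j _ => mul_comm _ _
  have hX2 : MemLp (X 0) 2 P := by
    have : X 0 = fun ω => ∑ j, t j * u (W 0 ω) j := funext fun ω => eX 0 ω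
    rw [this]
    exact memLp_finsetSum _ fun j _ => (hu2 j).const_mul _
  have hX0 : ∫ ω, X 0 ω ∂P = 0 := by
    simp_rw [eX]
    rw [integral_finsetSum _ fun j _ => ((hu2 j).integrable (by simp)).const_mul _]
    simp_rw [integral_const_mul, hu0]
    simp
  have hXid : ∀ i, IdentDistrib (X i) (X 0) P P := fun i => (hid i).comp hmi
  have hXind : iIndepFun X P := hW.comp _ fun _ => hmi
  -- One-dimensional central limit theorem for the projection on `t`. Its variance is the quadratic
  -- form of the second moment matrix at `t`, which is what the Gaussian characteristic function at
  -- `t` involves.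
  have clt := tendstoInDistribution_inv_sqrt_mul_sum_sub (Y := id)
    (P' := gaussianReal 0 Var[X 0; P].toNNReal) ⟨aemeasurable_id, Measure.map_id⟩ hX2 hXind hXid
  have h1 := ProbabilityMeasure.tendsto_iff_tendsto_charFun.1 clt.tendsto 1
  have hvar : Var[X 0; P] = dotProduct t
      ((Matrix.of fun i j => ∫ ω, u (W 0 ω) i * u (W 0 ω) j ∂P).mulVec t) := by
    rw [variance_of_integral_eq_zero hX2.aestronglyMeasurable.aemeasurable hX0,
      ← integral_inner_sq hu2]
  simp only [ProbabilityMeasure.coe_mk, hX0, mul_zero, sub_zero, Measure.map_id] at h1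
  have elim : charFun (gaussianReal 0 Var[X 0; P].toNNReal) (1 : ℝ)
      = charFun (multivariateGaussian 0 (Matrix.of fun i j =>
        ∫ ω, u (W 0 ω) i * u (W 0 ω) j ∂P)) t := by
    rw [charFun_multivariateGaussian
      (posSemidef_second_moment hu2), charFun_gaussianReal, ← hvar,
      Real.coe_toNNReal _ (variance_nonneg _ _)]
    simp
  rw [← elim]
  exact h1

/-- The central limit theorem for independent identically distributed random vectors. -/
theorem tendstoInDistribution_sqrt_smul_mean (hW : iIndepFun W P)
    (hid : ∀ i, IdentDistrib (W i) (W 0) P P) {u : 𝓦 → Param d} (hu : Measurable u)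
    (hu2 : ∀ j, MemLp (fun ω => u (W 0 ω) j) 2 P) (hu0 : ∀ j, ∫ ω, u (W 0 ω) j ∂P = 0) :
    TendstoInDistribution
      (fun (n : ℕ) ω => Real.sqrt n • ((n : ℝ)⁻¹ • ∑ i ∈ Finset.range n, u (W i ω))) atTop
      (id : Param d → Param d) (fun _ => P)
      (multivariateGaussian 0 (Matrix.of fun i j => ∫ ω, u (W 0 ω) i * u (W 0 ω) j ∂P)) where
  forall_aemeasurable n := aemeasurable_sqrt_smul_mean
    (fun i => hu.comp_aemeasurable (hid i).aemeasurable_fst) n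
  aemeasurable_limit := aemeasurable_id
  tendsto := by
    refine ProbabilityMeasure.tendsto_iff_tendsto_charFun.2 fun t => ?_
    simp only [ProbabilityMeasure.coe_mk, Measure.map_id]
    refine (tendsto_charFun_inner hW hid hu hu2 hu0 t).congr fun n => ?_
    exact (charFun_map_sqrt_smul_mean
      (fun i => hu.comp_aemeasurable (hid i).aemeasurable_fst) n t).symm

end CLT

end EIV

namespace EIV

/-! ### Weighted pairings of a spectral family with bounded functions -/

/-- Bounded measurable functions. -/
structure IsBddMeas (ζ : ℝ → ℂ) : Prop where
  measurable : Measurable ζ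
  bdd : ∃ c : ℝ, ∀ u, ‖ζ u‖ ≤ c

namespace IsBddMeas

variable {ζ ζ' : ℝ → ℂ}

theorem add (h : IsBddMeas ζ) (h' : IsBddMeas ζ') : IsBddMeas fun u => ζ u + ζ' u := by
  obtain ⟨c, hc⟩ := h.bdd
  obtain ⟨c', hc'⟩ := h'.bdd
  exact ⟨h.measurable.add h'.measurable, c + c', fun u =>
    (norm_add_le _ _).trans (add_le_add (hc u) (hc' u))⟩

theorem mul (h : IsBddMeas ζ) (h' : IsBddMeas ζ') : IsBddMeas fun u => ζ u * ζ' u := by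
  obtain ⟨c, hc⟩ := h.bdd
  obtain ⟨c', hc'⟩ := h'.bdd
  refine ⟨h.measurable.mul h'.measurable, c * c', fun u => ?_⟩
  rw [norm_mul]
  exact mul_le_mul (hc u) (hc' u) (norm_nonneg _) ((norm_nonneg _).trans (hc u))

theorem const (a : ℂ) : IsBddMeas fun _ => a := ⟨measurable_const, ‖a‖, fun _ => le_rfl⟩

theorem sub (h : IsBddMeas ζ) (h' : IsBddMeas ζ') : IsBddMeas fun u => ζ u - ζ' u := by
  have := h.add ((const (-1)).mul h')
  simpa [sub_eq_add_neg] using this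

theorem sum {ι : Type*} {s : Finset ι} {ζ : ι → ℝ → ℂ} (h : ∀ i ∈ s, IsBddMeas (ζ i)) :
    IsBddMeas fun u => ∑ i ∈ s, ζ i u := by
  classical
  induction s using Finset.induction_on with
  | empty => simpa using const 0
  | insert a s ha ih =>
    simp only [Finset.sum_insert ha]
    exact (h a (Finset.mem_insert_self _ _)).add
      (ih fun i hi => h i (Finset.mem_insert_of_mem hi))

theorem cexp (z : ℝ) : IsBddMeas fun u : ℝ => Complex.exp (-(Complex.I * u * z)) :=
  ⟨by fun_prop, 1, fun u => (norm_cexp_neg_I_mul u z).le⟩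

end IsBddMeas

/-- The pairing `∫ φ^* χ ζ`. -/
noncomputable def pairing (χ : ℝ → ℂ) (φ : ℝ → ℝ) (ζ : ℝ → ℂ) : ℂ :=
  ∫ u, fourier φ u * (χ u * ζ u)

/-- A weight `χ` for a spectral family `ψ` such that the functions `ψ_θ^* χ` are dominated by the
integrable function `H`, and the spectral gradient of `ψ` is integrable against `χ`. -/
structure SpectralWeight {d : ℕ} (Θ : Set (Param d)) (ψ : Param d → ℝ → ℝ) (G : ℝ → ℝ≥0∞)
    (χ : ℝ → ℂ) (H : ℝ → ℝ≥0∞) : Prop where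
  measurable : Measurable χ
  lintegral_grad : ∫⁻ u, G u * ‖χ u‖ₑ ≠ ∞
  aemeasurable_bound : AEMeasurable H
  lintegral_bound : ∫⁻ u, H u ≠ ∞
  bound : ∀ θ ∈ Θ, ∀ᵐ u, ‖fourier (ψ θ) u‖ₑ * ‖χ u‖ₑ ≤ H u

theorem lintegral_mul_bdd_ne_top {K : ℝ → ℝ≥0∞} (hK : ∫⁻ u, K u ≠ ∞) {ζ : ℝ → ℂ}
    (hζ : IsBddMeas ζ) : ∫⁻ u, K u * ‖ζ u‖ₑ ≠ ∞ := by
  obtain ⟨c, hc⟩ := hζ.bdd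
  refine ne_top_of_le_ne_top (ENNReal.mul_ne_top hK (ENNReal.ofReal_ne_top (r := c))) ?_
  rw [← lintegral_mul_const' _ _ ENNReal.ofReal_ne_top]
  gcongr with u
  rw [← ofReal_norm]
  exact ENNReal.ofReal_le_ofReal (hc u)

theorem integrable_pairing_of_enorm_le {F χ ζ : ℝ → ℂ} (hF : Measurable F) (hχ : Measurable χ)
    {K : ℝ → ℝ≥0∞} (hK : ∫⁻ u, K u ≠ ∞) (h : ∀ᵐ u, ‖F u‖ₑ * ‖χ u‖ₑ ≤ K u) (hζ : IsBddMeas ζ) :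
    Integrable fun u => F u * (χ u * ζ u) := by
  refine ⟨(hF.mul (hχ.mul hζ.measurable)).aestronglyMeasurable, ?_⟩
  refine (lintegral_mono_ae ?_).trans_lt (lintegral_mul_bdd_ne_top hK hζ).lt_top
  filter_upwards [h] with u hu
  rw [← mul_assoc, enorm_mul, enorm_mul]
  gcongr

theorem enorm_integral_pairing_le {F χ ζ : ℝ → ℂ} {K : ℝ → ℝ≥0∞}
    (h : ∀ᵐ u, ‖F u‖ₑ * ‖χ u‖ₑ ≤ K u) :
    ‖∫ u, F u * (χ u * ζ u)‖ₑ ≤ ∫⁻ u, K u * ‖ζ u‖ₑ := by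
  refine (enorm_integral_le_lintegral_enorm _).trans (lintegral_mono_ae ?_)
  filter_upwards [h] with u hu
  rw [← mul_assoc, enorm_mul, enorm_mul]
  gcongr

open SpectralFamily (taylorRem)

namespace SpectralWeight

variable {d : ℕ} {Θ : Set (Param d)} {ψ : Param d → ℝ → ℝ} {G H : ℝ → ℝ≥0∞} {χ : ℝ → ℂ}
  {θ₀ θ : Param d} {ρ : ℝ}

theorem integrable (h : SpectralFamily Θ ψ G) (hχ : SpectralWeight Θ ψ G χ H) (hθ : θ ∈ Θ)
    {ζ : ℝ → ℂ} (hζ : IsBddMeas ζ) : Integrable fun u => fourier (ψ θ) u * (χ u * ζ u) :=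
  integrable_pairing_of_enorm_le (continuous_fourier (h.integrable θ hθ)).measurable hχ.measurable
    hχ.lintegral_bound (hχ.bound θ hθ) hζ

theorem enorm_fourier_pderiv_mul_le (h : SpectralFamily Θ ψ G) (hθ : θ ∈ interior Θ) (j : Fin d)
    (u : ℝ) : ‖fourier (pderiv j ψ θ) u‖ₑ * ‖χ u‖ₑ ≤ G u * ‖χ u‖ₑ := by
  gcongr
  exact (Finset.single_le_sum (f := fun j => ‖fourier (pderiv j ψ θ) u‖ₑ)
    (fun _ _ => zero_le) (Finset.mem_univ j)).trans (h.bound θ hθ u)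

theorem integrable_pderiv (h : SpectralFamily Θ ψ G) (hχ : SpectralWeight Θ ψ G χ H)
    (hθ : θ ∈ interior Θ) (j : Fin d) {ζ : ℝ → ℂ} (hζ : IsBddMeas ζ) :
    Integrable fun u => fourier (pderiv j ψ θ) u * (χ u * ζ u) :=
  integrable_pairing_of_enorm_le (continuous_fourier (h.integrable_pderiv j θ hθ)).measurable
    hχ.measurable hχ.lintegral_grad
    (ae_of_all _ fun u => enorm_fourier_pderiv_mul_le h hθ j u) hζ

theorem enorm_pairing_le (hχ : SpectralWeight Θ ψ G χ H) (hθ : θ ∈ Θ) (ζ : ℝ → ℂ) :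
    ‖pairing χ (ψ θ) ζ‖ₑ ≤ ∫⁻ u, H u * ‖ζ u‖ₑ :=
  enorm_integral_pairing_le (hχ.bound θ hθ)

theorem pairing_add (h : SpectralFamily Θ ψ G) (hχ : SpectralWeight Θ ψ G χ H) (hθ : θ ∈ Θ)
    {ζ ζ' : ℝ → ℂ} (hζ : IsBddMeas ζ) (hζ' : IsBddMeas ζ') :
    pairing χ (ψ θ) (fun u => ζ u + ζ' u) = pairing χ (ψ θ) ζ + pairing χ (ψ θ) ζ' := by
  rw [pairing, pairing, pairing, ← integral_add (hχ.integrable h hθ hζ) (hχ.integrable h hθ hζ')]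
  simp_rw [mul_add]

theorem pairing_sub_eq_integral (h : SpectralFamily Θ ψ G) (hχ : SpectralWeight Θ ψ G χ H)
    (hθ : θ ∈ Θ) (hθ₀ : θ₀ ∈ Θ) {ζ : ℝ → ℂ} (hζ : IsBddMeas ζ) :
    pairing χ (ψ θ) ζ - pairing χ (ψ θ₀) ζ
      = ∫ u, (fourier (ψ θ) u - fourier (ψ θ₀) u) * (χ u * ζ u) := by
  rw [pairing, pairing, ← integral_sub (hχ.integrable h hθ hζ) (hχ.integrable h hθ₀ hζ)]
  simp_rw [sub_mul]

theorem enorm_pairing_sub_le (h : SpectralFamily Θ ψ G) (hχ : SpectralWeight Θ ψ G χ H)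
    (hρ : Metric.ball θ₀ ρ ⊆ interior Θ) (hθ : θ ∈ Metric.ball θ₀ ρ) {ζ : ℝ → ℂ}
    (hζ : IsBddMeas ζ) :
    ‖pairing χ (ψ θ) ζ - pairing χ (ψ θ₀) ζ‖ₑ
      ≤ (∫⁻ u, G u * ‖χ u‖ₑ * ‖ζ u‖ₑ) * ‖θ - θ₀‖ₑ := by
  have h0 : θ₀ ∈ Metric.ball θ₀ ρ := Metric.mem_ball_self (dist_nonneg.trans_lt hθ)
  rw [hχ.pairing_sub_eq_integral h (interior_subset (hρ hθ)) (interior_subset (hρ h0)) hζ,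
    ← lintegral_mul_const' _ _ enorm_ne_top]
  refine (enorm_integral_pairing_le (K := fun u => ‖θ - θ₀‖ₑ * G u * ‖χ u‖ₑ) ?_).trans
    (le_of_eq ?_)
  · filter_upwards [h.ae_enorm_fourier_sub_le (convex_ball θ₀ ρ) hρ hθ h0] with u hu
    gcongr
  · refine lintegral_congr fun u => ?_
    ring

theorem integral_taylorRem (h : SpectralFamily Θ ψ G) (hχ : SpectralWeight Θ ψ G χ H)
    (hθ₀ : θ₀ ∈ interior Θ) (hθ : θ ∈ Θ) {ζ : ℝ → ℂ} (hζ : IsBddMeas ζ) :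
    ∫ u, taylorRem ψ θ₀ θ u * (χ u * ζ u) = pairing χ (ψ θ) ζ - pairing χ (ψ θ₀) ζ
      - ∑ j, ((θ - θ₀) j : ℂ) * pairing χ (pderiv j ψ θ₀) ζ := by
  have i1 := hχ.integrable h hθ hζ
  have i0 := hχ.integrable h (interior_subset hθ₀) hζ
  have i2 : ∀ j, Integrable fun u => ((θ - θ₀) j : ℂ) *
      (fourier (pderiv j ψ θ₀) u * (χ u * ζ u)) :=
    fun j => (hχ.integrable_pderiv h hθ₀ j hζ).const_mul _
  have i3 : Integrable fun u => fourier (ψ θ) u * (χ u * ζ u) - fourier (ψ θ₀) u * (χ u * ζ u) :=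
    i1.sub i0
  simp only [pairing]
  simp_rw [← integral_const_mul]
  rw [← integral_finsetSum _ fun j _ => i2 j, ← integral_sub i1 i0,
    ← integral_sub i3 (integrable_finsetSum _ fun j _ => i2 j)]
  refine integral_congr_ae (ae_of_all _ fun u => ?_)
  simp only [taylorRem, sub_mul, Finset.sum_mul, mul_assoc]

theorem integrable_taylorRem (h : SpectralFamily Θ ψ G) (hχ : SpectralWeight Θ ψ G χ H)
    (hρ : Metric.ball θ₀ ρ ⊆ interior Θ) (hθ : θ ∈ Metric.ball θ₀ ρ) {ζ : ℝ → ℂ}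
    (hζ : IsBddMeas ζ) : Integrable fun u => taylorRem ψ θ₀ θ u * (χ u * ζ u) := by
  have h0 : θ₀ ∈ Metric.ball θ₀ ρ := Metric.mem_ball_self (dist_nonneg.trans_lt hθ)
  refine integrable_pairing_of_enorm_le
    (K := fun u => 2 * ‖θ - θ₀‖ₑ * (G u * ‖χ u‖ₑ))
    (h.continuous_taylorRem (hρ h0) (interior_subset (hρ hθ))).measurable hχ.measurable ?_ ?_ hζ
  · have hc : 2 * ‖θ - θ₀‖ₑ ≠ ∞ := ENNReal.mul_ne_top (by simp) enorm_ne_top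
    rw [lintegral_const_mul' _ _ hc]
    exact ENNReal.mul_ne_top hc hχ.lintegral_grad
  · filter_upwards [h.ae_enorm_taylorRem_le (convex_ball θ₀ ρ) hρ h0 hθ] with u hu
    rw [← mul_assoc]
    gcongr

theorem enorm_integral_taylorRem_le (h : SpectralFamily Θ ψ G)
    (hρ : Metric.ball θ₀ ρ ⊆ interior Θ) (hθ : θ ∈ Metric.ball θ₀ ρ) (ζ : ℝ → ℂ) :
    ‖∫ u, taylorRem ψ θ₀ θ u * (χ u * ζ u)‖ₑ
      ≤ 2 * (∫⁻ u, G u * ‖χ u‖ₑ * ‖ζ u‖ₑ) * ‖θ - θ₀‖ₑ := by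
  have h0 : θ₀ ∈ Metric.ball θ₀ ρ := Metric.mem_ball_self (dist_nonneg.trans_lt hθ)
  rw [← lintegral_const_mul' _ _ (by simp), ← lintegral_mul_const' _ _ enorm_ne_top]
  refine (enorm_integral_pairing_le (K := fun u => 2 * ‖θ - θ₀‖ₑ * G u * ‖χ u‖ₑ) ?_).trans
    (le_of_eq ?_)
  · filter_upwards [h.ae_enorm_taylorRem_le (convex_ball θ₀ ρ) hρ h0 hθ] with u hu
    gcongr
  · refine lintegral_congr fun u => ?_
    ring

theorem exists_norm_integral_taylorRem_le (h : SpectralFamily Θ ψ G)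
    (hχ : SpectralWeight Θ ψ G χ H) (hθ₀ : θ₀ ∈ interior Θ) {ζ : ℝ → ℂ} (hζ : IsBddMeas ζ)
    {ε : ℝ} (hε : 0 < ε) :
    ∃ ρ > 0, Metric.ball θ₀ ρ ⊆ interior Θ ∧ ∀ θ ∈ Metric.ball θ₀ ρ,
      ‖∫ u, taylorRem ψ θ₀ θ u * (χ u * ζ u)‖ ≤ ε * ‖θ - θ₀‖ := by
  refine h.exists_norm_integral_taylorRem_le hθ₀ (hχ.measurable.mul hζ.measurable) ?_ hε
  have := lintegral_mul_bdd_ne_top hχ.lintegral_grad hζ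
  simp_rw [mul_assoc] at this
  simpa only [Pi.mul_apply, enorm_mul] using this

/-! The effect of replacing `ζ` by `k (ζ + Δ)`. -/

variable {k ζ Δ : ℝ → ℂ}

/-- The split `k(ζ + Δ) - ζ = kΔ + (k - 1)ζ` separates the stochastic error from the smoothing bias.
-/
theorem pairing_mul_add_sub (h : SpectralFamily Θ ψ G) (hχ : SpectralWeight Θ ψ G χ H)
    (hθ : θ ∈ Θ) (hk : IsBddMeas k) (hζ : IsBddMeas ζ) (hΔ : IsBddMeas Δ) :
    pairing χ (ψ θ) (fun u => k u * (ζ u + Δ u)) - pairing χ (ψ θ) ζ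
      = pairing χ (ψ θ) (fun u => k u * Δ u + (k u - 1) * ζ u) := by
  have e : (fun u => k u * (ζ u + Δ u)) = fun u => (k u * Δ u + (k u - 1) * ζ u) + ζ u := by
    funext u
    ring
  rw [e, hχ.pairing_add h hθ ((hk.mul hΔ).add ((hk.sub (.const 1)).mul hζ)) hζ, add_sub_cancel_right]

theorem enorm_smoothed_le {K : ℝ → ℝ≥0∞} (hK : AEMeasurable K) (hk : IsBddMeas k)
    (hk2 : ∀ u, ‖k u‖ₑ ≤ 2) (hζ : IsBddMeas ζ) :
    ∫⁻ u, K u * ‖k u * Δ u + (k u - 1) * ζ u‖ₑ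
      ≤ 2 * (∫⁻ u, K u * ‖Δ u‖ₑ) + ∫⁻ u, K u * (‖k u - 1‖ₑ * ‖ζ u‖ₑ) := by
  have hm : AEMeasurable fun u => K u * (‖k u - 1‖ₑ * ‖ζ u‖ₑ) :=
    hK.mul (((hk.measurable.sub measurable_const).enorm).mul hζ.measurable.enorm).aemeasurable
  rw [← lintegral_const_mul' _ _ (by simp), ← lintegral_add_right' _ hm]
  refine lintegral_mono fun u => ?_
  calc K u * ‖k u * Δ u + (k u - 1) * ζ u‖ₑ
      ≤ K u * (‖k u * Δ u‖ₑ + ‖(k u - 1) * ζ u‖ₑ) := by gcongr; exact enorm_add_le _ _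
    _ ≤ K u * (2 * ‖Δ u‖ₑ + ‖k u - 1‖ₑ * ‖ζ u‖ₑ) := by
        rw [enorm_mul, enorm_mul]
        gcongr
        exact hk2 u
    _ = _ := by ring

theorem enorm_pairing_smoothed_sub_le (h : SpectralFamily Θ ψ G) (hχ : SpectralWeight Θ ψ G χ H)
    (hθ : θ ∈ Θ) (hk : IsBddMeas k) (hk2 : ∀ u, ‖k u‖ₑ ≤ 2) (hζ : IsBddMeas ζ)
    (hΔ : IsBddMeas Δ) :
    ‖pairing χ (ψ θ) (fun u => k u * (ζ u + Δ u)) - pairing χ (ψ θ) ζ‖ₑ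
      ≤ 2 * (∫⁻ u, H u * ‖Δ u‖ₑ) + ∫⁻ u, H u * (‖k u - 1‖ₑ * ‖ζ u‖ₑ) := by
  rw [hχ.pairing_mul_add_sub h hθ hk hζ hΔ]
  exact (hχ.enorm_pairing_le hθ _).trans (enorm_smoothed_le hχ.aemeasurable_bound hk hk2 hζ)

theorem enorm_pairing_smoothed_sub_sub_le (h : SpectralFamily Θ ψ G)
    (hχ : SpectralWeight Θ ψ G χ H) (hρ : Metric.ball θ₀ ρ ⊆ interior Θ)
    (hθ : θ ∈ Metric.ball θ₀ ρ) (hk : IsBddMeas k) (hk2 : ∀ u, ‖k u‖ₑ ≤ 2) (hζ : IsBddMeas ζ)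
    (hΔ : IsBddMeas Δ) :
    ‖(pairing χ (ψ θ) (fun u => k u * (ζ u + Δ u)) - pairing χ (ψ θ) ζ)
        - (pairing χ (ψ θ₀) (fun u => k u * (ζ u + Δ u)) - pairing χ (ψ θ₀) ζ)‖ₑ
      ≤ (2 * (∫⁻ u, G u * ‖χ u‖ₑ * ‖Δ u‖ₑ)
        + ∫⁻ u, G u * ‖χ u‖ₑ * (‖k u - 1‖ₑ * ‖ζ u‖ₑ)) * ‖θ - θ₀‖ₑ := by
  have h0 : θ₀ ∈ Metric.ball θ₀ ρ := Metric.mem_ball_self (dist_nonneg.trans_lt hθ)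
  rw [hχ.pairing_mul_add_sub h (interior_subset (hρ hθ)) hk hζ hΔ,
    hχ.pairing_mul_add_sub h (interior_subset (hρ h0)) hk hζ hΔ]
  refine (hχ.enorm_pairing_sub_le h hρ hθ
    ((hk.mul hΔ).add ((hk.sub (.const 1)).mul hζ))).trans ?_
  gcongr
  exact enorm_smoothed_le (h.aemeasurable_bound.mul hχ.measurable.enorm.aemeasurable) hk hk2 hζ

/-- Remainder bound: `Δ` splits into a finite rank part `∑ l, N l * e l` and a small part `Δ'`. -/
theorem enorm_pairing_smoothed_taylor_le (h : SpectralFamily Θ ψ G)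
    (hχ : SpectralWeight Θ ψ G χ H) (hρ : Metric.ball θ₀ ρ ⊆ interior Θ)
    (hθ : θ ∈ Metric.ball θ₀ ρ) (hk : IsBddMeas k) (hζ : IsBddMeas ζ) {ι : Type*} {s : Finset ι}
    {N : ι → ℂ} {e : ι → ℝ → ℂ} (he : ∀ l ∈ s, IsBddMeas (e l)) {Δ' : ℝ → ℂ}
    (hΔ' : IsBddMeas Δ') (hΔ : ∀ u, Δ u = (∑ l ∈ s, N l * e l u) + Δ' u) {ε : ℝ≥0∞}
    (hε : ∀ l ∈ s, ‖∫ u, taylorRem ψ θ₀ θ u * (χ u * e l u)‖ₑ ≤ ε * ‖θ - θ₀‖ₑ) :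
    ‖(pairing χ (ψ θ) (fun u => k u * (ζ u + Δ u)) - pairing χ (ψ θ) ζ)
        - (pairing χ (ψ θ₀) (fun u => k u * (ζ u + Δ u)) - pairing χ (ψ θ₀) ζ)
        - ∑ j, ((θ - θ₀) j : ℂ) * pairing χ (pderiv j ψ θ₀) Δ‖ₑ
      ≤ (ε * (∑ l ∈ s, ‖N l‖ₑ) + 2 * (∫⁻ u, G u * ‖χ u‖ₑ * ‖Δ' u‖ₑ)
        + (∫⁻ u, G u * ‖χ u‖ₑ * (‖k u - 1‖ₑ * ‖Δ u‖ₑ))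
        + ∫⁻ u, G u * ‖χ u‖ₑ * (‖k u - 1‖ₑ * ‖ζ u‖ₑ)) * ‖θ - θ₀‖ₑ := by
  have h0 : θ₀ ∈ Metric.ball θ₀ ρ := Metric.mem_ball_self (dist_nonneg.trans_lt hθ)
  have hθΘ := interior_subset (hρ hθ)
  have h0Θ := interior_subset (hρ h0)
  have hfin : IsBddMeas fun u => ∑ l ∈ s, N l * e l u :=
    .sum fun l hl => (IsBddMeas.const (N l)).mul (he l hl)
  have hΔb : IsBddMeas Δ := by
    rw [show Δ = fun u => (∑ l ∈ s, N l * e l u) + Δ' u from funext hΔ]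
    exact hfin.add hΔ'
  have hk1 := hk.sub (.const 1)
  -- The linear term contains the unsmoothed `Δ`, so the split used here is `k(ζ + Δ) - ζ = Δ + (k -
  -- 1)Δ + (k - 1)ζ`. The expansion in `θ` is needed for the first term only; the Lipschitz bound
  -- suffices for the other two.
  have e1 : ∀ η ∈ Θ, pairing χ (ψ η) (fun u => k u * (ζ u + Δ u)) - pairing χ (ψ η) ζ
      = pairing χ (ψ η) Δ + (pairing χ (ψ η) (fun u => (k u - 1) * Δ u)
        + pairing χ (ψ η) (fun u => (k u - 1) * ζ u)) := by
    intro η hη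
    rw [hχ.pairing_mul_add_sub h hη hk hζ hΔb, ← hχ.pairing_add h hη (hk1.mul hΔb) (hk1.mul hζ),
      ← hχ.pairing_add h hη hΔb ((hk1.mul hΔb).add (hk1.mul hζ))]
    congr 1
    funext u
    ring
  have e2 : ∫ u, taylorRem ψ θ₀ θ u * (χ u * Δ u)
      = (∑ l ∈ s, N l * ∫ u, taylorRem ψ θ₀ θ u * (χ u * e l u))
        + ∫ u, taylorRem ψ θ₀ θ u * (χ u * Δ' u) := by
    have i1 : ∀ l ∈ s, Integrable fun u => N l * (taylorRem ψ θ₀ θ u * (χ u * e l u)) :=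
      fun l hl => (hχ.integrable_taylorRem h hρ hθ (he l hl)).const_mul _
    simp_rw [← integral_const_mul]
    rw [← integral_finsetSum _ i1, ← integral_add (integrable_finsetSum _ i1)
      (hχ.integrable_taylorRem h hρ hθ hΔ')]
    refine integral_congr_ae (ae_of_all _ fun u => ?_)
    simp only [hΔ u, mul_add, Finset.mul_sum]
    congr 1
    refine Finset.sum_congr rfl fun l _ => ?_
    ring
  have e3 : (pairing χ (ψ θ) (fun u => k u * (ζ u + Δ u)) - pairing χ (ψ θ) ζ)
        - (pairing χ (ψ θ₀) (fun u => k u * (ζ u + Δ u)) - pairing χ (ψ θ₀) ζ)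
        - ∑ j, ((θ - θ₀) j : ℂ) * pairing χ (pderiv j ψ θ₀) Δ
      = (∑ l ∈ s, N l * ∫ u, taylorRem ψ θ₀ θ u * (χ u * e l u))
        + (∫ u, taylorRem ψ θ₀ θ u * (χ u * Δ' u))
        + (pairing χ (ψ θ) (fun u => (k u - 1) * Δ u) - pairing χ (ψ θ₀) (fun u => (k u - 1) * Δ u))
        + (pairing χ (ψ θ) (fun u => (k u - 1) * ζ u)
          - pairing χ (ψ θ₀) (fun u => (k u - 1) * ζ u)) := by
    rw [← e2, hχ.integral_taylorRem h (hρ h0) hθΘ hΔb, e1 θ hθΘ, e1 θ₀ h0Θ]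
    ring
  rw [e3]
  have b1 : ‖∑ l ∈ s, N l * ∫ u, taylorRem ψ θ₀ θ u * (χ u * e l u)‖ₑ
      ≤ ε * (∑ l ∈ s, ‖N l‖ₑ) * ‖θ - θ₀‖ₑ := by
    refine (enorm_sum_le _ _).trans ?_
    rw [Finset.mul_sum, Finset.sum_mul]
    refine Finset.sum_le_sum fun l hl => ?_
    rw [enorm_mul]
    calc ‖N l‖ₑ * ‖∫ u, taylorRem ψ θ₀ θ u * (χ u * e l u)‖ₑ
        ≤ ‖N l‖ₑ * (ε * ‖θ - θ₀‖ₑ) := by gcongr; exact hε l hl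
      _ = _ := by ring
  have b2 := enorm_integral_taylorRem_le (χ := χ) h hρ hθ Δ'
  have b3 := hχ.enorm_pairing_sub_le h hρ hθ (hk1.mul hΔb)
  have b4 := hχ.enorm_pairing_sub_le h hρ hθ (hk1.mul hζ)
  simp only [enorm_mul] at b3 b4
  rw [add_mul, add_mul, add_mul]
  exact (enorm_add_le _ _).trans (add_le_add ((enorm_add_le _ _).trans (add_le_add
    ((enorm_add_le _ _).trans (add_le_add b1 b2)) b3)) b4)

end SpectralWeight

end EIV

namespace EIV

set_option linter.unusedSectionVars false

/-! ### Smoothing of the empirical characteristic function -/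

/-- The weighted characteristic function of an observation. -/
noncomputable def obs (c : ℝ → ℝ) (u : ℝ) (x : ℝ × ℝ) : ℂ :=
  (c x.1 : ℂ) * Complex.exp (-(Complex.I * u * x.2))

theorem measurable_uncurry_obs {c : ℝ → ℝ} (hc : Measurable c) :
    Measurable (Function.uncurry (obs c)) := by
  unfold obs Function.uncurry
  fun_prop

theorem measurable_obs {c : ℝ → ℝ} (hc : Measurable c) (u : ℝ) : Measurable (obs c u) := by
  unfold obs
  fun_prop

theorem enorm_cexp_neg_I_mul (t x : ℝ) : ‖Complex.exp (-(Complex.I * t * x))‖ₑ = 1 := by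
  rw [← ofReal_norm, norm_cexp_neg_I_mul, ENNReal.ofReal_one]

theorem enorm_complex_ofReal (r : ℝ) : ‖(r : ℂ)‖ₑ = ‖r‖ₑ := by
  rw [← ofReal_norm, ← ofReal_norm, Complex.norm_real]

theorem enorm_obs (c : ℝ → ℝ) (u : ℝ) (x : ℝ × ℝ) : ‖obs c u x‖ₑ = ‖c x.1‖ₑ := by
  rw [obs, enorm_mul, enorm_cexp_neg_I_mul, mul_one, enorm_complex_ofReal]

/-- Multipliers that are bounded by `2` and equal to `1` on `(-C_n, C_n)`. -/
structure IsSmoothing (k : ℕ → ℝ → ℂ) (C : ℕ → ℝ) : Prop where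
  measurable : ∀ n, Measurable (k n)
  bound : ∀ n u, ‖k n u - 1‖ₑ ≤ {u : ℝ | C n ≤ |u|}.indicator 1 u
  tendsto : Tendsto C atTop atTop

namespace IsSmoothing

variable {k : ℕ → ℝ → ℂ} {C : ℕ → ℝ}

theorem enorm_sub_one_le (h : IsSmoothing k C) (n : ℕ) (u : ℝ) : ‖k n u - 1‖ₑ ≤ 1 :=
  (h.bound n u).trans (Set.indicator_le (fun _ _ => le_rfl) u)

theorem enorm_le_two (h : IsSmoothing k C) (n : ℕ) (u : ℝ) : ‖k n u‖ₑ ≤ 2 := by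
  calc ‖k n u‖ₑ = ‖(k n u - 1) + 1‖ₑ := by rw [sub_add_cancel]
    _ ≤ ‖k n u - 1‖ₑ + ‖(1 : ℂ)‖ₑ := enorm_add_le _ _
    _ ≤ 1 + 1 := by gcongr; exacts [h.enorm_sub_one_le n u, by simp]
    _ = 2 := one_add_one_eq_two

theorem isBddMeas (h : IsSmoothing k C) (n : ℕ) : IsBddMeas (k n) := by
  refine ⟨h.measurable n, 2, fun u => ?_⟩
  have := ENNReal.toReal_mono (by simp) (h.enorm_le_two n u)
  simpa using this

theorem tendsto_lintegral (h : IsSmoothing k C) {K : ℝ → ℝ≥0∞} (hK : AEMeasurable K)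
    (hKi : ∫⁻ u, K u ≠ ∞) : Tendsto (fun n => ∫⁻ u, K u * ‖k n u - 1‖ₑ) atTop (𝓝 0) := by
  have h0 : (0 : ℝ≥0∞) = ∫⁻ _ : ℝ, (0 : ℝ≥0∞) := by simp
  rw [h0]
  refine tendsto_lintegral_of_dominated_convergence' K
    (fun n => hK.mul ((h.measurable n).sub measurable_const).enorm.aemeasurable)
    (fun n => ae_of_all _ fun u => ?_) hKi (ae_of_all _ fun u => ?_)
  · exact (mul_le_mul_right (h.enorm_sub_one_le n u) _).trans_eq (mul_one _)
  · refine tendsto_const_nhds.congr' ?_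
    filter_upwards [h.tendsto.eventually_gt_atTop |u|] with n hn
    have h1 := h.bound n u
    rw [Set.indicator_of_notMem (by simpa using hn)] at h1
    rw [le_antisymm h1 zero_le, mul_zero]

end IsSmoothing

section IID

variable {Ω : Type*} [MeasurableSpace Ω] {P : Measure Ω} [IsProbabilityMeasure P]

section General

variable {𝓦 : Type*} [MeasurableSpace 𝓦] {W : ℕ → Ω → 𝓦}

theorem lintegral_sq_weighted_empDev_le (hWm : ∀ i, Measurable (W i)) (hW : iIndepFun W P)
    (hid : ∀ i, IdentDistrib (W i) (W 0) P P) {b : ℝ → 𝓦 → ℂ}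
    (hb : Measurable (Function.uncurry b)) (hb2 : ∀ u, ∫⁻ ω, ‖b u (W 0 ω)‖ₑ ^ 2 ∂P ≠ ∞)
    {K : ℝ → ℝ≥0∞} (hK : AEMeasurable K) (hKi : ∫⁻ u, K u ≠ ∞) {n : ℕ} (hn : 1 ≤ n) :
    ∫⁻ ω, (∫⁻ u, K u * ‖empDev P W (b u) n ω‖ₑ) ^ 2 ∂P
      ≤ (∫⁻ u, K u) * (∫⁻ u, K u * ∫⁻ ω, ‖b u (W 0 ω)‖ₑ ^ 2 ∂P) / n := by
  have : IsFiniteMeasure (volume.withDensity K) := isFiniteMeasure_withDensity hKi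
  have h := lintegral_sq_lintegral_empDev_le hWm hW hid hb hb2 (volume.withDensity K) hn
  have hm : Measurable fun u => ∫⁻ ω, ‖b u (W 0 ω)‖ₑ ^ 2 ∂P := by
    have h1 : Measurable fun z : ℝ × Ω => ‖b z.1 (W 0 z.2)‖ₑ ^ 2 :=
      ((hb.comp (measurable_fst.prodMk ((hWm 0).comp measurable_snd))).enorm).pow_const 2
    exact h1.lintegral_prod_right'
  rw [lintegral_withDensity_eq_lintegral_mul₀ hK hm.aemeasurable, withDensity_apply _ .univ,
    Measure.restrict_univ] at h
  refine le_trans (le_of_eq (lintegral_congr fun ω => ?_)) h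
  rw [lintegral_withDensity_eq_lintegral_mul₀ hK
    (measurable_empDev_left (P := P) hWm hb n ω).enorm.aemeasurable]
  rfl

theorem measurable_weighted_empDev (hWm : ∀ i, Measurable (W i)) {b : ℝ → 𝓦 → ℂ}
    (hb : Measurable (Function.uncurry b)) {K : ℝ → ℝ≥0∞} (hK : AEMeasurable K)
    (hKi : ∫⁻ u, K u ≠ ∞) (n : ℕ) :
    Measurable fun ω => ∫⁻ u, K u * ‖empDev P W (b u) n ω‖ₑ := by
  have : IsFiniteMeasure (volume.withDensity K) := isFiniteMeasure_withDensity hKi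
  have h := (measurable_empDev_uncurry (P := P) hWm hb n).enorm
  have h2 : Measurable fun ω => ∫⁻ u, ‖empDev P W (b u) n ω‖ₑ ∂(volume.withDensity K) :=
    h.lintegral_prod_left'
  convert h2 using 2 with ω
  rw [lintegral_withDensity_eq_lintegral_mul₀ hK
    (measurable_empDev_left (P := P) hWm hb n ω).enorm.aemeasurable]
  rfl

theorem empDev_add {b b' : 𝓦 → ℂ} (hb : Integrable (fun ω => b (W 0 ω)) P)
    (hb' : Integrable (fun ω => b' (W 0 ω)) P) (n : ℕ) (ω : Ω) :
    empDev P W (fun x => b x + b' x) n ω = empDev P W b n ω + empDev P W b' n ω := by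
  simp only [empDev]
  rw [integral_add hb hb', Finset.sum_add_distrib]
  ring

theorem empDev_sum_mul {ι : Type*} (s : Finset ι) {b : ι → 𝓦 → ℂ}
    (hb : ∀ l ∈ s, Integrable (fun ω => b l (W 0 ω)) P) (a : ι → ℂ) (n : ℕ) (ω : Ω) :
    empDev P W (fun x => ∑ l ∈ s, b l x * a l) n ω = ∑ l ∈ s, empDev P W (b l) n ω * a l := by
  simp only [empDev]
  rw [integral_finsetSum _ fun l hl => (hb l hl).mul_const _, Finset.sum_comm, Finset.mul_sum,
    ← Finset.sum_sub_distrib]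
  refine Finset.sum_congr rfl fun l _ => ?_
  rw [integral_mul_const, ← Finset.sum_mul]
  ring

end General

theorem ofReal_sqrt_eq_rpow (n : ℕ) : ENNReal.ofReal (Real.sqrt n) = (n : ℝ≥0∞) ^ (1 / 2 : ℝ) := by
  rw [Real.sqrt_eq_rpow, ← ENNReal.ofReal_rpow_of_nonneg (Nat.cast_nonneg n) (by norm_num),
    ENNReal.ofReal_natCast]

theorem lintegral_le_div_sqrt {X : Ω → ℝ≥0∞} (hX : AEMeasurable X P) {a : ℝ≥0∞} {n : ℕ}
    (h : ∫⁻ ω, X ω ^ 2 ∂P ≤ a / n) :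
    ∫⁻ ω, X ω ∂P ≤ a ^ (1 / 2 : ℝ) / ENNReal.ofReal (Real.sqrt n) := by
  rw [ofReal_sqrt_eq_rpow, ← ENNReal.div_rpow_of_nonneg _ _ (by norm_num)]
  exact lintegral_le_rpow_of_sq_le hX h

/-! ### Weighted empirical characteristic functions and their discretization -/

variable {W : ℕ → Ω → ℝ × ℝ} {c : ℝ → ℝ}

/-- The expectation of the weighted characteristic function. -/
noncomputable def obsMean (P : Measure Ω) (W : ℕ → Ω → ℝ × ℝ) (c : ℝ → ℝ) (u : ℝ) : ℂ :=
  ∫ ω, obs c u (W 0 ω) ∂P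

theorem isBddMeas_obsMean (hWm : ∀ i, Measurable (W i)) (hc : Measurable c) :
    IsBddMeas (obsMean P W c) := by
  refine ⟨?_, ∫ ω, |c (W 0 ω).1| ∂P, fun u => ?_⟩
  · have h : StronglyMeasurable (Function.uncurry fun (u : ℝ) (ω : Ω) => obs c u (W 0 ω)) :=
      ((measurable_uncurry_obs hc).comp
        (measurable_fst.prodMk ((hWm 0).comp measurable_snd))).stronglyMeasurable
    exact (h.integral_prod_right (ν := P)).measurable
  · refine (norm_integral_le_integral_norm _).trans (le_of_eq (integral_congr_ae
      (ae_of_all _ fun ω => ?_)))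
    simp only [obs, norm_mul, norm_cexp_neg_I_mul, mul_one, Complex.norm_real, Real.norm_eq_abs]

theorem isBddMeas_obs (c : ℝ → ℝ) (x : ℝ × ℝ) : IsBddMeas fun u => obs c u x :=
  (IsBddMeas.const (c x.1)).mul (IsBddMeas.cexp x.2)

theorem isBddMeas_empDev_obs (hWm : ∀ i, Measurable (W i)) (hc : Measurable c) (n : ℕ) (ω : Ω) :
    IsBddMeas fun u => empDev P W (obs c u) n ω :=
  ((IsBddMeas.const _).mul (.sum fun i _ => isBddMeas_obs c (W i ω))).sub
    (isBddMeas_obsMean hWm hc)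

/-- The empirical version of `obsMean`. -/
noncomputable def obsEmp (W : ℕ → Ω → ℝ × ℝ) (c : ℝ → ℝ) (n : ℕ) (ω : Ω) (u : ℝ) : ℂ :=
  (n : ℂ)⁻¹ * ∑ i ∈ Finset.range n, obs c u (W i ω)

theorem obsEmp_eq (P : Measure Ω) (W : ℕ → Ω → ℝ × ℝ) (c : ℝ → ℝ) (n : ℕ) (ω : Ω) (u : ℝ) :
    obsEmp W c n ω u = obsMean P W c u + empDev P W (obs c u) n ω := by
  rw [empDev, obsMean, obsEmp, add_sub_cancel]

theorem lintegral_sq_obs (c : ℝ → ℝ) (u : ℝ) :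
    ∫⁻ ω, ‖obs c u (W 0 ω)‖ₑ ^ 2 ∂P = ∫⁻ ω, ‖c (W 0 ω).1‖ₑ ^ 2 ∂P := by
  simp only [enorm_obs]

theorem lintegral_sq_weighted_empDev_obs_le (hWm : ∀ i, Measurable (W i)) (hW : iIndepFun W P)
    (hid : ∀ i, IdentDistrib (W i) (W 0) P P) (hc : Measurable c)
    (hc2 : ∫⁻ ω, ‖c (W 0 ω).1‖ₑ ^ 2 ∂P ≠ ∞) {K : ℝ → ℝ≥0∞} (hK : AEMeasurable K)
    (hKi : ∫⁻ u, K u ≠ ∞) {n : ℕ} (hn : 1 ≤ n) :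
    ∫⁻ ω, (∫⁻ u, K u * ‖empDev P W (obs c u) n ω‖ₑ) ^ 2 ∂P
      ≤ (∫⁻ u, K u) ^ 2 * (∫⁻ ω, ‖c (W 0 ω).1‖ₑ ^ 2 ∂P) / n := by
  have h := lintegral_sq_weighted_empDev_le hWm hW hid (measurable_uncurry_obs hc)
    (fun u => by rwa [lintegral_sq_obs]) hK hKi hn
  simp only [lintegral_sq_obs] at h
  rwa [lintegral_mul_const' _ _ hc2, ← mul_assoc, ← sq] at h

/-- Discretization of the covariate. -/
noncomputable def rounding (m : ℕ) : SimpleFunc ℝ ℝ :=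
  SimpleFunc.approxOn id measurable_id Set.univ 0 (Set.mem_univ _) m

theorem tendsto_rounding (z : ℝ) : Tendsto (fun m => rounding m z) atTop (𝓝 z) :=
  SimpleFunc.tendsto_approxOn measurable_id (Set.mem_univ _) (by simp)

/-- The discretization error of `obs`. -/
noncomputable def obsErr (c : ℝ → ℝ) (m : ℕ) (u : ℝ) (x : ℝ × ℝ) : ℂ :=
  obs c u x - obs c u (x.1, rounding m x.2)

theorem measurable_uncurry_obsErr (hc : Measurable c) (m : ℕ) :
    Measurable (Function.uncurry (obsErr c m)) := by
  have h : Measurable (rounding m) := (rounding m).measurable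
  unfold obsErr obs Function.uncurry
  fun_prop

theorem measurable_obsErr (hc : Measurable c) (m : ℕ) (u : ℝ) : Measurable (obsErr c m u) := by
  have h : Measurable (rounding m) := (rounding m).measurable
  unfold obsErr obs
  fun_prop

theorem enorm_sq_obsErr_le (c : ℝ → ℝ) (m : ℕ) (u : ℝ) (x : ℝ × ℝ) :
    ‖obsErr c m u x‖ₑ ^ 2 ≤ 4 * ‖c x.1‖ₑ ^ 2 := by
  have h : ‖obsErr c m u x‖ₑ ≤ 2 * ‖c x.1‖ₑ := by
    refine enorm_sub_le.trans ?_
    rw [enorm_obs, enorm_obs, two_mul]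
  calc ‖obsErr c m u x‖ₑ ^ 2 ≤ (2 * ‖c x.1‖ₑ) ^ 2 := by gcongr
    _ = _ := by rw [mul_pow]; norm_num

theorem tendsto_obsErr (c : ℝ → ℝ) (u : ℝ) (x : ℝ × ℝ) :
    Tendsto (fun m => ‖obsErr c m u x‖ₑ ^ 2) atTop (𝓝 0) := by
  have h1 : Continuous fun z : ℝ => obs c u (x.1, z) := by
    simp only [obs]
    fun_prop
  have h2 : Tendsto (fun m => obsErr c m u x) atTop (𝓝 0) := by
    have := ((h1.tendsto x.2).comp (tendsto_rounding x.2)).const_sub (obs c u x)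
    simpa only [Function.comp_def, Prod.mk.eta, sub_self, obsErr] using this
  have h3 := ((ENNReal.continuous_pow 2).tendsto _).comp h2.enorm
  simpa [Function.comp_def] using h3

theorem lintegral_sq_obsErr_le (c : ℝ → ℝ) (m : ℕ) (u : ℝ) :
    ∫⁻ ω, ‖obsErr c m u (W 0 ω)‖ₑ ^ 2 ∂P ≤ 4 * ∫⁻ ω, ‖c (W 0 ω).1‖ₑ ^ 2 ∂P := by
  rw [← lintegral_const_mul' _ _ (by simp)]
  exact lintegral_mono fun ω => enorm_sq_obsErr_le c m u _

/-- Dominated convergence twice, in `ω` and then in `u`, with a second moment of `c` as the common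
bound. No modulus of continuity uniform in `u` is needed. -/
theorem tendsto_lintegral_obsErr (hWm : ∀ i, Measurable (W i)) (hc : Measurable c)
    (hc2 : ∫⁻ ω, ‖c (W 0 ω).1‖ₑ ^ 2 ∂P ≠ ∞) {K : ℝ → ℝ≥0∞} (hK : AEMeasurable K)
    (hKi : ∫⁻ u, K u ≠ ∞) :
    Tendsto (fun m => ∫⁻ u, K u * ∫⁻ ω, ‖obsErr c m u (W 0 ω)‖ₑ ^ 2 ∂P) atTop (𝓝 0) := by
  have hV : 4 * ∫⁻ ω, ‖c (W 0 ω).1‖ₑ ^ 2 ∂P ≠ ∞ := ENNReal.mul_ne_top (by simp) hc2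
  have hV' : ∫⁻ ω, 4 * ‖c (W 0 ω).1‖ₑ ^ 2 ∂P ≠ ∞ := by rwa [lintegral_const_mul' _ _ (by simp)]
  have hm : ∀ m, Measurable fun z : ℝ × Ω => ‖obsErr c m z.1 (W 0 z.2)‖ₑ ^ 2 := fun m =>
    (((measurable_uncurry_obsErr hc m).comp
      (measurable_fst.prodMk ((hWm 0).comp measurable_snd))).enorm).pow_const 2
  have h1 : ∀ u, Tendsto (fun m => ∫⁻ ω, ‖obsErr c m u (W 0 ω)‖ₑ ^ 2 ∂P) atTop (𝓝 0) := by
    intro u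
    have h0 : (0 : ℝ≥0∞) = ∫⁻ _, (0 : ℝ≥0∞) ∂P := by simp
    rw [h0]
    exact tendsto_lintegral_of_dominated_convergence _
      (fun m => (((measurable_obsErr hc m u).comp (hWm 0)).enorm).pow_const 2)
      (fun m => ae_of_all _ fun ω => enorm_sq_obsErr_le c m u (W 0 ω)) hV'
      (ae_of_all _ fun ω => tendsto_obsErr c u (W 0 ω))
  have h0 : (0 : ℝ≥0∞) = ∫⁻ _ : ℝ, (0 : ℝ≥0∞) := by simp
  rw [h0]
  refine tendsto_lintegral_of_dominated_convergence'
    (fun u => K u * (4 * ∫⁻ ω, ‖c (W 0 ω).1‖ₑ ^ 2 ∂P))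
    (fun m => hK.mul (hm m).lintegral_prod_right'.aemeasurable)
    (fun m => ae_of_all _ fun u => mul_le_mul_right (lintegral_sq_obsErr_le c m u) _) ?_ ?_
  · rw [lintegral_mul_const' _ _ hV]
    exact ENNReal.mul_ne_top hKi hV
  · filter_upwards [ae_lt_top' hK hKi] with u hu
    have := ENNReal.Tendsto.const_mul (a := K u) (h1 u) (Or.inr hu.ne)
    simpa using this

/-- The part of an observation whose rounded covariate is `l`. -/
noncomputable def obsCell (c : ℝ → ℝ) (m : ℕ) (l : ℝ) (x : ℝ × ℝ) : ℂ :=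
  ((c x.1 : ℝ) : ℂ) * if rounding m x.2 = l then 1 else 0

theorem measurable_obsCell (hc : Measurable c) (m : ℕ) (l : ℝ) : Measurable (obsCell c m l) := by
  have h : MeasurableSet {x : ℝ × ℝ | rounding m x.2 = l} :=
    ((rounding m).measurable.comp measurable_snd) (measurableSet_singleton l)
  unfold obsCell
  exact (Complex.measurable_ofReal.comp (hc.comp measurable_fst)).mul
    (Measurable.ite h measurable_const measurable_const)

theorem enorm_obsCell_le (c : ℝ → ℝ) (m : ℕ) (l : ℝ) (x : ℝ × ℝ) :
    ‖obsCell c m l x‖ₑ ≤ ‖c x.1‖ₑ := by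
  rw [obsCell, enorm_mul, enorm_complex_ofReal]
  split_ifs <;> simp

/-- A rounded covariate takes finitely many values, so the rounded exponential is a finite sum of
products of a function of the observation and a fixed function of `u`. -/
theorem obs_eq_sum_obsCell_add (c : ℝ → ℝ) (m : ℕ) (u : ℝ) (x : ℝ × ℝ) :
    obs c u x = (∑ l ∈ (rounding m).range, obsCell c m l x * Complex.exp (-(Complex.I * u * l)))
      + obsErr c m u x := by
  have h : ∑ l ∈ (rounding m).range, obsCell c m l x * Complex.exp (-(Complex.I * u * l))
      = obs c u (x.1, rounding m x.2) := by
    rw [Finset.sum_eq_single (rounding m x.2)]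
    · simp [obsCell, obs]
    · intro l _ hl
      simp [obsCell, hl.symm]
    · intro hx
      exact absurd ((rounding m).mem_range_self x.2) hx
  rw [h, obsErr, add_sub_cancel]

theorem integrable_of_enorm_le_mul (hc : Measurable c)
    (hc2 : ∫⁻ ω, ‖c (W 0 ω).1‖ₑ ^ 2 ∂P ≠ ∞) (hWm : ∀ i, Measurable (W i)) {b : ℝ × ℝ → ℂ}
    (hb : Measurable b) (h : ∀ x, ‖b x‖ₑ ≤ 2 * ‖c x.1‖ₑ) :
    Integrable (fun ω => b (W 0 ω)) P := by
  have h1 : MemLp (fun ω => c (W 0 ω).1) 2 P := memLp_two_of_lintegral_sq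
    (hc.comp (measurable_fst.comp (hWm 0))).aestronglyMeasurable hc2
  have h2 : Integrable (fun ω => c (W 0 ω).1) P := h1.integrable (by simp)
  refine ⟨(hb.comp (hWm 0)).aestronglyMeasurable,
    (lintegral_mono fun ω => h (W 0 ω)).trans_lt ?_⟩
  rw [lintegral_const_mul' _ _ (by simp)]
  exact ENNReal.mul_lt_top (by simp) h2.hasFiniteIntegral

/-- The randomness of the main part now sits in finitely many scalars that do not depend on `u`.
This is the finite rank decomposition required by `enorm_pairing_smoothed_taylor_le`. -/
theorem empDev_obs_eq (hWm : ∀ i, Measurable (W i)) (hc : Measurable c)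
    (hc2 : ∫⁻ ω, ‖c (W 0 ω).1‖ₑ ^ 2 ∂P ≠ ∞) (m n : ℕ) (u : ℝ) (ω : Ω) :
    empDev P W (obs c u) n ω
      = (∑ l ∈ (rounding m).range, empDev P W (obsCell c m l) n ω
          * Complex.exp (-(Complex.I * u * l))) + empDev P W (obsErr c m u) n ω := by
  have h1 : ∀ l, Integrable (fun ω => obsCell c m l (W 0 ω)) P := fun l =>
    integrable_of_enorm_le_mul hc hc2 hWm (measurable_obsCell hc m l) fun x =>
      (enorm_obsCell_le c m l x).trans (by rw [two_mul]; exact le_self_add)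
  have h2 : Integrable (fun ω => obsErr c m u (W 0 ω)) P :=
    integrable_of_enorm_le_mul hc hc2 hWm
      (measurable_obsErr hc m u) fun x => by
        refine enorm_sub_le.trans ?_
        rw [enorm_obs, enorm_obs, two_mul]
  rw [show obs c u = fun x => (∑ l ∈ (rounding m).range, obsCell c m l x
    * Complex.exp (-(Complex.I * u * l))) + obsErr c m u x from
    funext fun x => obs_eq_sum_obsCell_add c m u x,
    empDev_add (integrable_finsetSum _ fun l _ => (h1 l).mul_const _) h2,
    empDev_sum_mul _ fun l _ => h1 l]

end IID

end EIV

namespace EIV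

set_option linter.unusedSectionVars false

open SpectralFamily (taylorRem)

theorem sq_sum_le_card_mul {ι : Type*} [Fintype ι] (F : ι → ℝ≥0∞) :
    (∑ i, F i) ^ 2 ≤ Fintype.card ι * ∑ i, F i ^ 2 := by
  let _ : MeasurableSpace ι := ⊤
  have h := sq_lintegral_le (Measure.count : Measure ι) (F := F) (measurable_from_top).aemeasurable
  rw [lintegral_fintype, lintegral_fintype, Measure.count_univ, ENat.card_eq_coe_fintype_card] at h
  simpa only [Measure.count_singleton, mul_one, ENat.toENNReal_coe] using h

/-! ### Deviation bounds for a smoothed empirical pairing -/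

namespace SpectralWeight

variable {d : ℕ} {Θ : Set (Param d)} {ψ : Param d → ℝ → ℝ} {G H : ℝ → ℝ≥0∞} {χ : ℝ → ℂ}
  {θ₀ : Param d} {Ω : Type*} [MeasurableSpace Ω] {P : Measure Ω} [IsProbabilityMeasure P]
  {W : ℕ → Ω → ℝ × ℝ} {c : ℝ → ℝ} {k : ℕ → ℝ → ℂ} {C : ℕ → ℝ}

/-- The deviation of the smoothed empirical pairing from its theoretical counterpart. -/
noncomputable def pairingDev (P : Measure Ω) (W : ℕ → Ω → ℝ × ℝ) (χ : ℝ → ℂ)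
    (ψ : Param d → ℝ → ℝ) (c : ℝ → ℝ) (k : ℕ → ℝ → ℂ) (n : ℕ) (ω : Ω) (θ : Param d) : ℂ :=
  pairing χ (ψ θ) (fun u => k n u * obsEmp W c n ω u) - pairing χ (ψ θ) (obsMean P W c)

theorem pairingDev_eq (P : Measure Ω) (W : ℕ → Ω → ℝ × ℝ) (χ : ℝ → ℂ)
    (ψ : Param d → ℝ → ℝ) (c : ℝ → ℝ) (k : ℕ → ℝ → ℂ) (n : ℕ) (ω : Ω) (θ : Param d) :
    pairingDev P W χ ψ c k n ω θ
      = pairing χ (ψ θ) (fun u => k n u * (obsMean P W c u + empDev P W (obs c u) n ω))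
        - pairing χ (ψ θ) (obsMean P W c) := by
  simp only [pairingDev, obsEmp_eq P]

theorem aemeasurable_grad (h : SpectralFamily Θ ψ G) (hχ : SpectralWeight Θ ψ G χ H) :
    AEMeasurable fun u => G u * ‖χ u‖ₑ :=
  h.aemeasurable_bound.mul hχ.measurable.enorm.aemeasurable

/-- Since `H` dominates `ψ_θ^* χ` for all `θ`, the supremum over `θ` is bounded by `2 ∫ H |Δ_n|`
plus a deterministic bias. No rate is needed for the bias, as this bound only serves to localize the
estimator. -/
theorem exists_pairingDev_le (h : SpectralFamily Θ ψ G) (hχ : SpectralWeight Θ ψ G χ H)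
    (hWm : ∀ i, Measurable (W i)) (hW : iIndepFun W P)
    (hid : ∀ i, IdentDistrib (W i) (W 0) P P) (hc : Measurable c)
    (hc2 : ∫⁻ ω, ‖c (W 0 ω).1‖ₑ ^ 2 ∂P ≠ ∞) (hk : IsSmoothing k C) :
    ∃ M : ℕ → Ω → ℝ≥0∞, ∃ β : ℕ → ℝ≥0∞, ∃ A : ℝ≥0∞, A ≠ ∞ ∧ (∀ n, Measurable (M n)) ∧
      (∀ n, 1 ≤ n → ∫⁻ ω, M n ω ^ 2 ∂P ≤ A / n) ∧ Tendsto β atTop (𝓝 0) ∧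
      ∀ n ω, ∀ θ ∈ Θ, ‖pairingDev P W χ ψ c k n ω θ‖ₑ ≤ M n ω + β n := by
  have hφ := isBddMeas_obsMean (P := P) hWm hc
  refine ⟨fun n ω => 2 * ∫⁻ u, H u * ‖empDev P W (obs c u) n ω‖ₑ,
    fun n => ∫⁻ u, H u * (‖k n u - 1‖ₑ * ‖obsMean P W c u‖ₑ),
    4 * ((∫⁻ u, H u) ^ 2 * ∫⁻ ω, ‖c (W 0 ω).1‖ₑ ^ 2 ∂P), ?_, fun n => ?_, fun n hn => ?_, ?_,
    fun n ω θ hθ => ?_⟩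
  · exact ENNReal.mul_ne_top (by simp)
      (ENNReal.mul_ne_top (ENNReal.pow_ne_top hχ.lintegral_bound) hc2)
  · exact (measurable_weighted_empDev hWm (measurable_uncurry_obs hc) hχ.aemeasurable_bound
      hχ.lintegral_bound n).const_mul 2
  · simp_rw [mul_pow]
    rw [lintegral_const_mul' _ _ (by simp), mul_div_assoc]
    refine mul_le_mul' (by norm_num) (lintegral_sq_weighted_empDev_obs_le hWm hW hid hc hc2
      hχ.aemeasurable_bound hχ.lintegral_bound hn)
  · have := hk.tendsto_lintegral (K := fun u => H u * ‖obsMean P W c u‖ₑ)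
      (hχ.aemeasurable_bound.mul hφ.measurable.enorm.aemeasurable)
      (lintegral_mul_bdd_ne_top hχ.lintegral_bound hφ)
    refine this.congr fun n => lintegral_congr fun u => ?_
    ring
  · rw [pairingDev_eq]
    exact hχ.enorm_pairing_smoothed_sub_le h hθ (hk.isBddMeas n) (hk.enorm_le_two n) hφ
      (isBddMeas_empDev_obs hWm hc n ω)

/-- The same argument for increments, with the spectral gradient bound `G |χ|` in the role of `H`.
Here the bias must have order `n^{-1/2}`. -/
theorem exists_pairingDev_sub_le (h : SpectralFamily Θ ψ G) (hχ : SpectralWeight Θ ψ G χ H)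
    (hWm : ∀ i, Measurable (W i)) (hW : iIndepFun W P)
    (hid : ∀ i, IdentDistrib (W i) (W 0) P P) (hc : Measurable c)
    (hc2 : ∫⁻ ω, ‖c (W 0 ω).1‖ₑ ^ 2 ∂P ≠ ∞) (hk : IsSmoothing k C)
    (hbias : Tendsto (fun n : ℕ => ENNReal.ofReal (Real.sqrt n) *
      ∫⁻ u, G u * ‖χ u‖ₑ * (‖k n u - 1‖ₑ * ‖obsMean P W c u‖ₑ)) atTop (𝓝 0)) {ρ : ℝ}
    (hρ : Metric.ball θ₀ ρ ⊆ interior Θ) :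
    ∃ L : ℕ → Ω → ℝ≥0∞, ∃ A : ℝ≥0∞, A ≠ ∞ ∧ (∀ n, Measurable (L n)) ∧
      (∀ n, 1 ≤ n → ∫⁻ ω, L n ω ^ 2 ∂P ≤ A / n) ∧
      ∀ n ω, ∀ θ ∈ Metric.ball θ₀ ρ,
        ‖pairingDev P W χ ψ c k n ω θ - pairingDev P W χ ψ c k n ω θ₀‖ₑ
          ≤ L n ω * ‖θ - θ₀‖ₑ := by
  have hφ := isBddMeas_obsMean (P := P) hWm hc
  have hK := aemeasurable_grad h hχ
  set b : ℕ → ℝ≥0∞ := fun n => ∫⁻ u, G u * ‖χ u‖ₑ * (‖k n u - 1‖ₑ * ‖obsMean P W c u‖ₑ) with hb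
  set b₀ : ℝ≥0∞ := ∫⁻ u, G u * ‖χ u‖ₑ * ‖obsMean P W c u‖ₑ with hb₀
  have hb₀t : b₀ ≠ ∞ := lintegral_mul_bdd_ne_top hχ.lintegral_grad hφ
  have hbb : ∀ n, b n ≤ b₀ := fun n => lintegral_mono fun u => by
    have := hk.enorm_sub_one_le n u
    calc G u * ‖χ u‖ₑ * (‖k n u - 1‖ₑ * ‖obsMean P W c u‖ₑ)
        ≤ G u * ‖χ u‖ₑ * (1 * ‖obsMean P W c u‖ₑ) := by gcongr
      _ = _ := by rw [one_mul]
  -- The scaled bias is at most `1` from `N` on; the earlier terms are covered by the trivial bound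
  -- `‖k - 1‖ ≤ 1`.
  obtain ⟨B, hBt, hB⟩ : ∃ B : ℝ≥0∞, B ≠ ∞ ∧ ∀ n : ℕ, ENNReal.ofReal (Real.sqrt n) * b n ≤ B := by
    obtain ⟨N, hN⟩ := eventually_atTop.1 (hbias.eventually (Iic_mem_nhds zero_lt_one))
    refine ⟨1 + ENNReal.ofReal (Real.sqrt N) * b₀, ENNReal.add_ne_top.2
      ⟨by simp, ENNReal.mul_ne_top ENNReal.ofReal_ne_top hb₀t⟩, fun n => ?_⟩
    rcases le_total N n with hn | hn
    · exact (hN n hn).trans le_self_add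
    · refine le_trans ?_ le_add_self
      gcongr
      exact hbb n
  set V := ∫⁻ ω, ‖c (W 0 ω).1‖ₑ ^ 2 ∂P with hV
  have hm : ∀ n, Measurable fun ω => ∫⁻ u, G u * ‖χ u‖ₑ * ‖empDev P W (obs c u) n ω‖ₑ := fun n =>
    measurable_weighted_empDev hWm (measurable_uncurry_obs hc) hK hχ.lintegral_grad n
  refine ⟨fun n ω => 2 * (∫⁻ u, G u * ‖χ u‖ₑ * ‖empDev P W (obs c u) n ω‖ₑ) + b n,
    8 * ((∫⁻ u, G u * ‖χ u‖ₑ) ^ 2 * V) + 2 * B ^ 2, ?_, fun n => ?_, fun n hn => ?_,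
    fun n ω θ hθ => ?_⟩
  · exact ENNReal.add_ne_top.2 ⟨ENNReal.mul_ne_top (by simp)
      (ENNReal.mul_ne_top (ENNReal.pow_ne_top hχ.lintegral_grad) hc2),
      ENNReal.mul_ne_top (by simp) (ENNReal.pow_ne_top hBt)⟩
  · exact ((hm n).const_mul 2).add_const _
  · have h1 := lintegral_sq_weighted_empDev_obs_le hWm hW hid hc hc2 hK hχ.lintegral_grad hn
    have hn0 : (n : ℝ≥0∞) ≠ 0 := by exact_mod_cast (by omega : n ≠ 0)
    have h2 : b n ^ 2 ≤ B ^ 2 / n := by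
      rw [ENNReal.le_div_iff_mul_le (Or.inl hn0) (Or.inl (by simp))]
      have h3 : ENNReal.ofReal (Real.sqrt n) ^ 2 = n := by
        rw [← ENNReal.ofReal_pow (Real.sqrt_nonneg _), Real.sq_sqrt (Nat.cast_nonneg n),
          ENNReal.ofReal_natCast]
      calc b n ^ 2 * n = (ENNReal.ofReal (Real.sqrt n) * b n) ^ 2 := by rw [mul_pow, h3, mul_comm]
        _ ≤ B ^ 2 := by gcongr; exact hB n
    have h4 : ∀ x y : ℝ≥0∞, (2 * x + y) ^ 2 ≤ 8 * x ^ 2 + 2 * y ^ 2 := fun x y => by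
      have := sq_sum_le_card_mul ![2 * x, y]
      simp only [Fin.sum_univ_two, Matrix.cons_val_zero, Matrix.cons_val_one, Fintype.card_fin,
        mul_pow] at this
      calc (2 * x + y) ^ 2 ≤ 2 * (2 ^ 2 * x ^ 2 + y ^ 2) := this
        _ = _ := by ring
    calc ∫⁻ ω, (2 * (∫⁻ u, G u * ‖χ u‖ₑ * ‖empDev P W (obs c u) n ω‖ₑ) + b n) ^ 2 ∂P
        ≤ ∫⁻ ω, (8 * (∫⁻ u, G u * ‖χ u‖ₑ * ‖empDev P W (obs c u) n ω‖ₑ) ^ 2 + 2 * b n ^ 2) ∂P :=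
          lintegral_mono fun ω => h4 _ _
      _ = 8 * (∫⁻ ω, (∫⁻ u, G u * ‖χ u‖ₑ * ‖empDev P W (obs c u) n ω‖ₑ) ^ 2 ∂P)
          + 2 * b n ^ 2 := by
          rw [lintegral_add_right _ measurable_const, lintegral_const_mul' _ _ (by simp),
            lintegral_const, measure_univ, mul_one]
      _ ≤ 8 * ((∫⁻ u, G u * ‖χ u‖ₑ) ^ 2 * V / n) + 2 * (B ^ 2 / n) := by gcongr
      _ = _ := by simp only [ENNReal.add_div, mul_div_assoc, hV]
  · rw [pairingDev_eq, pairingDev_eq]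
    exact hχ.enorm_pairing_smoothed_sub_sub_le h hρ hθ (hk.isBddMeas n) (hk.enorm_le_two n) hφ
      (isBddMeas_empDev_obs hWm hc n ω)

/-- The factor multiplying `n^{-1/2}` in the mean square bound depends on the mesh alone and tends
to `0`, so one mesh can be fixed before `n`. -/
theorem exists_discretization (h : SpectralFamily Θ ψ G) (hχ : SpectralWeight Θ ψ G χ H)
    (hWm : ∀ i, Measurable (W i)) (hW : iIndepFun W P)
    (hid : ∀ i, IdentDistrib (W i) (W 0) P P) (hc : Measurable c)
    (hc2 : ∫⁻ ω, ‖c (W 0 ω).1‖ₑ ^ 2 ∂P ≠ ∞) {ε : ℝ≥0∞} (hε : 0 < ε) :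
    ∃ m, ∀ n : ℕ, 1 ≤ n → ∫⁻ ω, 2 * (∫⁻ u, G u * ‖χ u‖ₑ * ‖empDev P W (obsErr c m u) n ω‖ₑ) ∂P
      ≤ ε / ENNReal.ofReal (Real.sqrt n) := by
  have hK := aemeasurable_grad h hχ
  have h1 := tendsto_lintegral_obsErr hWm hc hc2 hK hχ.lintegral_grad
  have h2 := ENNReal.Tendsto.const_mul (a := ∫⁻ u, G u * ‖χ u‖ₑ) h1 (Or.inr hχ.lintegral_grad)
  have h3 := (ENNReal.continuous_rpow_const (y := 1 / 2)).tendsto _ |>.comp h2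
  have h4 := ENNReal.Tendsto.const_mul (a := 2) h3 (Or.inr (by simp))
  rw [mul_zero, ENNReal.zero_rpow_of_pos (by norm_num), mul_zero] at h4
  obtain ⟨m, hm⟩ := (h4.eventually (Iic_mem_nhds hε)).exists
  refine ⟨m, fun n hn => ?_⟩
  have hb2 : ∀ u, ∫⁻ ω, ‖obsErr c m u (W 0 ω)‖ₑ ^ 2 ∂P ≠ ∞ := fun u =>
    ne_top_of_le_ne_top (ENNReal.mul_ne_top (by simp) hc2) (lintegral_sq_obsErr_le c m u)
  have h5 := lintegral_le_div_sqrt (measurable_weighted_empDev hWm (measurable_uncurry_obsErr hc m)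
    hK hχ.lintegral_grad n).aemeasurable (lintegral_sq_weighted_empDev_le hWm hW hid
    (measurable_uncurry_obsErr hc m) hb2 hK hχ.lintegral_grad hn)
  rw [lintegral_const_mul' _ _ (by simp)]
  calc 2 * ∫⁻ ω, (∫⁻ u, G u * ‖χ u‖ₑ * ‖empDev P W (obsErr c m u) n ω‖ₑ) ∂P
      ≤ 2 * (((∫⁻ u, G u * ‖χ u‖ₑ)
        * ∫⁻ u, G u * ‖χ u‖ₑ * ∫⁻ ω, ‖obsErr c m u (W 0 ω)‖ₑ ^ 2 ∂P) ^ (1 / 2 : ℝ)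
          / ENNReal.ofReal (Real.sqrt n)) := by gcongr
    _ = (2 * ((∫⁻ u, G u * ‖χ u‖ₑ)
        * ∫⁻ u, G u * ‖χ u‖ₑ * ∫⁻ ω, ‖obsErr c m u (W 0 ω)‖ₑ ^ 2 ∂P) ^ (1 / 2 : ℝ))
          / ENNReal.ofReal (Real.sqrt n) := by rw [mul_div_assoc]
    _ ≤ ε / ENNReal.ofReal (Real.sqrt n) := by gcongr; exact hm

theorem lintegral_sum_obsCell_le (hWm : ∀ i, Measurable (W i)) (hW : iIndepFun W P)
    (hid : ∀ i, IdentDistrib (W i) (W 0) P P) (hc : Measurable c)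
    (hc2 : ∫⁻ ω, ‖c (W 0 ω).1‖ₑ ^ 2 ∂P ≠ ∞) (m : ℕ) {n : ℕ} (hn : 1 ≤ n) :
    ∫⁻ ω, ∑ l ∈ (rounding m).range, ‖empDev P W (obsCell c m l) n ω‖ₑ ∂P
      ≤ (rounding m).range.card * (∫⁻ ω, ‖c (W 0 ω).1‖ₑ ^ 2 ∂P) ^ (1 / 2 : ℝ)
        / ENNReal.ofReal (Real.sqrt n) := by
  have hm : ∀ l, Measurable fun ω => empDev P W (obsCell c m l) n ω := fun l =>
    ((Finset.measurable_fun_sum _ fun i _ => (measurable_obsCell hc m l).comp (hWm i)).const_mul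
      _).sub_const _
  rw [lintegral_finsetSum _ fun l _ => (hm l).enorm, mul_div_assoc, ← nsmul_eq_mul]
  refine Finset.sum_le_card_nsmul _ _ _ fun l _ => ?_
  have hle : ∫⁻ ω, ‖obsCell c m l (W 0 ω)‖ₑ ^ 2 ∂P ≤ ∫⁻ ω, ‖c (W 0 ω).1‖ₑ ^ 2 ∂P :=
    lintegral_mono fun ω => by
      have := enorm_obsCell_le c m l (W 0 ω)
      gcongr
  refine lintegral_le_div_sqrt (hm l).enorm.aemeasurable
    ((lintegral_sq_empDev_le hWm hW hid (measurable_obsCell hc m l)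
      (ne_top_of_le_ne_top hc2 hle) hn).trans ?_)
  gcongr

/-- The order of choices is essential: first the mesh `m`, which makes the discretization error
small for all `n`; then the radius, by the weak expansion at finitely many exponentials; last `N`,
for the smoothing terms. Each of the four contributions receives `ε/4`. -/
theorem exists_pairingDev_taylor_le (h : SpectralFamily Θ ψ G) (hχ : SpectralWeight Θ ψ G χ H)
    (hWm : ∀ i, Measurable (W i)) (hW : iIndepFun W P)
    (hid : ∀ i, IdentDistrib (W i) (W 0) P P) (hc : Measurable c)
    (hc2 : ∫⁻ ω, ‖c (W 0 ω).1‖ₑ ^ 2 ∂P ≠ ∞) (hk : IsSmoothing k C) (hθ₀ : θ₀ ∈ interior Θ)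
    (hbias : Tendsto (fun n : ℕ => ENNReal.ofReal (Real.sqrt n) *
      ∫⁻ u, G u * ‖χ u‖ₑ * (‖k n u - 1‖ₑ * ‖obsMean P W c u‖ₑ)) atTop (𝓝 0)) {ε : ℝ}
    (hε : 0 < ε) :
    ∃ ρ > 0, ∃ N : ℕ, ∀ n ≥ N, ∃ R : Ω → ℝ≥0∞, Measurable R ∧
      ∫⁻ ω, R ω ∂P ≤ ENNReal.ofReal ε / ENNReal.ofReal (Real.sqrt n) ∧
      ∀ ω, ∀ θ ∈ Metric.ball θ₀ ρ,
        ‖pairingDev P W χ ψ c k n ω θ - pairingDev P W χ ψ c k n ω θ₀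
          - ∑ j, ((θ - θ₀) j : ℂ) * pairing χ (pderiv j ψ θ₀)
            (fun u => empDev P W (obs c u) n ω)‖ₑ ≤ R ω * ‖θ - θ₀‖ₑ := by
  have hφ := isBddMeas_obsMean (P := P) hWm hc
  have hK := aemeasurable_grad h hχ
  have hε4 : 0 < ENNReal.ofReal (ε / 4) := ENNReal.ofReal_pos.2 (by positivity)
  set V := ∫⁻ ω, ‖c (W 0 ω).1‖ₑ ^ 2 ∂P with hV
  have hVr : V ^ (1 / 2 : ℝ) ≠ ∞ := ENNReal.rpow_ne_top_of_nonneg (by norm_num) hc2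
  obtain ⟨m, hm⟩ := exists_discretization h hχ hWm hW hid hc hc2 hε4
  set A : ℝ≥0∞ := (rounding m).range.card * V ^ (1 / 2 : ℝ) with hA
  have hAt : A ≠ ∞ := ENNReal.mul_ne_top (by simp) hVr
  -- `A / √n` bounds the mean of the sum of the finitely many random coefficients, so `ε'` is the
  -- precision each expansion must have; `A + 1` avoids a zero denominator.
  obtain ⟨ε', hε', hε'A⟩ : ∃ ε' : ℝ, 0 < ε' ∧ ENNReal.ofReal ε' * A ≤ ENNReal.ofReal (ε / 4) := by
    refine ⟨ε / 4 / (A.toReal + 1), by positivity, ?_⟩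
    rw [← ENNReal.ofReal_toReal hAt, ← ENNReal.ofReal_mul (by positivity)]
    refine ENNReal.ofReal_le_ofReal ?_
    rw [ENNReal.toReal_ofReal ENNReal.toReal_nonneg, div_mul_eq_mul_div,
      div_le_iff₀ (by positivity)]
    have := ENNReal.toReal_nonneg (a := A)
    nlinarith
  obtain ⟨ρ₁, hρ₁, hball⟩ := Metric.isOpen_iff.1 isOpen_interior θ₀ hθ₀
  have hrem : ∀ᶠ θ in 𝓝 θ₀, ∀ l ∈ (rounding m).range,
      ‖∫ u : ℝ, taylorRem ψ θ₀ θ u * (χ u * Complex.exp (-(Complex.I * u * l)))‖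
        ≤ ε' * ‖θ - θ₀‖ := by
    rw [eventually_all_finset]
    intro l _
    obtain ⟨ρ, hρ, -, hle⟩ := hχ.exists_norm_integral_taylorRem_le h hθ₀ (IsBddMeas.cexp l) hε'
    exact Metric.eventually_nhds_iff_ball.2 ⟨ρ, hρ, hle⟩
  obtain ⟨ρ₂, hρ₂, hrem⟩ := Metric.eventually_nhds_iff_ball.1 hrem
  -- Smoothing acting on the deviation: `Δ_n` is already of order `n^{-1/2}`, so it suffices that
  -- the weight `G ‖χ‖ ‖k n - 1‖` has vanishing mass.
  have htail : ∀ᶠ n in atTop, (∫⁻ u, G u * ‖χ u‖ₑ * ‖k n u - 1‖ₑ) * V ^ (1 / 2 : ℝ)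
      ≤ ENNReal.ofReal (ε / 4) := by
    have h1 := ENNReal.Tendsto.mul_const (b := V ^ (1 / 2 : ℝ))
      (hk.tendsto_lintegral hK hχ.lintegral_grad) (Or.inr hVr)
    rw [zero_mul] at h1
    exact h1.eventually (Iic_mem_nhds hε4)
  obtain ⟨N, hN⟩ := eventually_atTop.1
    ((htail.and (hbias.eventually (Iic_mem_nhds hε4))).and (eventually_ge_atTop 1))
  refine ⟨min ρ₁ ρ₂, lt_min hρ₁ hρ₂, N, fun n hn => ?_⟩
  obtain ⟨⟨hn1, hn2⟩, hn3⟩ := hN n hn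
  have hs0 : ENNReal.ofReal (Real.sqrt n) ≠ 0 :=
    (ENNReal.ofReal_pos.2 (Real.sqrt_pos.2 (by exact_mod_cast hn3))).ne'
  have hkm : Measurable fun u => ‖k n u - 1‖ₑ := ((hk.measurable n).sub measurable_const).enorm
  have hKn : AEMeasurable fun u => G u * ‖χ u‖ₑ * ‖k n u - 1‖ₑ := hK.mul hkm.aemeasurable
  have hKni : ∫⁻ u, G u * ‖χ u‖ₑ * ‖k n u - 1‖ₑ ≠ ∞ :=
    ne_top_of_le_ne_top hχ.lintegral_grad (lintegral_mono fun u =>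
      (mul_le_mul_right (hk.enorm_sub_one_le n u) _).trans_eq (mul_one _))
  set b := ∫⁻ u, G u * ‖χ u‖ₑ * (‖k n u - 1‖ₑ * ‖obsMean P W c u‖ₑ) with hb
  have m1 : Measurable fun ω => ENNReal.ofReal ε'
      * ∑ l ∈ (rounding m).range, ‖empDev P W (obsCell c m l) n ω‖ₑ :=
    (Finset.measurable_fun_sum _ fun l _ => (((Finset.measurable_fun_sum _ fun i _ =>
      (measurable_obsCell hc m l).comp (hWm i)).const_mul _).sub_const _).enorm).const_mul _
  have m2 : Measurable fun ω =>
      2 * ∫⁻ u, G u * ‖χ u‖ₑ * ‖empDev P W (obsErr c m u) n ω‖ₑ :=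
    (measurable_weighted_empDev hWm (measurable_uncurry_obsErr hc m) hK
      hχ.lintegral_grad n).const_mul 2
  have m3 : Measurable fun ω =>
      ∫⁻ u, G u * ‖χ u‖ₑ * (‖k n u - 1‖ₑ * ‖empDev P W (obs c u) n ω‖ₑ) := by
    simp_rw [← mul_assoc]
    exact measurable_weighted_empDev hWm (measurable_uncurry_obs hc) hKn hKni n
  have b1 : ∫⁻ ω, ENNReal.ofReal ε' * ∑ l ∈ (rounding m).range, ‖empDev P W (obsCell c m l) n ω‖ₑ ∂P
      ≤ ENNReal.ofReal (ε / 4) / ENNReal.ofReal (Real.sqrt n) := by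
    rw [lintegral_const_mul' _ _ ENNReal.ofReal_ne_top]
    calc ENNReal.ofReal ε' * ∫⁻ ω, ∑ l ∈ (rounding m).range, ‖empDev P W (obsCell c m l) n ω‖ₑ ∂P
        ≤ ENNReal.ofReal ε' * (A / ENNReal.ofReal (Real.sqrt n)) := by
          gcongr
          exact lintegral_sum_obsCell_le hWm hW hid hc hc2 m hn3
      _ = ENNReal.ofReal ε' * A / ENNReal.ofReal (Real.sqrt n) := (mul_div_assoc _ _ _).symm
      _ ≤ _ := by gcongr
  have b3 : ∫⁻ ω, (∫⁻ u, G u * ‖χ u‖ₑ * (‖k n u - 1‖ₑ * ‖empDev P W (obs c u) n ω‖ₑ)) ∂P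
      ≤ ENNReal.ofReal (ε / 4) / ENNReal.ofReal (Real.sqrt n) := by
    have h1 := lintegral_sq_weighted_empDev_obs_le hWm hW hid hc hc2 hKn hKni hn3
    simp_rw [← mul_assoc] at m3 ⊢
    refine (lintegral_le_div_sqrt m3.aemeasurable h1).trans ?_
    gcongr
    refine le_trans (le_of_eq ?_) hn1
    rw [ENNReal.mul_rpow_of_nonneg _ _ (by norm_num), ← ENNReal.rpow_natCast, ← ENNReal.rpow_mul]
    norm_num
    rfl
  have b4 : b ≤ ENNReal.ofReal (ε / 4) / ENNReal.ofReal (Real.sqrt n) := by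
    rw [ENNReal.le_div_iff_mul_le (Or.inl hs0) (Or.inl ENNReal.ofReal_ne_top), mul_comm]
    exact hn2
  refine ⟨fun ω => ENNReal.ofReal ε' * (∑ l ∈ (rounding m).range, ‖empDev P W (obsCell c m l) n ω‖ₑ)
      + 2 * (∫⁻ u, G u * ‖χ u‖ₑ * ‖empDev P W (obsErr c m u) n ω‖ₑ)
      + (∫⁻ u, G u * ‖χ u‖ₑ * (‖k n u - 1‖ₑ * ‖empDev P W (obs c u) n ω‖ₑ)) + b,
    ((m1.add m2).add m3).add_const _, ?_, fun ω θ hθ => ?_⟩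
  · rw [lintegral_add_right _ measurable_const, lintegral_add_right _ m3, lintegral_add_right _ m2,
      lintegral_const, measure_univ, mul_one]
    refine (add_le_add (add_le_add (add_le_add b1 (hm n hn3)) b3) b4).trans (le_of_eq ?_)
    rw [← ENNReal.add_div, ← ENNReal.add_div, ← ENNReal.add_div,
      ← ENNReal.ofReal_add (by positivity) (by positivity),
      ← ENNReal.ofReal_add (by positivity) (by positivity),
      ← ENNReal.ofReal_add (by positivity) (by positivity)]
    congr 2
    ring
  · rw [pairingDev_eq, pairingDev_eq]
    have hθ1 : θ ∈ Metric.ball θ₀ ρ₁ := Metric.ball_subset_ball (min_le_left _ _) hθ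
    have hθ2 : θ ∈ Metric.ball θ₀ ρ₂ := Metric.ball_subset_ball (min_le_right _ _) hθ
    refine hχ.enorm_pairing_smoothed_taylor_le h hball hθ1 (hk.isBddMeas n) hφ
      (s := (rounding m).range) (N := fun l => empDev P W (obsCell c m l) n ω)
      (e := fun l u => Complex.exp (-(Complex.I * u * l)))
      (Δ' := fun u => empDev P W (obsErr c m u) n ω) (fun l _ => IsBddMeas.cexp l) ?_
      (fun u => empDev_obs_eq hWm hc hc2 m n u ω) fun l hl => ?_
    · have e1 : (fun u => empDev P W (obsErr c m u) n ω) = fun u => empDev P W (obs c u) n ω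
          - ∑ l ∈ (rounding m).range, empDev P W (obsCell c m l) n ω
            * Complex.exp (-(Complex.I * u * l)) := by
        funext u
        rw [empDev_obs_eq hWm hc hc2 m n u ω, add_sub_cancel_left]
      rw [e1]
      exact (isBddMeas_empDev_obs hWm hc n ω).sub
        (.sum fun l _ => (IsBddMeas.const _).mul (IsBddMeas.cexp l))
    · rw [← ofReal_norm, ← ofReal_norm, ← ENNReal.ofReal_mul hε'.le]
      exact ENNReal.ofReal_le_ofReal (hrem θ hθ2 l hl)

end SpectralWeight

end EIV

namespace EIV

set_option linter.unusedSectionVars false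

/-! ### The observations -/

section Sample

variable {d : ℕ} {Ω : Type*} [MeasurableSpace Ω] {P : Measure Ω} [IsProbabilityMeasure P]
  {f : Param d → ℝ → ℝ} {θ₀ : Param d} {g p : ℝ → ℝ} {X ξ ε : ℕ → Ω → ℝ}

/-- The observed pairs. -/
noncomputable def observations (f : Param d → ℝ → ℝ) (θ₀ : Param d) (X ξ ε : ℕ → Ω → ℝ) (i : ℕ)
    (ω : Ω) : ℝ × ℝ :=
  (response f θ₀ X ξ i ω, observed X ε i ω)

namespace IsSample

theorem lintegral_p (h : IsSample P g p X ξ ε) : ∫⁻ x, ENNReal.ofReal (p x) = 1 := by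
  have : IsProbabilityMeasure (P.map (ε 0)) :=
    Measure.isProbabilityMeasure_map (h.measurable_noise 0).aemeasurable
  have h1 : P.map (ε 0) Set.univ = 1 := measure_univ
  rwa [h.law_noise 0, withDensity_apply _ .univ, Measure.restrict_univ] at h1

theorem integrable_p (h : IsSample P g p X ξ ε) : Integrable p := by
  refine ⟨h.measurable_p.aestronglyMeasurable, ?_⟩
  rw [hasFiniteIntegral_iff_ofReal (ae_of_all _ h.p_nonneg), h.lintegral_p]
  exact ENNReal.one_lt_top

theorem enorm_fourier_p_le (h : IsSample P g p X ξ ε) (u : ℝ) : ‖fourier p u‖ₑ ≤ 1 := by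
  refine (enorm_integral_le_lintegral_enorm _).trans (le_of_eq ?_)
  rw [← h.lintegral_p]
  refine lintegral_congr fun x => ?_
  rw [enorm_mul, enorm_complex_ofReal, ← ofReal_norm, norm_cexp_I_mul, ENNReal.ofReal_one, one_mul,
    Real.enorm_of_nonneg (h.p_nonneg x)]

theorem fourier_p_eq (h : IsSample P g p X ξ ε) (u : ℝ) :
    fourier p u = ∫ ω, Complex.exp (Complex.I * u * ε 0 ω) ∂P := by
  have hm : AEStronglyMeasurable (fun x : ℝ => Complex.exp (Complex.I * u * x)) (P.map (ε 0)) :=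
    Continuous.aestronglyMeasurable (by fun_prop)
  rw [← integral_map (h.measurable_noise 0).aemeasurable hm, h.law_noise 0,
    integral_withDensity_eq_integral_toReal_smul (h.measurable_p.ennreal_ofReal)
      (ae_of_all _ fun _ => ENNReal.ofReal_lt_top), fourier]
  refine integral_congr_ae (ae_of_all _ fun x => ?_)
  dsimp only
  rw [ENNReal.toReal_ofReal (h.p_nonneg x), Complex.real_smul, mul_comm]

theorem indepFun_noise (h : IsSample P g p X ξ ε) (i : ℕ) :
    IndepFun (fun ω => (X i ω, ξ i ω)) (ε i) P := by
  have hm : ∀ j, Measurable (![X i, ξ i, ε i] j) := by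
    intro j
    fin_cases j
    exacts [h.measurable_design i, h.measurable_error i, h.measurable_noise i]
  exact (h.indep_components i).indepFun_prodMk hm 0 1 2 (by decide) (by decide)

theorem indepFun_error (h : IsSample P g p X ξ ε) (i : ℕ) : IndepFun (X i) (ξ i) P :=
  (h.indep_components i).indepFun (show (0 : Fin 3) ≠ 1 by decide)

theorem identDistrib_design (h : IsSample P g p X ξ ε) (i : ℕ) : IdentDistrib (X i) (X 0) P P :=
  ⟨(h.measurable_design i).aemeasurable, (h.measurable_design 0).aemeasurable, by
    rw [h.law_design i, h.law_design 0]⟩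

theorem identDistrib_noise (h : IsSample P g p X ξ ε) (i : ℕ) : IdentDistrib (ε i) (ε 0) P P :=
  ⟨(h.measurable_noise i).aemeasurable, (h.measurable_noise 0).aemeasurable, by
    rw [h.law_noise i, h.law_noise 0]⟩

theorem measurable_response (h : IsSample P g p X ξ ε) (hf : Measurable (f θ₀)) (i : ℕ) :
    Measurable (response f θ₀ X ξ i) :=
  (hf.comp (h.measurable_design i)).add (h.measurable_error i)

theorem measurable_observations (h : IsSample P g p X ξ ε) (hf : Measurable (f θ₀)) (i : ℕ) :
    Measurable (observations f θ₀ X ξ ε i) :=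
  (h.measurable_response hf i).prodMk ((h.measurable_design i).add (h.measurable_noise i))

theorem iIndepFun_observations (h : IsSample P g p X ξ ε) (hf : Measurable (f θ₀)) :
    iIndepFun (observations f θ₀ X ξ ε) P :=
  h.indep_triples.comp (fun _ t => (f θ₀ t.1 + t.2.1, t.1 + t.2.2)) fun _ => by fun_prop

theorem identDistrib_observations (h : IsSample P g p X ξ ε) (hf : Measurable (f θ₀)) (i : ℕ) :
    IdentDistrib (observations f θ₀ X ξ ε i) (observations f θ₀ X ξ ε 0) P P := by
  have h1 : IdentDistrib (fun ω => ((X i ω, ξ i ω), ε i ω)) (fun ω => ((X 0 ω, ξ 0 ω), ε 0 ω)) P P :=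
    ((h.identDistrib_design i).prodMk (h.law_error i) (h.indepFun_error i)
      (h.indepFun_error 0)).prodMk (h.identDistrib_noise i) (h.indepFun_noise i)
      (h.indepFun_noise 0)
  have h2 : Measurable fun t : (ℝ × ℝ) × ℝ => (f θ₀ t.1.1 + t.1.2, t.1.1 + t.2) := by fun_prop
  exact h1.comp h2

/-- The weighted characteristic function of the design. -/
theorem obsMean_eq (h : IsSample P g p X ξ ε) (hf : Measurable (f θ₀)) {c : ℝ → ℝ}
    (hc : Measurable c) (u : ℝ) :
    obsMean P (observations f θ₀ X ξ ε) c u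
      = (∫ ω, obs c u (response f θ₀ X ξ 0 ω, X 0 ω) ∂P) * fourier p (-u) := by
  have h1 : Measurable fun t : ℝ × ℝ => obs c u (f θ₀ t.1 + t.2, t.1) :=
    (measurable_obs hc u).comp (by fun_prop)
  have h2 : Measurable fun e : ℝ => Complex.exp (Complex.I * (-u : ℝ) * e) := by fun_prop
  -- As `Z = X + ε` with `ε` independent of `(X, ξ)`, the exponential factorizes.
  have h3 := (h.indepFun_noise 0).integral_comp_mul_comp
    ((h.measurable_design 0).prodMk (h.measurable_error 0)).aemeasurable
    (h.measurable_noise 0).aemeasurable h1.aestronglyMeasurable h2.aestronglyMeasurable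
  rw [h.fourier_p_eq, obsMean]
  simp only [Function.comp_def] at h3
  rw [show (∫ ω, obs c u (response f θ₀ X ξ 0 ω, X 0 ω) ∂P)
    = ∫ ω, obs c u (f θ₀ (X 0 ω) + ξ 0 ω, X 0 ω) ∂P from rfl, ← h3]
  refine integral_congr_ae (ae_of_all _ fun ω => ?_)
  simp only [obs, observations, response, observed, Pi.mul_apply]
  rw [mul_assoc (c _ : ℂ), ← Complex.exp_add]
  congr 2
  push_cast
  ring

/-- The mean inherits the decay of `p^*`. This cancels the division by `p^*` in `deconvWeight`,
which is why the bias condition on the bandwidth does not involve the noise. -/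
theorem enorm_obsMean_le (h : IsSample P g p X ξ ε) (hf : Measurable (f θ₀)) {c : ℝ → ℝ}
    (hc : Measurable c) (u : ℝ) :
    ‖obsMean P (observations f θ₀ X ξ ε) c u‖ₑ
      ≤ (∫⁻ ω, ‖c (response f θ₀ X ξ 0 ω)‖ₑ ∂P) * ‖fourier p u‖ₑ := by
  rw [h.obsMean_eq hf hc, enorm_mul, ← ofReal_norm (fourier p (-u)), norm_fourier_neg, ofReal_norm]
  gcongr
  refine (enorm_integral_le_lintegral_enorm _).trans (le_of_eq ?_)
  simp only [enorm_obs]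

end IsSample

end Sample

/-! ### The spectral families of the model -/

/-- The weight `(2π)⁻¹ / p^*(-u)`. -/
noncomputable def deconvWeight (p : ℝ → ℝ) (u : ℝ) : ℂ := (2 * Real.pi : ℂ)⁻¹ / fourier p (-u)

theorem continuous_deconvWeight {p : ℝ → ℝ} (hp : Integrable p) (hp0 : ∀ t, fourier p t ≠ 0) :
    Continuous (deconvWeight p) :=
  continuous_const.div ((continuous_fourier hp).comp continuous_neg) fun _ => hp0 _

theorem norm_two_pi_inv_le : ‖(2 * Real.pi : ℂ)⁻¹‖ ≤ 1 := by
  rw [norm_inv]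
  apply inv_le_one_of_one_le₀
  rw [norm_mul, Complex.norm_real, Real.norm_eq_abs, abs_of_pos Real.pi_pos]
  have := Real.pi_gt_three
  norm_num
  linarith

theorem enorm_deconvWeight_mul_le {p : ℝ → ℝ} {u : ℝ} (hp0 : fourier p u ≠ 0) :
    ‖deconvWeight p u‖ₑ * ‖fourier p u‖ₑ ≤ 1 := by
  rw [← ofReal_norm, ← ofReal_norm, ← ENNReal.ofReal_mul (norm_nonneg _), ← ENNReal.ofReal_one]
  refine ENNReal.ofReal_le_ofReal ?_
  rw [deconvWeight, norm_div, norm_fourier_neg, div_mul_cancel₀ _ (norm_ne_zero_iff.2 hp0)]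
  exact norm_two_pi_inv_le

theorem fourier_eq_ratio_mul {p : ℝ → ℝ} {u : ℝ} (hp0 : fourier p u ≠ 0) (φ : ℝ → ℝ) :
    fourier φ u = ratio p φ u * fourier p u := by
  rw [ratio, div_mul_cancel₀ _ hp0]

theorem enorm_fourier_mul_deconvWeight_le {p : ℝ → ℝ} {u : ℝ} (hp0 : fourier p u ≠ 0)
    (φ : ℝ → ℝ) : ‖fourier φ u‖ₑ * ‖deconvWeight p u‖ₑ ≤ ‖ratio p φ u‖ₑ := by
  rw [fourier_eq_ratio_mul hp0, enorm_mul, mul_assoc, mul_comm ‖fourier p u‖ₑ]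
  exact (mul_le_mul_right (enorm_deconvWeight_mul_le hp0) _).trans_eq (mul_one _)

theorem supOver_fourier_eq {d : ℕ} {p : ℝ → ℝ} {u : ℝ} (hp0 : fourier p u ≠ 0)
    (A : Set (Param d)) (φ : Param d → ℝ → ℝ) :
    supOver A (fun θ => fourier (φ θ)) u = supOver A (fun θ => ratio p (φ θ)) u * ‖fourier p u‖ₑ := by
  simp only [supOver, ENNReal.iSup_mul, fourier_eq_ratio_mul hp0 (φ _), enorm_mul]

theorem enorm_le_supOver {d : ℕ} {β : Type*} [ENorm β] {A : Set (Param d)} (h : Param d → ℝ → β)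
    {θ : Param d} (hθ : θ ∈ A) (x : ℝ) : ‖h θ x‖ₑ ≤ supOver A h x :=
  le_iSup₂ (f := fun θ (_ : θ ∈ A) => ‖h θ x‖ₑ) θ hθ

theorem aemeasurable_of_inL1L2 {h : ℝ → ℝ≥0∞} (hh : MemLp h 1) :
    AEMeasurable h ∧ ∫⁻ u, h u ≠ ∞ := by
  refine ⟨hh.1.aemeasurable, ?_⟩
  have := hh.2
  rw [eLpNorm_one_eq_lintegral_enorm] at this
  simpa using this.ne

/-! ### Domination for the families `w f^k` and choice of the bandwidth -/

section Families

variable {d : ℕ} {Θ : Set (Param d)} {f w : Param d → ℝ → ℝ} {p : ℝ → ℝ}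

/-- The dominating function of the spectral gradient of `w f^k`. -/
noncomputable def gradBound (Θ : Set (Param d)) (f w : Param d → ℝ → ℝ) (k : ℕ) (u : ℝ) : ℝ≥0∞ :=
  ∑ j, supOver (interior Θ) (fun θ => fourier (pderiv j (wf w f k) θ)) u

/-- The dominating function of the ratios of the spectral gradient of `w f^k`. -/
noncomputable def ratioBound (Θ : Set (Param d)) (f w : Param d → ℝ → ℝ) (p : ℝ → ℝ) (k : ℕ)
    (u : ℝ) : ℝ≥0∞ :=
  ∑ j, supOver (interior Θ) (fun θ => ratio p (pderiv j (wf w f k) θ)) u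

theorem gradBound_eq {k : ℕ} {u : ℝ} (hp0 : fourier p u ≠ 0) :
    gradBound Θ f w k u = ratioBound Θ f w p k u * ‖fourier p u‖ₑ := by
  simp only [gradBound, ratioBound, supOver_fourier_eq hp0, Finset.sum_mul]

theorem RatioConditions.ratioBound_bound (h : RatioConditions Θ f w p) {k : ℕ} (hk : k ≤ 2) :
    AEMeasurable (ratioBound Θ f w p k) ∧ ∫⁻ u, ratioBound Θ f w p k u ≠ ∞ := by
  have h1 : ∀ j, _ := fun j => aemeasurable_of_inL1L2 (h.sup_ratio_deriv k hk j).1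
  refine ⟨Finset.aemeasurable_fun_sum _ fun j _ => (h1 j).1, ?_⟩
  simp only [ratioBound]
  rw [lintegral_finsetSum' _ fun j _ => (h1 j).1]
  exact ENNReal.sum_ne_top.2 fun j _ => (h1 j).2

theorem gradBound_mul_deconvWeight_le {k : ℕ} {u : ℝ} (hp0 : fourier p u ≠ 0) :
    gradBound Θ f w k u * ‖deconvWeight p u‖ₑ ≤ ratioBound Θ f w p k u := by
  rw [gradBound_eq hp0, mul_assoc, mul_comm ‖fourier p u‖ₑ]
  exact (mul_le_mul_right (enorm_deconvWeight_mul_le hp0) _).trans_eq (mul_one _)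

theorem wf_zero (w f : Param d → ℝ → ℝ) : wf w f 0 = w := by
  funext θ x
  simp [wf]

theorem integrable_fourier_of_ratio (hp0 : ∀ t, fourier p t ≠ 0)
    (hp1 : ∀ u, ‖fourier p u‖ₑ ≤ 1) {φ : ℝ → ℝ} (hφ : Integrable φ) {K : ℝ → ℝ≥0∞}
    (hK : ∫⁻ u, K u ≠ ∞) (h : ∀ u, ‖ratio p φ u‖ₑ ≤ K u) : Integrable (fourier φ) := by
  refine ⟨(continuous_fourier hφ).aestronglyMeasurable, (lintegral_mono fun u => ?_).trans_lt
    hK.lt_top⟩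
  rw [fourier_eq_ratio_mul (hp0 u), enorm_mul]
  exact ((mul_le_mul_right (hp1 u) _).trans_eq (mul_one _)).trans (h u)

theorem RatioConditions.exists_ratio_le (h : RatioConditions Θ f w p) {k : ℕ} (hk : k ≤ 2)
    {θ : Param d} (hθ : θ ∈ Θ) :
    ∃ K : ℝ → ℝ≥0∞, AEMeasurable K ∧ ∫⁻ u, K u ≠ ∞ ∧ ∀ u, ‖ratio p (wf w f k θ) u‖ₑ ≤ K u := by
  interval_cases k
  · have h1 := memLp_one_iff_integrable.1 (h.ratio_w θ hθ).1
    refine ⟨fun u => ‖ratio p (w θ) u‖ₑ, h1.1.enorm, h1.2.ne, fun u => ?_⟩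
    rw [wf_zero]
  · have h1 := aemeasurable_of_inL1L2 h.sup_ratio_wf.1
    exact ⟨_, h1.1, h1.2, fun u => enorm_le_supOver (fun θ => ratio p (wf w f 1 θ)) hθ u⟩
  · have h1 := aemeasurable_of_inL1L2 h.sup_ratio_wf_sq.1
    exact ⟨_, h1.1, h1.2, fun u => enorm_le_supOver (fun θ => ratio p (wf w f 2 θ)) hθ u⟩

/-- As `|p^*| ≤ 1`, integrability of the ratios passes to the transforms themselves. -/
theorem spectralFamily_wf (hf : SmoothRegression Θ f) (hw : SmoothWeight Θ w)
    (h : RatioConditions Θ f w p) (hp : Integrable p) (hp0 : ∀ t, fourier p t ≠ 0)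
    (hp1 : ∀ u, ‖fourier p u‖ₑ ≤ 1) {k : ℕ} (hk : k ≤ 2) :
    SpectralFamily Θ (wf w f k) (gradBound Θ f w k) where
  contDiffOn x := ((hw.contDiffOn x).of_le (by norm_num)).mul
    (((hf.contDiffOn x).of_le (by norm_num)).pow k)
  continuousOn x := (hw.continuousOn x).mul ((hf.continuousOn x).pow k)
  integrable := h.integrable k hk
  integrable_fourier θ hθ := by
    obtain ⟨K, -, hK, hle⟩ := h.exists_ratio_le hk hθ
    exact integrable_fourier_of_ratio hp0 hp1 (h.integrable k hk θ hθ) hK hle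
  integrable_pderiv := h.integrable_deriv k hk
  aemeasurable_bound := by
    have e : gradBound Θ f w k = fun u => ratioBound Θ f w p k u * ‖fourier p u‖ₑ :=
      funext fun u => gradBound_eq (hp0 u)
    rw [e]
    exact (h.ratioBound_bound hk).1.mul (continuous_fourier hp).measurable.enorm.aemeasurable
  lintegral_bound := by
    refine ne_top_of_le_ne_top (h.ratioBound_bound hk).2 (lintegral_mono fun u => ?_)
    rw [gradBound_eq (hp0 u)]
    exact (mul_le_mul_right (hp1 u) _).trans_eq (mul_one _)
  bound θ hθ u := Finset.sum_le_sum fun j _ =>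
    enorm_le_supOver (fun θ => fourier (pderiv j (wf w f k) θ)) hθ u

/-- For `k = 1, 2` the supremum is integrable by assumption, and for `k = 0` this is assumed when
`Θ` is not convex. On a convex `Θ` the case `k = 0` follows from the mean value inequality: the
ratio at `θ₀` plus the diameter times the bound on the ratios of the gradient. -/
theorem exists_ratio_dominated (hf : SmoothRegression Θ f) (hw : SmoothWeight Θ w)
    (h : RatioConditions Θ f w p) (hp : Integrable p) (hp0 : ∀ t, fourier p t ≠ 0)
    (hp1 : ∀ u, ‖fourier p u‖ₑ ≤ 1) (hΘ : IsCompact Θ) {θ₀ : Param d} (hθ₀ : θ₀ ∈ interior Θ)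
    (hnc : ¬ Convex ℝ Θ → MemLp (supOver Θ (fun θ => ratio p (w θ))) 1) {k : ℕ} (hk : k ≤ 2) :
    ∃ H : ℝ → ℝ≥0∞, AEMeasurable H ∧ ∫⁻ u, H u ≠ ∞ ∧
      ∀ θ ∈ Θ, ∀ᵐ u, ‖ratio p (wf w f k θ) u‖ₑ ≤ H u := by
  by_cases hk0 : k = 0
  · subst hk0
    by_cases hconv : Convex ℝ Θ
    · obtain ⟨K, hKm, hK, hle⟩ := h.exists_ratio_le hk (interior_subset hθ₀)
      obtain ⟨D, hD⟩ := hΘ.isBounded.exists_norm_le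
      -- `Θ` lies in the ball of radius `D` about the origin, so `2 * D` bounds `‖θ - θ₀‖`.
      refine ⟨fun u => K u + ENNReal.ofReal (2 * D) * ratioBound Θ f w p 0 u,
        hKm.add ((h.ratioBound_bound hk).1.const_mul _), ?_, fun θ hθ => ?_⟩
      · rw [lintegral_add_left' hKm, lintegral_const_mul' _ _ ENNReal.ofReal_ne_top]
        exact ENNReal.add_ne_top.2 ⟨hK,
          ENNReal.mul_ne_top ENNReal.ofReal_ne_top (h.ratioBound_bound hk).2⟩
      · filter_upwards [(spectralFamily_wf hf hw h hp hp0 hp1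
          hk).ae_enorm_fourier_sub_le_of_convex hconv hθ₀ hθ] with u hu
        have e1 : ratio p (wf w f 0 θ) u = ratio p (wf w f 0 θ₀) u
            + (fourier (wf w f 0 θ) u - fourier (wf w f 0 θ₀) u) / fourier p u := by
          simp only [ratio]
          ring
        rw [e1]
        refine (enorm_add_le _ _).trans (add_le_add (hle u) ?_)
        have hpe : ‖fourier p u‖ₑ ≠ 0 := by simpa using hp0 u
        have hnorm : ‖θ - θ₀‖ₑ ≤ ENNReal.ofReal (2 * D) := by
          rw [← ofReal_norm]
          refine ENNReal.ofReal_le_ofReal ((norm_sub_le _ _).trans ?_)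
          linarith [hD θ hθ, hD θ₀ (interior_subset hθ₀)]
        rw [div_eq_mul_inv, enorm_mul, enorm_inv (hp0 u), ← div_eq_mul_inv]
        refine ENNReal.div_le_of_le_mul (hu.trans ?_)
        rw [gradBound_eq (hp0 u), mul_assoc]
        gcongr
    · have h1 := aemeasurable_of_inL1L2 (hnc hconv)
      refine ⟨_, h1.1, h1.2, fun θ hθ => ae_of_all _ fun u => ?_⟩
      rw [wf_zero]
      exact enorm_le_supOver (fun θ => ratio p (w θ)) hθ u
  · have hk' : k = 1 ∨ k = 2 := by omega
    rcases hk' with rfl | rfl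
    · have h1 := aemeasurable_of_inL1L2 h.sup_ratio_wf.1
      exact ⟨_, h1.1, h1.2, fun θ hθ => ae_of_all _ fun u =>
        enorm_le_supOver (fun θ => ratio p (wf w f 1 θ)) hθ u⟩
    · have h1 := aemeasurable_of_inL1L2 h.sup_ratio_wf_sq.1
      exact ⟨_, h1.1, h1.2, fun θ hθ => ae_of_all _ fun u =>
        enorm_le_supOver (fun θ => ratio p (wf w f 2 θ)) hθ u⟩

theorem exists_spectralWeight (hf : SmoothRegression Θ f) (hw : SmoothWeight Θ w)
    (h : RatioConditions Θ f w p) (hp : Integrable p) (hp0 : ∀ t, fourier p t ≠ 0)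
    (hp1 : ∀ u, ‖fourier p u‖ₑ ≤ 1) (hΘ : IsCompact Θ) {θ₀ : Param d} (hθ₀ : θ₀ ∈ interior Θ)
    (hnc : ¬ Convex ℝ Θ → MemLp (supOver Θ (fun θ => ratio p (w θ))) 1) {k : ℕ} (hk : k ≤ 2) :
    ∃ H, SpectralWeight Θ (wf w f k) (gradBound Θ f w k) (deconvWeight p) H := by
  obtain ⟨H, hHm, hHi, hle⟩ := exists_ratio_dominated hf hw h hp hp0 hp1 hΘ hθ₀ hnc hk
  refine ⟨H, (continuous_deconvWeight hp hp0).measurable, ?_, hHm, hHi, fun θ hθ => ?_⟩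
  · exact ne_top_of_le_ne_top (h.ratioBound_bound hk).2
      (lintegral_mono fun u => gradBound_mul_deconvWeight_le (hp0 u))
  · filter_upwards [hle θ hθ] with u hu
    exact (enorm_fourier_mul_deconvWeight_le (hp0 u) _).trans hu

/-! ### Bandwidths -/

variable {κ : ℝ → ℂ}

theorem IsKernelTransform.norm_neg_sub_one (h : IsKernelTransform κ) (t : ℝ) :
    ‖κ (-t) - 1‖ₑ = ‖κ t - 1‖ₑ := by
  rw [← ofReal_norm, ← ofReal_norm, h.symm, ← RCLike.norm_conj (κ t - 1), map_sub, map_one]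

theorem IsKernelTransform.enorm_sub_one_le (h : IsKernelTransform κ) {c : ℝ} (hc : 0 < c) (u : ℝ) :
    ‖κ (u / c) - 1‖ₑ ≤ {u : ℝ | c ≤ |u|}.indicator 1 u := by
  have h1 := h.bound (u / c)
  rw [← ofReal_norm, ← norm_neg, neg_sub]
  by_cases hu : c ≤ |u|
  · rw [Set.indicator_of_mem (by exact hu), Pi.one_apply, ← ENNReal.ofReal_one]
    exact ENNReal.ofReal_le_ofReal (h1.trans (Set.indicator_le_self' (by simp) _))
  · rw [Set.indicator_of_notMem (by exact hu)]
    rw [Set.indicator_of_notMem (by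
      simp only [Set.mem_ofPred_eq, not_le, abs_div, abs_of_pos hc]
      rw [div_lt_one hc]
      exact not_le.1 hu)] at h1
    simpa using h1

/-- The multipliers `u ↦ K^*(-u / C_n)`. -/
theorem isSmoothing_of_isBandwidth (h : IsKernelTransform κ) {C : ℕ → ℝ}
    (hC : IsBandwidth Θ f w κ C) : IsSmoothing (fun n u => κ (-u / C n)) C where
  measurable n := h.measurable.comp (by fun_prop)
  bound n u := by
    rw [neg_div, h.norm_neg_sub_one]
    exact h.enorm_sub_one_le (hC.pos n) u
  tendsto := hC.tendsto

theorem lintegral_gradBound_mul {c : ℝ} (k : ℕ) (hm : ∀ j, AEMeasurable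
      (supOver (interior Θ) (fun θ => fourier (pderiv j (wf w f k) θ)))) (h : IsKernelTransform κ) :
    ∫⁻ u, gradBound Θ f w k u * ‖κ (u / c) - 1‖ₑ = ∑ j, ∫⁻ t : ℝ,
      supOver (interior Θ) (fun θ => fourier (pderiv j (wf w f k) θ)) t * ‖κ (t / c) - 1‖ₑ := by
  have hk : Measurable fun u : ℝ => ‖κ (u / c) - 1‖ₑ :=
    ((h.measurable.comp (measurable_id.div_const c)).sub measurable_const).enorm
  rw [← lintegral_finsetSum' (f := fun j u => supOver (interior Θ)
    (fun θ => fourier (pderiv j (wf w f k) θ)) u * ‖κ (u / c) - 1‖ₑ) _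
    fun j _ => (hm j).mul hk.aemeasurable]
  simp only [gradBound, Finset.sum_mul]

theorem aemeasurable_supOver_fourier (h : RatioConditions Θ f w p) (hp : Integrable p)
    (hp0 : ∀ t, fourier p t ≠ 0) {k : ℕ} (hk : k ≤ 2) (j : Fin d) :
    AEMeasurable (supOver (interior Θ) (fun θ => fourier (pderiv j (wf w f k) θ))) := by
  have e : supOver (interior Θ) (fun θ => fourier (pderiv j (wf w f k) θ)) = fun u =>
      supOver (interior Θ) (fun θ => ratio p (pderiv j (wf w f k) θ)) u * ‖fourier p u‖ₑ :=
    funext fun u => supOver_fourier_eq (hp0 u) _ _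
  rw [e]
  exact (aemeasurable_of_inL1L2 (h.sup_ratio_deriv k hk j).1).1.mul
    (continuous_fourier hp).measurable.enorm.aemeasurable

/-- The product of `deconvWeight` and a function bounded by `A |p^*|` is at most `A`; what remains
is a finite sum of the quantities in the bandwidth condition. The modulus of `K^* - 1` is even, so
the sign of `u` is immaterial. -/
theorem tendsto_bias (h : RatioConditions Θ f w p) (hp : Integrable p)
    (hp0 : ∀ t, fourier p t ≠ 0) (hκ : IsKernelTransform κ) {C : ℕ → ℝ}
    (hC : IsBandwidth Θ f w κ C) {k : ℕ} (hk : k ≤ 2) {φ : ℝ → ℂ} {A : ℝ≥0∞} (hA : A ≠ ∞)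
    (hφ : ∀ u, ‖φ u‖ₑ ≤ A * ‖fourier p u‖ₑ) :
    Tendsto (fun n : ℕ => ENNReal.ofReal (Real.sqrt n) * ∫⁻ u, gradBound Θ f w k u
      * ‖deconvWeight p u‖ₑ * (‖κ (-u / C n) - 1‖ₑ * ‖φ u‖ₑ)) atTop (𝓝 0) := by
  have h1 := tendsto_finsetSum Finset.univ fun (j : Fin d) _ => hC.bias k hk j
  have h2 := ENNReal.Tendsto.const_mul (a := A) h1 (Or.inr hA)
  simp only [Finset.sum_const_zero, mul_zero] at h2
  refine tendsto_of_tendsto_of_tendsto_of_le_of_le tendsto_const_nhds h2 (fun _ => zero_le)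
    fun n => ?_
  dsimp only
  rw [← Finset.mul_sum, ← lintegral_gradBound_mul k
    (fun j => aemeasurable_supOver_fourier h hp hp0 hk j) hκ, mul_left_comm,
    ← lintegral_const_mul' _ _ hA]
  refine mul_le_mul_right (lintegral_mono fun u => ?_) _
  rw [neg_div, hκ.norm_neg_sub_one]
  calc gradBound Θ f w k u * ‖deconvWeight p u‖ₑ * (‖κ (u / C n) - 1‖ₑ * ‖φ u‖ₑ)
      ≤ gradBound Θ f w k u * ‖deconvWeight p u‖ₑ
        * (‖κ (u / C n) - 1‖ₑ * (A * ‖fourier p u‖ₑ)) := by gcongr; exact hφ u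
    _ = A * (gradBound Θ f w k u * ‖κ (u / C n) - 1‖ₑ)
        * (‖deconvWeight p u‖ₑ * ‖fourier p u‖ₑ) := by ring
    _ ≤ _ := (mul_le_mul_right (enorm_deconvWeight_mul_le (hp0 u)) _).trans_eq (mul_one _)

/-- `K^*(t / C_n) - 1` vanishes for `|t| < C_n`, so the bias is at most the tail of an integrable
function. Tails tend to `0`, and `C_n` can be taken so large that `√n` times the tail is at most `1
/ (n + 1)`. -/
theorem exists_isBandwidth (hf : SmoothRegression Θ f) (hw : SmoothWeight Θ w)
    (h : RatioConditions Θ f w p) (hp : Integrable p) (hp0 : ∀ t, fourier p t ≠ 0)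
    (hp1 : ∀ u, ‖fourier p u‖ₑ ≤ 1) (hκ : IsKernelTransform κ) :
    ∃ C : ℕ → ℝ, IsBandwidth Θ f w κ C := by
  set G : ℝ → ℝ≥0∞ := fun u => ∑ k : Fin 3, gradBound Θ f w k u with hG
  have hfam : ∀ k : Fin 3, _ := fun k =>
    spectralFamily_wf hf hw h hp hp0 hp1 (show (k : ℕ) ≤ 2 by omega)
  have hGm : AEMeasurable G := Finset.aemeasurable_fun_sum _ fun k _ => (hfam k).aemeasurable_bound
  have hGi : ∫⁻ u, G u ≠ ∞ := by
    rw [hG, lintegral_finsetSum' _ fun k _ => (hfam k).aemeasurable_bound]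
    exact ENNReal.sum_ne_top.2 fun k _ => (hfam k).lintegral_bound
  have htail : Tendsto (fun m : ℕ => ∫⁻ u, {u : ℝ | (m : ℝ) ≤ |u|}.indicator G u) atTop (𝓝 0) := by
    have h0 : (0 : ℝ≥0∞) = ∫⁻ _ : ℝ, (0 : ℝ≥0∞) := by simp
    rw [h0]
    refine tendsto_lintegral_of_dominated_convergence' G (fun m => hGm.indicator
      (measurableSet_le measurable_const (by fun_prop)))
      (fun m => ae_of_all _ fun u => Set.indicator_le_self _ _ _) hGi (ae_of_all _ fun u => ?_)
    refine tendsto_const_nhds.congr' ?_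
    filter_upwards [tendsto_natCast_atTop_atTop.eventually_gt_atTop |u|] with m hm
    rw [Set.indicator_of_notMem (by simpa using hm)]
  -- The requirement `n + 1 ≤ m` makes the sequence positive and divergent.
  have hex : ∀ n : ℕ, ∃ m : ℕ, n + 1 ≤ m ∧ ENNReal.ofReal (Real.sqrt n) *
      ∫⁻ u, {u : ℝ | (m : ℝ) ≤ |u|}.indicator G u ≤ ENNReal.ofReal (1 / ((n : ℝ) + 1)) := by
    intro n
    have h1 := ENNReal.Tendsto.const_mul (a := ENNReal.ofReal (Real.sqrt n)) htail
      (Or.inr ENNReal.ofReal_ne_top)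
    rw [mul_zero] at h1
    obtain ⟨m, h2, h3⟩ := ((h1.eventually (Iic_mem_nhds (ENNReal.ofReal_pos.2
      (by positivity : (0 : ℝ) < 1 / ((n : ℝ) + 1))))).and (eventually_ge_atTop (n + 1))).exists
    exact ⟨m, h3, h2⟩
  choose C hCn hC using hex
  have hpos : ∀ n, (0 : ℝ) < C n := fun n => by
    exact_mod_cast lt_of_lt_of_le (Nat.succ_pos n) (hCn n)
  refine ⟨fun n => C n, hpos, ?_, fun k hk j => ?_⟩
  · refine tendsto_natCast_atTop_atTop.comp (tendsto_atTop_mono (fun n => ?_) tendsto_id)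
    exact (Nat.le_succ n).trans (hCn n)
  · have h0 : Tendsto (fun n : ℕ => ENNReal.ofReal (1 / ((n : ℝ) + 1))) atTop (𝓝 0) := by
      have := ENNReal.tendsto_ofReal (tendsto_one_div_add_atTop_nhds_zero_nat (𝕜 := ℝ))
      simpa using this
    refine tendsto_of_tendsto_of_tendsto_of_le_of_le tendsto_const_nhds h0 (fun _ => zero_le)
      fun n => le_trans ?_ (hC n)
    dsimp only
    gcongr with u
    rw [show {u : ℝ | (C n : ℝ) ≤ |u|}.indicator G u
      = G u * {u : ℝ | (C n : ℝ) ≤ |u|}.indicator 1 u by simp [Set.indicator_apply]]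
    refine mul_le_mul' ?_ (hκ.enorm_sub_one_le (hpos n) u)
    refine le_trans ?_ (Finset.single_le_sum (f := fun k : Fin 3 => gradBound Θ f w k u)
      (fun _ _ => zero_le) (Finset.mem_univ (⟨k, by omega⟩ : Fin 3)))
    exact Finset.single_le_sum (f := fun j =>
      supOver (interior Θ) (fun θ => fourier (pderiv j (wf w f k) θ)) u)
      (fun _ _ => zero_le) (Finset.mem_univ j)

end Families

end EIV

namespace EIV

set_option linter.unusedSectionVars false

/-! ### Spectral representation of the criteria -/

/-- The coefficients of `(y - f)² - s2` as a polynomial in `f`. -/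
noncomputable def coef (s2 : ℝ) : Fin 3 → ℝ → ℝ :=
  ![fun y => y ^ 2 - s2, fun y => -2 * y, fun _ => 1]

theorem measurable_coef (s2 : ℝ) (k : Fin 3) : Measurable (coef s2 k) := by
  fin_cases k <;> simp only [coef, Fin.zero_eta, Fin.mk_one, Fin.reduceFinMk,
    Matrix.cons_val_zero, Matrix.cons_val_one, Matrix.cons_val] <;> fun_prop

theorem sum_coef_mul_wf {d : ℕ} (w f : Param d → ℝ → ℝ) (s2 y : ℝ) (θ : Param d) (x : ℝ) :
    ∑ k : Fin 3, coef s2 k y * wf w f k θ x = ((y - f θ x) ^ 2 - s2) * w θ x := by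
  simp only [Fin.sum_univ_three, coef, wf, Matrix.cons_val_zero, Matrix.cons_val_one,
    Matrix.cons_val, Fin.val_zero, Fin.val_one, Fin.val_two]
  ring

/-- This is where fourth moments enter: the coefficient `y² - s2` must be square integrable at `Y`.
-/
theorem memLp_coef {Ω : Type*} [MeasurableSpace Ω] {P : Measure Ω} [IsProbabilityMeasure P]
    {Y : Ω → ℝ} (hY : MemLp Y 4 P) (s2 : ℝ) (k : Fin 3) : MemLp (fun ω => coef s2 k (Y ω)) 2 P := by
  have h2 : MemLp Y 2 P := hY.mono_exponent (by norm_num)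
  fin_cases k
  · have h : MemLp (fun ω => Y ω ^ 2) 2 P := by
      refine memLp_two_of_lintegral_sq (hY.1.pow 2) ?_
      have h4 := hY.2
      rw [eLpNorm_lt_top_iff_lintegral_rpow_enorm_lt_top (by simp) (by simp)] at h4
      refine ne_top_of_le_ne_top h4.ne (le_of_eq (lintegral_congr fun ω => ?_))
      rw [enorm_pow, ← pow_mul]
      norm_num
    exact h.sub (memLp_const s2)
  · exact h2.const_mul (-2)
  · exact memLp_const 1

/-! ### Pairings with exponentials -/

section Inversion

variable {χ : ℝ → ℂ}

theorem continuous_cfourier {η : ℝ → ℂ} (hη : Integrable η) : Continuous (cfourier η) := by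
  refine continuous_of_dominated (bound := fun u => ‖η u‖) (fun x => ?_) (fun x => ?_) hη.norm ?_
  · exact (Continuous.aestronglyMeasurable (by fun_prop)).mul hη.aestronglyMeasurable
  · refine ae_of_all _ fun u => ?_
    rw [norm_mul, norm_cexp_I_mul, one_mul]
  · exact ae_of_all _ fun u => by fun_prop

theorem pairing_cexp_eq (χ : ℝ → ℂ) (φ : ℝ → ℝ) (z : ℝ) :
    pairing χ φ (fun u => Complex.exp (-(Complex.I * u * z)))
      = ∫ u : ℝ, Complex.exp (-(Complex.I * z * u)) * (fourier φ u * χ u) := by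
  refine integral_congr_ae (ae_of_all _ fun u => ?_)
  dsimp only
  rw [mul_right_comm Complex.I (u : ℂ) z]
  ring

theorem continuous_pairing_cexp {φ : ℝ → ℝ} (h : Integrable fun u => fourier φ u * χ u) :
    Continuous fun z : ℝ => pairing χ φ (fun u => Complex.exp (-(Complex.I * u * z))) := by
  simp_rw [pairing_cexp_eq]
  refine continuous_of_dominated (bound := fun u => ‖fourier φ u * χ u‖) (fun x => ?_)
    (fun x => ?_) h.norm ?_
  · exact (Continuous.aestronglyMeasurable (by fun_prop)).mul h.aestronglyMeasurable
  · refine ae_of_all _ fun u => ?_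
    rw [norm_mul, norm_cexp_neg_I_mul, one_mul]
  · exact ae_of_all _ fun u => by fun_prop

theorem norm_pairing_cexp_le (χ : ℝ → ℂ) (φ : ℝ → ℝ) (z : ℝ) :
    ‖pairing χ φ (fun u => Complex.exp (-(Complex.I * u * z)))‖ ≤ ∫ u, ‖fourier φ u * χ u‖ := by
  rw [pairing_cexp_eq]
  refine (norm_integral_le_integral_norm _).trans (le_of_eq ?_)
  simp_rw [norm_mul _ (_ * _), norm_cexp_neg_I_mul, one_mul]

variable {Ω : Type*} [MeasurableSpace Ω] {P : Measure Ω} [IsProbabilityMeasure P]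

/-- Averaging of a pairing over the observations. -/
theorem integral_mul_pairing_cexp {c : ℝ → ℝ} {U : Ω → ℝ × ℝ}
    (hU : Measurable U) (hc1 : Integrable (fun ω => c (U ω).1) P) {φ : ℝ → ℝ}
    (h : Integrable fun u => fourier φ u * χ u) :
    ∫ ω, (c (U ω).1 : ℂ) * pairing χ φ (fun u => Complex.exp (-(Complex.I * u * (U ω).2))) ∂P
      = pairing χ φ (fun u => ∫ ω, obs c u (U ω) ∂P) := by
  have hint : Integrable (Function.uncurry fun (ω : Ω) (u : ℝ) =>
      fourier φ u * χ u * obs c u (U ω)) (P.prod volume) := by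
    have h1 : Integrable (fun z : Ω × ℝ => (c (U z.1).1 : ℂ) * (fourier φ z.2 * χ z.2))
        (P.prod volume) := hc1.ofReal.mul_prod h
    refine (h1.mul_bdd (c := 1) (g := fun z : Ω × ℝ =>
      Complex.exp (-(Complex.I * z.2 * (U z.1).2))) ?_ (ae_of_all _ fun z => ?_)).congr
      (ae_of_all _ fun z => ?_)
    · exact Measurable.aestronglyMeasurable (by fun_prop)
    · exact (norm_cexp_neg_I_mul _ _).le
    · simp only [Function.uncurry, obs]
      ring
  have h2 := integral_integral_swap hint
  calc ∫ ω, (c (U ω).1 : ℂ) * pairing χ φ (fun u => Complex.exp (-(Complex.I * u * (U ω).2))) ∂P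
      = ∫ ω, (∫ u, fourier φ u * χ u * obs c u (U ω)) ∂P := by
        refine integral_congr_ae (ae_of_all _ fun ω => ?_)
        dsimp only [pairing]
        rw [← integral_const_mul]
        refine integral_congr_ae (ae_of_all _ fun u => ?_)
        simp only [obs]
        ring
    _ = ∫ u, ∫ ω, fourier φ u * χ u * obs c u (U ω) ∂P := h2
    _ = _ := by
        refine integral_congr_ae (ae_of_all _ fun u => ?_)
        dsimp only
        rw [integral_const_mul]
        ring

end Inversion

/-! ### The two criteria as spectral pairings -/

section Criteria

variable {d : ℕ} {Ω : Type*} [MeasurableSpace Ω] {P : Measure Ω} [IsProbabilityMeasure P]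
  {f : Param d → ℝ → ℝ} {θ₀ : Param d} {g p : ℝ → ℝ} {X ξ ε : ℕ → Ω → ℝ}

/-- The design has a density, so the almost everywhere identities of Fourier inversion hold at `X`.
-/
theorem IsSample.ae_design (h : IsSample P g p X ξ ε) {q : ℝ → Prop} (hq : ∀ᵐ x, q x) :
    ∀ᵐ ω ∂P, q (X 0 ω) := by
  refine ae_of_ae_map (h.measurable_design 0).aemeasurable ?_
  rw [h.law_design 0]
  exact (withDensity_absolutelyContinuous _ _).ae_le hq

theorem IsSample.integrable_mul (h : IsSample P g p X ξ ε) {c : Ω → ℝ} (hc : Integrable c P)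
    {ψ : ℝ → ℝ} (hψm : Measurable ψ) {B : ℝ} (hB : ∀ᵐ x, |ψ x| ≤ B) :
    Integrable (fun ω => c ω * ψ (X 0 ω)) P :=
  hc.mul_bdd (hψm.comp (h.measurable_design 0)).aestronglyMeasurable (h.ae_design hB)

/-- Spectral form of the expectation `E[c(Y) ψ(X)]`. -/
theorem IsSample.integral_mul_eq_pairing (h : IsSample P g p X ξ ε) (hf : Measurable (f θ₀))
    (hp0 : ∀ t, fourier p t ≠ 0) {c : ℝ → ℝ} (hc : Measurable c)
    (hc1 : Integrable (fun ω => c (response f θ₀ X ξ 0 ω)) P) {ψ : ℝ → ℝ} (hψ : Integrable ψ)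
    (hψ' : Integrable (fourier ψ)) :
    ((∫ ω, c (response f θ₀ X ξ 0 ω) * ψ (X 0 ω) ∂P : ℝ) : ℂ)
      = pairing (deconvWeight p) ψ (obsMean P (observations f θ₀ X ξ ε) c) := by
  -- With the constant weight `(2π)⁻¹` the pairing is the inversion formula for `ψ` at `X`. The
  -- factor `p^*(-u)` is then introduced and divided out, which replaces `X` by the observed `Z`.
  have h1 := integral_mul_pairing_cexp (P := P) (χ := fun _ => (2 * Real.pi : ℂ)⁻¹)
    (U := fun ω => (response f θ₀ X ξ 0 ω, X 0 ω))
    ((h.measurable_response hf 0).prodMk (h.measurable_design 0)) hc1 (hψ'.mul_const _)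
  rw [← integral_complex_ofReal]
  calc ∫ ω, ((c (response f θ₀ X ξ 0 ω) * ψ (X 0 ω) : ℝ) : ℂ) ∂P
      = ∫ ω, (c (response f θ₀ X ξ 0 ω) : ℂ) * pairing (fun _ => (2 * Real.pi : ℂ)⁻¹) ψ
          (fun u => Complex.exp (-(Complex.I * u * X 0 ω))) ∂P := by
        refine integral_congr_ae ?_
        filter_upwards [h.ae_design (ae_eq_invFourier hψ hψ')] with ω hω
        rw [Complex.ofReal_mul, hω, pairing_cexp_eq, invFourier, ← integral_const_mul]
        congr 2
        funext u
        ring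
    _ = _ := h1
    _ = _ := by
        refine integral_congr_ae (ae_of_all _ fun u => ?_)
        dsimp only
        rw [h.obsMean_eq hf hc, deconvWeight]
        have := hp0 (-u)
        field_simp

/-- `1 / p^*` may be unbounded, but it is continuous, and `K^*` cuts it off to a compact set. -/
theorem IsKernelTransform.integrable_deconv {κ : ℝ → ℂ} (h : IsKernelTransform κ)
    (hχ : Continuous (deconvWeight p)) {C : ℝ} (hC : 0 < C) (z : ℝ) :
    Integrable fun u : ℝ => deconvWeight p u * (κ (-u / C) * Complex.exp (-(Complex.I * u * z))) := by
  obtain ⟨R, hR⟩ := h.compactSupport.isCompact.isBounded.exists_norm_le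
  have hbdd : IsBddMeas fun u : ℝ => κ (-u / C) := by
    refine ⟨h.measurable.comp (by fun_prop), 2, fun u => ?_⟩
    have h1 : ‖1 - κ (-u / C)‖ ≤ 1 := (h.bound _).trans (Set.indicator_le_self' (by simp) _)
    calc ‖κ (-u / C)‖ = ‖1 - (1 - κ (-u / C))‖ := by rw [sub_sub_cancel]
      _ ≤ ‖(1 : ℂ)‖ + ‖1 - κ (-u / C)‖ := norm_sub_le _ _
      _ ≤ 2 := by rw [norm_one]; linarith
  obtain ⟨hm, b, hb⟩ := hbdd.mul (.cexp z)
  have hon : IntegrableOn (fun u : ℝ => deconvWeight p u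
      * (κ (-u / C) * Complex.exp (-(Complex.I * u * z)))) (Set.Icc (-(R * C)) (R * C)) :=
    (hχ.continuousOn.integrableOn_compact isCompact_Icc).mul_bdd hm.aestronglyMeasurable
      (ae_of_all _ hb)
  refine (integrableOn_iff_integrable_of_support_subset fun u hu => ?_).1 hon
  have hk : κ (-u / C) ≠ 0 := fun h0 => hu (by simp [h0])
  have h2 := hR _ (subset_tsupport _ hk)
  rw [Real.norm_eq_abs, abs_div, abs_neg, abs_of_pos hC, div_le_iff₀ hC] at h2
  exact abs_le.1 h2

/-- The substitution `u ↦ -u` in the kernel is the origin of the arguments `-u` in the multiplier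
and in `deconvWeight`. -/
theorem deconvKernel_eq (κ : ℝ → ℂ) (p : ℝ → ℝ) (C x z : ℝ) :
    deconvKernel κ p C (x - z) = (cfourier (fun u : ℝ => deconvWeight p u
      * (κ (-u / C) * Complex.exp (-(Complex.I * u * z)))) x).re := by
  rw [deconvKernel, cfourier, ← integral_const_mul]
  rw [← integral_neg_eq_self]
  congr 2
  funext u
  rw [deconvWeight]
  have e : Complex.exp (-(Complex.I * ((-u : ℝ) : ℂ) * ((x - z : ℝ) : ℂ)))
      = Complex.exp (Complex.I * u * x) * Complex.exp (-(Complex.I * u * z)) := by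
    rw [← Complex.exp_add]
    congr 1
    push_cast
    ring
  rw [e]
  ring

/-- Spectral form of the smoothed criterion. -/
theorem IsKernelTransform.integral_mul_deconvKernel {κ : ℝ → ℂ} (h : IsKernelTransform κ)
    (hχ : Continuous (deconvWeight p)) {C : ℝ} (hC : 0 < C) (z : ℝ) {φ : ℝ → ℝ}
    (hφ : Integrable φ) :
    Integrable (fun x => φ x * deconvKernel κ p C (x - z)) ∧
    ∫ x, φ x * deconvKernel κ p C (x - z) = (pairing (deconvWeight p) φ
      (fun u => κ (-u / C) * Complex.exp (-(Complex.I * u * z)))).re := by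
  have hη := h.integrable_deconv hχ hC z
  have hint : Integrable fun x => (φ x : ℂ) * cfourier (fun u : ℝ => deconvWeight p u
      * (κ (-u / C) * Complex.exp (-(Complex.I * u * z)))) x :=
    hφ.ofReal.mul_bdd (continuous_cfourier hη).aestronglyMeasurable
      (ae_of_all _ (norm_cfourier_le _))
  have e : (fun x => φ x * deconvKernel κ p C (x - z)) = fun x => ((φ x : ℂ) *
      cfourier (fun u : ℝ => deconvWeight p u
        * (κ (-u / C) * Complex.exp (-(Complex.I * u * z)))) x).re := by
    funext x
    rw [Complex.re_ofReal_mul, deconvKernel_eq]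
  rw [e]
  refine ⟨hint.re, ?_⟩
  rw [pairing, integral_fourier_mul hφ hη]
  exact integral_re hint

end Criteria

end EIV

namespace EIV

set_option linter.unusedSectionVars false

open SpectralWeight (pairingDev)
open SpectralFamily (taylorRem)

/-! ### Criteria built from several spectral families -/

/-- Finitely many spectral families `ψ k` with a common weight `χ`, and i.i.d. observations whose
first components have square integrable images under the coefficients `c k`. -/
structure SpectralModel {d : ℕ} {Ω : Type*} [MeasurableSpace Ω] (P : Measure Ω) {ι : Type*}
    (Θ : Set (Param d)) (ψ : ι → Param d → ℝ → ℝ) (G H : ι → ℝ → ℝ≥0∞) (χ : ℝ → ℂ)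
    (W : ℕ → Ω → ℝ × ℝ) (c : ι → ℝ → ℝ) : Prop where
  family : ∀ k, SpectralFamily Θ (ψ k) (G k)
  weight : ∀ k, SpectralWeight Θ (ψ k) (G k) χ (H k)
  measurable_obs : ∀ i, Measurable (W i)
  indep : iIndepFun W P
  ident : ∀ i, IdentDistrib (W i) (W 0) P P
  measurable_coef : ∀ k, Measurable (c k)
  memLp_coef : ∀ k, MemLp (fun ω => c k (W 0 ω).1) 2 P

section

variable {d : ℕ} {Ω : Type*} [MeasurableSpace Ω] {ι : Type*} [Fintype ι]

/-- The spectral form of the theoretical criterion. -/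
noncomputable def spectralCrit (P : Measure Ω) (ψ : ι → Param d → ℝ → ℝ) (χ : ℝ → ℂ)
    (W : ℕ → Ω → ℝ × ℝ) (c : ι → ℝ → ℝ) (θ : Param d) : ℝ :=
  (∑ i, pairing χ (ψ i θ) (obsMean P W (c i))).re

/-- The spectral form of the smoothed empirical criterion. -/
noncomputable def spectralCritEmp (ψ : ι → Param d → ℝ → ℝ) (χ : ℝ → ℂ)
    (W : ℕ → Ω → ℝ × ℝ) (c : ι → ℝ → ℝ) (k : ℕ → ℝ → ℂ) (n : ℕ) (ω : Ω) (θ : Param d) : ℝ :=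
  (∑ i, pairing χ (ψ i θ) (fun u => k n u * obsEmp W (c i) n ω u)).re

/-- The spectral form of the gradient of the unsmoothed empirical criterion for one observation. -/
noncomputable def spectralScore (ψ : ι → Param d → ℝ → ℝ) (χ : ℝ → ℂ) (c : ι → ℝ → ℝ)
    (θ₀ : Param d) (j : Fin d) (x : ℝ × ℝ) : ℝ :=
  (∑ i, (c i x.1 : ℂ) * pairing χ (pderiv j (ψ i) θ₀)
    (fun u => Complex.exp (-(Complex.I * u * x.2)))).re

end

theorem enorm_re_le (z : ℂ) : ‖z.re‖ₑ ≤ ‖z‖ₑ := by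
  rw [← ofReal_norm, ← ofReal_norm, Real.norm_eq_abs]
  exact ENNReal.ofReal_le_ofReal (Complex.abs_re_le_norm z)

theorem enorm_re_sum_le {ι : Type*} (s : Finset ι) (z : ι → ℂ) :
    ‖(∑ i ∈ s, z i).re‖ₑ ≤ ∑ i ∈ s, ‖z i‖ₑ :=
  (enorm_re_le _).trans (enorm_sum_le _ _)

theorem lintegral_sq_ne_top_of_memLp {Ω : Type*} [MeasurableSpace Ω] {P : Measure Ω} {X : Ω → ℝ}
    (h : MemLp X 2 P) : ∫⁻ ω, ‖X ω‖ₑ ^ 2 ∂P ≠ ∞ := by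
  have h2 := h.2
  rw [eLpNorm_lt_top_iff_lintegral_rpow_enorm_lt_top (by simp) (by simp)] at h2
  simpa using h2.ne

theorem lintegral_sq_sum_le {Ω : Type*} [MeasurableSpace Ω] {P : Measure Ω} {ι : Type*} [Fintype ι]
    {M : ι → Ω → ℝ≥0∞} (hM : ∀ i, Measurable (M i)) {A : ι → ℝ≥0∞} {n : ℕ}
    (h : ∀ i, ∫⁻ ω, M i ω ^ 2 ∂P ≤ A i / n) :
    ∫⁻ ω, (∑ i, M i ω) ^ 2 ∂P ≤ (Fintype.card ι * ∑ i, A i) / n := by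
  calc ∫⁻ ω, (∑ i, M i ω) ^ 2 ∂P ≤ ∫⁻ ω, Fintype.card ι * ∑ i, M i ω ^ 2 ∂P :=
        lintegral_mono fun ω => sq_sum_le_card_mul fun i => M i ω
    _ = Fintype.card ι * ∑ i, ∫⁻ ω, M i ω ^ 2 ∂P := by
        rw [lintegral_const_mul' _ _ (by simp), lintegral_finsetSum _ fun i _ => (hM i).pow_const 2]
    _ ≤ Fintype.card ι * ∑ i, A i / n := by gcongr with i; exact h i
    _ = _ := by simp only [div_eq_mul_inv, ← Finset.sum_mul, mul_assoc]

namespace SpectralModel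

variable {d : ℕ} {Ω : Type*} [MeasurableSpace Ω] {P : Measure Ω} [IsProbabilityMeasure P]
  {ι : Type*} [Fintype ι] {Θ : Set (Param d)} {ψ : ι → Param d → ℝ → ℝ} {G H : ι → ℝ → ℝ≥0∞}
  {χ : ℝ → ℂ} {W : ℕ → Ω → ℝ × ℝ} {c : ι → ℝ → ℝ} {θ₀ : Param d} {k : ℕ → ℝ → ℂ} {C : ℕ → ℝ}

theorem lintegral_coef (h : SpectralModel P Θ ψ G H χ W c) (i : ι) :
    ∫⁻ ω, ‖c i (W 0 ω).1‖ₑ ^ 2 ∂P ≠ ∞ :=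
  lintegral_sq_ne_top_of_memLp (h.memLp_coef i)

theorem critEmp_sub_crit (P : Measure Ω) (ψ : ι → Param d → ℝ → ℝ) (χ : ℝ → ℂ)
    (W : ℕ → Ω → ℝ × ℝ) (c : ι → ℝ → ℝ) (k : ℕ → ℝ → ℂ) (n : ℕ) (ω : Ω) (θ : Param d) :
    spectralCritEmp ψ χ W c k n ω θ - spectralCrit P ψ χ W c θ
      = (∑ i, pairingDev P W χ (ψ i) (c i) k n ω θ).re := by
  rw [spectralCritEmp, spectralCrit, ← Complex.sub_re, ← Finset.sum_sub_distrib]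
  rfl

theorem exists_uniform_bound (h : SpectralModel P Θ ψ G H χ W c) (hk : IsSmoothing k C) :
    ∃ M : ℕ → Ω → ℝ≥0∞, ∃ β : ℕ → ℝ≥0∞, ∃ A : ℝ≥0∞, A ≠ ∞ ∧ (∀ n, Measurable (M n)) ∧
      (∀ n, 1 ≤ n → ∫⁻ ω, M n ω ^ 2 ∂P ≤ A / n) ∧ Tendsto β atTop (𝓝 0) ∧
      ∀ n ω, ∀ θ ∈ Θ, ‖spectralCritEmp ψ χ W c k n ω θ - spectralCrit P ψ χ W c θ‖ₑ
        ≤ M n ω + β n := by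
  choose M β A hA hMm hM hβ hle using fun i => (h.weight i).exists_pairingDev_le (h.family i)
    h.measurable_obs h.indep h.ident (h.measurable_coef i) (h.lintegral_coef i) hk
  refine ⟨fun n ω => ∑ i, M i n ω, fun n => ∑ i, β i n, Fintype.card ι * ∑ i, A i,
    ENNReal.mul_ne_top (by simp) (ENNReal.sum_ne_top.2 fun i _ => hA i),
    fun n => Finset.measurable_fun_sum _ fun i _ => hMm i n,
    fun n hn => lintegral_sq_sum_le (fun i => hMm i n) fun i => hM i n hn, ?_, fun n ω θ hθ => ?_⟩
  · simpa using tendsto_finsetSum Finset.univ fun i _ => hβ i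
  · rw [critEmp_sub_crit, ← Finset.sum_add_distrib]
    exact (enorm_re_sum_le _ _).trans (Finset.sum_le_sum fun i _ => hle i n ω θ hθ)

theorem exists_lipschitz_bound (h : SpectralModel P Θ ψ G H χ W c) (hk : IsSmoothing k C)
    (hbias : ∀ i, Tendsto (fun n : ℕ => ENNReal.ofReal (Real.sqrt n) *
      ∫⁻ u, G i u * ‖χ u‖ₑ * (‖k n u - 1‖ₑ * ‖obsMean P W (c i) u‖ₑ)) atTop (𝓝 0)) {ρ : ℝ}
    (hρ : Metric.ball θ₀ ρ ⊆ interior Θ) :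
    ∃ L : ℕ → Ω → ℝ≥0∞, ∃ A : ℝ≥0∞, A ≠ ∞ ∧
      (∀ n, 1 ≤ n → ∫⁻ ω, L n ω ^ 2 ∂P ≤ A / n) ∧
      ∀ n ω, ∀ θ ∈ Metric.ball θ₀ ρ,
        ‖(spectralCritEmp ψ χ W c k n ω θ - spectralCrit P ψ χ W c θ)
          - (spectralCritEmp ψ χ W c k n ω θ₀ - spectralCrit P ψ χ W c θ₀)‖ₑ
          ≤ L n ω * ‖θ - θ₀‖ₑ := by
  choose L A hA hLm hL hle using fun i => (h.weight i).exists_pairingDev_sub_le (h.family i)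
    h.measurable_obs h.indep h.ident (h.measurable_coef i) (h.lintegral_coef i) hk (hbias i) hρ
  refine ⟨fun n ω => ∑ i, L i n ω, Fintype.card ι * ∑ i, A i,
    ENNReal.mul_ne_top (by simp) (ENNReal.sum_ne_top.2 fun i _ => hA i),
    fun n hn => lintegral_sq_sum_le (fun i => hLm i n) fun i => hL i n hn, fun n ω θ hθ => ?_⟩
  rw [critEmp_sub_crit, critEmp_sub_crit, ← Complex.sub_re, ← Finset.sum_sub_distrib,
    Finset.sum_mul]
  exact (enorm_re_sum_le _ _).trans (Finset.sum_le_sum fun i _ => hle i n ω θ hθ)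

/-! #### The score -/

theorem integrable_fourier_pderiv_mul (h : SpectralModel P Θ ψ G H χ W c)
    (hθ₀ : θ₀ ∈ interior Θ) (i : ι) (j : Fin d) :
    Integrable fun u => fourier (pderiv j (ψ i) θ₀) u * χ u := by
  have := (h.weight i).integrable_pderiv (h.family i) hθ₀ j (IsBddMeas.const 1)
  simpa only [mul_one] using this

theorem measurable_score (h : SpectralModel P Θ ψ G H χ W c) (hθ₀ : θ₀ ∈ interior Θ) (j : Fin d) :
    Measurable (spectralScore ψ χ c θ₀ j) :=
  Complex.measurable_re.comp (Finset.measurable_fun_sum _ fun i _ =>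
    (Complex.measurable_ofReal.comp ((h.measurable_coef i).comp measurable_fst)).mul
      ((continuous_pairing_cexp
        (h.integrable_fourier_pderiv_mul hθ₀ i j)).measurable.comp measurable_snd))

theorem memLp_score (h : SpectralModel P Θ ψ G H χ W c) (hθ₀ : θ₀ ∈ interior Θ) (j : Fin d) :
    MemLp (fun ω => spectralScore ψ χ c θ₀ j (W 0 ω)) 2 P := by
  have h1 : ∀ i, MemLp (fun ω => (c i (W 0 ω).1 : ℂ) * pairing χ (pderiv j (ψ i) θ₀)
      (fun u => Complex.exp (-(Complex.I * u * (W 0 ω).2)))) 2 P := fun i => by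
    have hm : Measurable fun ω => pairing χ (pderiv j (ψ i) θ₀)
        (fun u => Complex.exp (-(Complex.I * u * (W 0 ω).2))) :=
      (continuous_pairing_cexp (h.integrable_fourier_pderiv_mul hθ₀ i j)).measurable.comp
        (measurable_snd.comp (h.measurable_obs 0))
    refine (h.memLp_coef i).of_le_mul (c := ∫ u, ‖fourier (pderiv j (ψ i) θ₀) u * χ u‖)
      ((Complex.measurable_ofReal.comp ((h.measurable_coef i).comp
        (measurable_fst.comp (h.measurable_obs 0)))).mul hm).aestronglyMeasurable
      (ae_of_all _ fun ω => ?_)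
    rw [norm_mul, Complex.norm_real, mul_comm]
    gcongr
    exact norm_pairing_cexp_le _ _ _
  exact (memLp_finsetSum _ fun i _ => h1 i).re

theorem integral_score (h : SpectralModel P Θ ψ G H χ W c) (hθ₀ : θ₀ ∈ interior Θ) (j : Fin d) :
    ∫ ω, spectralScore ψ χ c θ₀ j (W 0 ω) ∂P
      = (∑ i, pairing χ (pderiv j (ψ i) θ₀) (obsMean P W (c i))).re := by
  have hi := fun i => h.integrable_fourier_pderiv_mul hθ₀ i j
  have hc1 : ∀ i, Integrable (fun ω => c i (W 0 ω).1) P := fun i =>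
    (h.memLp_coef i).integrable (by simp)
  have h1 : ∀ i, Integrable (fun ω => (c i (W 0 ω).1 : ℂ) * pairing χ (pderiv j (ψ i) θ₀)
      (fun u => Complex.exp (-(Complex.I * u * (W 0 ω).2)))) P := fun i =>
    (hc1 i).ofReal.mul_bdd ((continuous_pairing_cexp (hi i)).measurable.comp
        (measurable_snd.comp (h.measurable_obs 0))).aestronglyMeasurable
      (ae_of_all _ fun ω => norm_pairing_cexp_le _ _ _)
  have h2 := integral_re (integrable_finsetSum Finset.univ fun i _ => h1 i)
  rw [integral_finsetSum _ fun i _ => h1 i] at h2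
  simp only [integral_mul_pairing_cexp (h.measurable_obs 0) (hc1 _)
    (hi _)] at h2
  exact h2

theorem mean_score (h : SpectralModel P Θ ψ G H χ W c) (hθ₀ : θ₀ ∈ interior Θ) (j : Fin d) (n : ℕ)
    (ω : Ω) :
    (n : ℝ)⁻¹ * ∑ l ∈ Finset.range n, spectralScore ψ χ c θ₀ j (W l ω)
      = (∑ i, pairing χ (pderiv j (ψ i) θ₀) (obsEmp W (c i) n ω)).re := by
  have h1 : ∀ i, pairing χ (pderiv j (ψ i) θ₀) (obsEmp W (c i) n ω)
      = (n : ℂ)⁻¹ * ∑ l ∈ Finset.range n, (c i (W l ω).1 : ℂ) * pairing χ (pderiv j (ψ i) θ₀)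
        (fun u => Complex.exp (-(Complex.I * u * (W l ω).2))) := fun i => by
    simp only [pairing, ← integral_const_mul]
    rw [← integral_finsetSum _ fun l _ => ((h.weight i).integrable_pderiv (h.family i) hθ₀ j
      (IsBddMeas.cexp (W l ω).2)).const_mul _, ← integral_const_mul]
    refine integral_congr_ae (ae_of_all _ fun u => ?_)
    simp only [obsEmp, obs, Finset.mul_sum]
    refine Finset.sum_congr rfl fun l _ => ?_
    ring
  simp only [h1, spectralScore]
  rw [← Finset.mul_sum, Finset.sum_comm, ← Complex.re_sum, ← Complex.ofReal_natCast,
    ← Complex.ofReal_inv, Complex.re_ofReal_mul]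

/-- Identifies the linear term of the expansion as the centred empirical mean of the score. No
smoothing is left in it, so its law is independent of the bandwidth. -/
theorem re_sum_pairing_empDev (h : SpectralModel P Θ ψ G H χ W c) (hθ₀ : θ₀ ∈ interior Θ)
    (j : Fin d) (n : ℕ) (ω : Ω) :
    (∑ i, pairing χ (pderiv j (ψ i) θ₀) (fun u => empDev P W (obs (c i) u) n ω)).re
      = (n : ℝ)⁻¹ * ∑ l ∈ Finset.range n, spectralScore ψ χ c θ₀ j (W l ω)
        - ∫ ω, spectralScore ψ χ c θ₀ j (W 0 ω) ∂P := by
  rw [h.mean_score hθ₀, h.integral_score hθ₀, ← Complex.sub_re, ← Finset.sum_sub_distrib]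
  congr 2
  funext i
  have hφ := isBddMeas_obsMean (P := P) h.measurable_obs (h.measurable_coef i)
  have hΔ := isBddMeas_empDev_obs (P := P) h.measurable_obs (h.measurable_coef i) n ω
  have he : IsBddMeas (obsEmp W (c i) n ω) := by
    rw [show obsEmp W (c i) n ω = fun u => obsMean P W (c i) u + empDev P W (obs (c i) u) n ω from
      funext fun u => obsEmp_eq P W (c i) n ω u]
    exact hφ.add hΔ
  rw [pairing, pairing, pairing, ← integral_sub
    ((h.weight i).integrable_pderiv (h.family i) hθ₀ j he)
    ((h.weight i).integrable_pderiv (h.family i) hθ₀ j hφ)]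
  refine integral_congr_ae (ae_of_all _ fun u => ?_)
  dsimp only
  rw [obsEmp_eq P]
  ring

theorem exists_remainder_bound (h : SpectralModel P Θ ψ G H χ W c) (hk : IsSmoothing k C)
    (hθ₀ : θ₀ ∈ interior Θ)
    (hbias : ∀ i, Tendsto (fun n : ℕ => ENNReal.ofReal (Real.sqrt n) *
      ∫⁻ u, G i u * ‖χ u‖ₑ * (‖k n u - 1‖ₑ * ‖obsMean P W (c i) u‖ₑ)) atTop (𝓝 0)) {ε : ℝ}
    (hε : 0 < ε) :
    ∃ ρ > 0, ∃ N : ℕ, ∀ n ≥ N, ∃ R : Ω → ℝ≥0∞, AEMeasurable R P ∧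
      ∫⁻ ω, R ω ∂P ≤ ENNReal.ofReal (ε / Real.sqrt n) ∧
      ∀ ω, ∀ θ ∈ Metric.ball θ₀ ρ,
        ‖(spectralCritEmp ψ χ W c k n ω θ - spectralCrit P ψ χ W c θ)
          - (spectralCritEmp ψ χ W c k n ω θ₀ - spectralCrit P ψ χ W c θ₀)
          - ∑ j, (θ - θ₀) j * ((n : ℝ)⁻¹ * ∑ l ∈ Finset.range n, spectralScore ψ χ c θ₀ j (W l ω)
            - ∫ ω, spectralScore ψ χ c θ₀ j (W 0 ω) ∂P)‖ₑ ≤ R ω * ‖θ - θ₀‖ₑ := by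
  -- An equal share for each family; the `+ 1` also covers an empty index type.
  set ε' : ℝ := ε / (Fintype.card ι + 1) with hε'
  have hε'0 : 0 < ε' := by positivity
  choose ρ hρ N hN using fun i => (h.weight i).exists_pairingDev_taylor_le (h.family i)
    h.measurable_obs h.indep h.ident (h.measurable_coef i) (h.lintegral_coef i) hk hθ₀ (hbias i)
    hε'0
  obtain ⟨ρ₀, hρ₀, hρle⟩ : ∃ ρ₀ > 0, ∀ i, ρ₀ ≤ ρ i := by
    have h1 : ∀ᶠ r in 𝓝[>] (0 : ℝ), ∀ i, r ≤ ρ i := by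
      rw [eventually_all]
      exact fun i => (eventually_le_nhds (hρ i)).filter_mono nhdsWithin_le_nhds
    obtain ⟨r, hr, hr0⟩ := (h1.and self_mem_nhdsWithin).exists
    exact ⟨r, hr0, hr⟩
  -- The `+ 1` ensures `n > 0`, hence `√n > 0` in the division.
  refine ⟨ρ₀, hρ₀, (Finset.univ.sup N) + 1, fun n hn => ?_⟩
  have hNn : ∀ i, n ≥ N i := fun i => by
    have := Finset.le_sup (f := N) (Finset.mem_univ i)
    omega
  choose R hRm hR hle using fun i => hN i n (hNn i)
  have hs : 0 < Real.sqrt n := Real.sqrt_pos.2 (by exact_mod_cast (by omega : 0 < n))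
  refine ⟨fun ω => ∑ i, R i ω, (Finset.measurable_fun_sum _ fun i _ => hRm i).aemeasurable, ?_,
    fun ω θ hθ => ?_⟩
  · rw [lintegral_finsetSum _ fun i _ => hRm i]
    refine (Finset.sum_le_sum fun i _ => hR i).trans ?_
    rw [Finset.sum_const, Finset.card_univ, ← ENNReal.ofReal_div_of_pos hs, nsmul_eq_mul,
      ← ENNReal.ofReal_natCast, ← ENNReal.ofReal_mul (by positivity)]
    refine ENNReal.ofReal_le_ofReal ?_
    rw [hε', ← mul_div_assoc, ← mul_div_assoc]
    gcongr
    rw [div_le_iff₀ (by positivity)]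
    nlinarith
  · have e : (spectralCritEmp ψ χ W c k n ω θ - spectralCrit P ψ χ W c θ)
          - (spectralCritEmp ψ χ W c k n ω θ₀ - spectralCrit P ψ χ W c θ₀)
          - ∑ j, (θ - θ₀) j * ((n : ℝ)⁻¹ * ∑ l ∈ Finset.range n, spectralScore ψ χ c θ₀ j (W l ω)
            - ∫ ω, spectralScore ψ χ c θ₀ j (W 0 ω) ∂P)
        = (∑ i, (pairingDev P W χ (ψ i) (c i) k n ω θ - pairingDev P W χ (ψ i) (c i) k n ω θ₀
          - ∑ j, ((θ - θ₀) j : ℂ) * pairing χ (pderiv j (ψ i) θ₀)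
            (fun u => empDev P W (obs (c i) u) n ω))).re := by
      simp only [← h.re_sum_pairing_empDev hθ₀]
      rw [critEmp_sub_crit, critEmp_sub_crit, Finset.sum_sub_distrib, Finset.sum_sub_distrib,
        Complex.sub_re, Complex.sub_re, Finset.sum_comm]
      congr 1
      rw [Complex.re_sum]
      refine Finset.sum_congr rfl fun j _ => ?_
      rw [← Finset.mul_sum, Complex.re_ofReal_mul]
    rw [e, Finset.sum_mul]
    exact (enorm_re_sum_le _ _).trans (Finset.sum_le_sum fun i _ => hle i ω θ
      (Metric.ball_subset_ball (hρle i) hθ))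

/-! #### The gradient of the theoretical criterion -/

/-- The weak expansion applied with the fixed function `obsMean` shows that the gradient of the
criterion is the mean of the score. At an interior minimum this gives the centring needed for the
central limit theorem. -/
theorem hasFDerivAt_crit (h : SpectralModel P Θ ψ G H χ W c) (hθ₀ : θ₀ ∈ interior Θ) :
    HasFDerivAt (spectralCrit P ψ χ W c) (∑ j, (∫ ω, spectralScore ψ χ c θ₀ j (W 0 ω) ∂P) •
      (EuclideanSpace.proj j : Param d →L[ℝ] ℝ)) θ₀ := by
  rw [hasFDerivAt_iff_isLittleO]
  have key : ∀ i, (fun θ => ∫ u, taylorRem (ψ i) θ₀ θ u * (χ u * obsMean P W (c i) u))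
      =o[𝓝 θ₀] fun θ => θ - θ₀ := fun i => by
    rw [Asymptotics.isLittleO_iff]
    intro ε hε
    obtain ⟨ρ, hρ, -, hle⟩ := (h.weight i).exists_norm_integral_taylorRem_le (h.family i) hθ₀
      (isBddMeas_obsMean (P := P) h.measurable_obs (h.measurable_coef i)) hε
    exact Metric.eventually_nhds_iff_ball.2 ⟨ρ, hρ, hle⟩
  have hsum : (fun θ => ∑ i, ∫ u, taylorRem (ψ i) θ₀ θ u * (χ u * obsMean P W (c i) u))
      =o[𝓝 θ₀] fun θ => θ - θ₀ := by
    simpa only [Finset.sum_fn] using Asymptotics.IsLittleO.sum (s := Finset.univ) fun i _ => key i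
  refine (Asymptotics.IsBigO.trans_isLittleO ?_ hsum)
  refine Asymptotics.IsBigO.of_bound 1 ?_
  filter_upwards [isOpen_interior.mem_nhds hθ₀] with θ hθ
  rw [one_mul]
  have e : spectralCrit P ψ χ W c θ - spectralCrit P ψ χ W c θ₀
      - (∑ j, (∫ ω, spectralScore ψ χ c θ₀ j (W 0 ω) ∂P) •
        (EuclideanSpace.proj j : Param d →L[ℝ] ℝ)) (θ - θ₀)
      = (∑ i, ∫ u, taylorRem (ψ i) θ₀ θ u * (χ u * obsMean P W (c i) u)).re := by
    simp only [(h.weight _).integral_taylorRem (h.family _) hθ₀ (interior_subset hθ)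
      (isBddMeas_obsMean (P := P) h.measurable_obs (h.measurable_coef _))]
    rw [Finset.sum_sub_distrib, Finset.sum_sub_distrib, Complex.sub_re, Complex.sub_re,
      Finset.sum_comm, spectralCrit, spectralCrit]
    congr 1
    simp only [sum_apply, smul_apply, smul_eq_mul, h.integral_score hθ₀]
    rw [Complex.re_sum]
    refine Finset.sum_congr rfl fun j _ => ?_
    rw [← Finset.mul_sum, Complex.re_ofReal_mul, mul_comm]
    rfl
  rw [e]
  exact Complex.abs_re_le_norm _

end SpectralModel

end EIV

namespace EIV

set_option linter.unusedSectionVars false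

/-! ### Consistency and asymptotic normality for spectral models -/

theorem bilin_apply_eq_sum {d : ℕ} (B : Param d →L[ℝ] Param d →L[ℝ] ℝ) (v w : Param d) :
    B v w = ∑ i, ∑ j, v i * (w j * B (EuclideanSpace.single i 1) (EuclideanSpace.single j 1)) := by
  rw [fderiv_apply_eq_sum B v]
  simp only [sum_apply, smul_apply, smul_eq_mul]
  refine Finset.sum_congr rfl fun i _ => ?_
  rw [fderiv_apply_eq_sum (B (EuclideanSpace.single i 1)) w, Finset.mul_sum]
  rfl

theorem sqrtConsistent_of_lintegral {d : ℕ} {Ω : Type*} [MeasurableSpace Ω] {P : Measure Ω}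
    [IsProbabilityMeasure P] {θ₀ : Param d} {θhat : ℕ → Ω → Param d}
    (hm : ∀ n, AEMeasurable (θhat n) P) {C : ℝ≥0∞} (hC : C ≠ ∞)
    (h : ∀ n : ℕ, 1 ≤ n → ∫⁻ ω, ‖θhat n ω - θ₀‖ₑ ^ 2 ∂P ≤ C / n) : SqrtConsistent P θ₀ θhat := by
  have hm' : ∀ n, AEMeasurable (fun ω => θhat n ω - θ₀) P := fun n => (hm n).sub_const _
  refine ⟨⟨C.toReal, fun n hn => ?_⟩, fun δ hδ => ?_⟩
  · have hn0 : (n : ℝ≥0∞) ≠ 0 := by exact_mod_cast (by omega : n ≠ 0)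
    rw [integral_eq_lintegral_of_nonneg_ae (ae_of_all _ fun ω => by positivity)
      ((hm' n).norm.pow_const 2).aestronglyMeasurable]
    have e : ∀ ω, ENNReal.ofReal (‖θhat n ω - θ₀‖ ^ 2) = ‖θhat n ω - θ₀‖ₑ ^ 2 := fun ω => by
      rw [ENNReal.ofReal_pow (norm_nonneg _), ofReal_norm]
    simp only [e]
    have := ENNReal.toReal_mono (ENNReal.div_ne_top hC hn0) (h n hn)
    rwa [ENNReal.toReal_div, ENNReal.toReal_natCast] at this
  · set K : ℝ := 1 + C.toReal / δ with hK
    have hK1 : 1 ≤ K := by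
      have : 0 ≤ C.toReal / δ := by positivity
      linarith
    refine ⟨K, fun n => ?_⟩
    -- Boundedness in probability includes `n = 0`, where the scaled error is `0 < K`.
    rcases Nat.eq_zero_or_pos n with rfl | hn
    · have : {ω | K < Real.sqrt (0 : ℕ) * ‖θhat 0 ω - θ₀‖} = ∅ := by
        ext ω
        simp only [Nat.cast_zero, Real.sqrt_zero, zero_mul, Set.mem_ofPred_eq,
          Set.mem_empty_iff_false, iff_false, not_lt]
        linarith
      rw [this, measure_empty]
      exact zero_le
    · refine (measure_mono fun ω hω => ?_).trans ((meas_norm_ge_le (hm' n).enorm hn (h n hn)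
        (by linarith : 0 < K)).trans ?_)
      · simp only [Set.mem_ofPred_eq] at hω ⊢
        exact hω.le
      · rw [← ENNReal.ofReal_toReal hC, ← ENNReal.ofReal_div_of_pos (by positivity)]
        refine ENNReal.ofReal_le_ofReal ?_
        rw [div_le_iff₀ (by positivity)]
        have h1 : C.toReal / δ ≤ K ^ 2 := by nlinarith
        rw [div_le_iff₀ hδ] at h1
        linarith

namespace SpectralModel

variable {d : ℕ} {Ω : Type*} [MeasurableSpace Ω] {P : Measure Ω} [IsProbabilityMeasure P]
  {ι : Type*} [Fintype ι] {Θ : Set (Param d)} {ψ : ι → Param d → ℝ → ℝ} {G H : ι → ℝ → ℝ≥0∞}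
  {χ : ℝ → ℂ} {W : ℕ → Ω → ℝ × ℝ} {c : ι → ℝ → ℝ} {θ₀ : Param d} {k : ℕ → ℝ → ℂ} {C : ℕ → ℝ}

theorem integral_score_eq_zero (h : SpectralModel P Θ ψ G H χ W c) (hθ₀ : θ₀ ∈ interior Θ)
    (hmin : IsLocalMin (spectralCrit P ψ χ W c) θ₀) (j : Fin d) :
    ∫ ω, spectralScore ψ χ c θ₀ j (W 0 ω) ∂P = 0 := by
  have h1 := hmin.hasFDerivAt_eq_zero (h.hasFDerivAt_crit hθ₀)
  have h2 := congrArg (fun L : Param d →L[ℝ] ℝ => L (EuclideanSpace.single j 1)) h1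
  simpa [sum_apply, smul_apply, Finset.sum_ite_eq] using h2

/-- The influence function `-J⁻¹ V`. -/
noncomputable def influence (ψ : ι → Param d → ℝ → ℝ) (χ : ℝ → ℂ) (c : ι → ℝ → ℝ)
    (θ₀ : Param d) (J : Matrix (Fin d) (Fin d) ℝ) (x : ℝ × ℝ) : Param d :=
  WithLp.toLp 2 fun i => -∑ j, J⁻¹ i j * spectralScore ψ χ c θ₀ j x

theorem influence_apply (ψ : ι → Param d → ℝ → ℝ) (χ : ℝ → ℂ) (c : ι → ℝ → ℝ)
    (θ₀ : Param d) (J : Matrix (Fin d) (Fin d) ℝ) (x : ℝ × ℝ) (i : Fin d) :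
    influence ψ χ c θ₀ J x i = -∑ j, J⁻¹ i j * spectralScore ψ χ c θ₀ j x := rfl

variable {J : Matrix (Fin d) (Fin d) ℝ}

theorem measurable_influence (h : SpectralModel P Θ ψ G H χ W c) (hθ₀ : θ₀ ∈ interior Θ) :
    Measurable (influence ψ χ c θ₀ J) := by
  refine (WithLp.measurable_toLp 2 (Fin d → ℝ)).comp (measurable_pi_lambda _ fun i => ?_)
  exact (Finset.measurable_fun_sum _ fun j _ => (h.measurable_score hθ₀ j).const_mul _).neg

theorem memLp_influence (h : SpectralModel P Θ ψ G H χ W c) (hθ₀ : θ₀ ∈ interior Θ) (i : Fin d) :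
    MemLp (fun ω => influence ψ χ c θ₀ J (W 0 ω) i) 2 P := by
  simp only [influence_apply]
  exact (memLp_finsetSum _ fun j _ => (h.memLp_score hθ₀ j).const_mul _).neg

theorem integral_influence (h : SpectralModel P Θ ψ G H χ W c) (hθ₀ : θ₀ ∈ interior Θ)
    (h0 : ∀ j, ∫ ω, spectralScore ψ χ c θ₀ j (W 0 ω) ∂P = 0) (i : Fin d) :
    ∫ ω, influence ψ χ c θ₀ J (W 0 ω) i ∂P = 0 := by
  simp only [influence_apply]
  rw [integral_neg, integral_finsetSum _ fun j _ =>
    ((h.memLp_score hθ₀ j).integrable (by simp)).const_mul _]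
  simp only [integral_const_mul, h0, mul_zero, Finset.sum_const_zero, neg_zero]

theorem second_moment_influence (h : SpectralModel P Θ ψ G H χ W c) (hθ₀ : θ₀ ∈ interior Θ)
    (hJ : J.IsSymm) :
    (Matrix.of fun i j => ∫ ω, influence ψ χ c θ₀ J (W 0 ω) i * influence ψ χ c θ₀ J (W 0 ω) j ∂P)
      = J⁻¹ * (Matrix.of fun i j => ∫ ω, spectralScore ψ χ c θ₀ i (W 0 ω)
        * spectralScore ψ χ c θ₀ j (W 0 ω) ∂P) * J⁻¹ := by
  have hint : ∀ a b, Integrable (fun ω => spectralScore ψ χ c θ₀ a (W 0 ω)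
      * spectralScore ψ χ c θ₀ b (W 0 ω)) P := fun a b =>
    (h.memLp_score hθ₀ a).integrable_mul (h.memLp_score hθ₀ b)
  have hsymm : ∀ a b, J⁻¹ a b = J⁻¹ b a := fun a b => by
    have : (J⁻¹).transpose = J⁻¹ := by rw [Matrix.transpose_nonsing_inv, hJ]
    exact (congrFun (congrFun this b) a)
  ext i j
  simp only [Matrix.of_apply, Matrix.mul_apply, influence_apply]
  have e : ∀ ω, (-∑ a, J⁻¹ i a * spectralScore ψ χ c θ₀ a (W 0 ω))
      * (-∑ b, J⁻¹ j b * spectralScore ψ χ c θ₀ b (W 0 ω))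
      = ∑ b, ∑ a, J⁻¹ i a * J⁻¹ b j * (spectralScore ψ χ c θ₀ a (W 0 ω)
        * spectralScore ψ χ c θ₀ b (W 0 ω)) := fun ω => by
    rw [neg_mul_neg, Finset.sum_mul_sum, Finset.sum_comm]
    refine Finset.sum_congr rfl fun b _ => Finset.sum_congr rfl fun a _ => ?_
    rw [hsymm j b]
    ring
  simp only [e]
  rw [integral_finsetSum _ fun b _ => integrable_finsetSum _ fun a _ => (hint a b).const_mul _]
  refine Finset.sum_congr rfl fun b _ => ?_
  rw [integral_finsetSum _ fun a _ => (hint a b).const_mul _, Finset.sum_mul]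
  refine Finset.sum_congr rfl fun a _ => ?_
  rw [integral_const_mul]
  ring

/-- The mean of the influence function inverts the mean of the score. -/
theorem bilin_mean_influence {B : Param d →L[ℝ] Param d →L[ℝ] ℝ}
    (hB : ∀ i j, B (EuclideanSpace.single i 1) (EuclideanSpace.single j 1) = J i j)
    (hJ : J.IsSymm) (hJdet : IsUnit J.det) (n : ℕ) (ω : Ω) (v : Param d) :
    B ((n : ℝ)⁻¹ • ∑ l ∈ Finset.range n, influence ψ χ c θ₀ J (W l ω)) v
      = -∑ j, v j * ((n : ℝ)⁻¹ * ∑ l ∈ Finset.range n, spectralScore ψ χ c θ₀ j (W l ω)) := by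
  set m : Fin d → ℝ := fun j => (n : ℝ)⁻¹ * ∑ l ∈ Finset.range n, spectralScore ψ χ c θ₀ j (W l ω)
    with hm
  have hT : ∀ i, ((n : ℝ)⁻¹ • ∑ l ∈ Finset.range n, influence ψ χ c θ₀ J (W l ω)) i
      = -(J⁻¹.mulVec m) i := fun i => by
    have e1 : (∑ l ∈ Finset.range n, influence ψ χ c θ₀ J (W l ω)) i
        = ∑ l ∈ Finset.range n, influence ψ χ c θ₀ J (W l ω) i := by
      simp
    rw [PiLp.smul_apply, e1, smul_eq_mul]
    simp only [influence_apply, hm, Matrix.mulVec, dotProduct, Finset.sum_neg_distrib,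
      Finset.mul_sum, mul_neg]
    rw [Finset.sum_comm]
    congr 1
    refine Finset.sum_congr rfl fun j _ => Finset.sum_congr rfl fun l _ => ?_
    ring
  have hinv : J.mulVec (J⁻¹.mulVec m) = m := by
    rw [Matrix.mulVec_mulVec, Matrix.mul_nonsing_inv _ hJdet, Matrix.one_mulVec]
  rw [bilin_apply_eq_sum, Finset.sum_comm, ← Finset.sum_neg_distrib]
  refine Finset.sum_congr rfl fun j _ => ?_
  simp only [hT, hB]
  rw [show (n : ℝ)⁻¹ * ∑ l ∈ Finset.range n, spectralScore ψ χ c θ₀ j (W l ω) = m j from rfl,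
    ← congrFun hinv j, Matrix.mulVec, dotProduct, Finset.mul_sum, ← Finset.sum_neg_distrib]
  refine Finset.sum_congr rfl fun i _ => ?_
  rw [← hJ.apply i j]
  ring

theorem enorm_sq_eq_sum (v : Param d) : ‖v‖ₑ ^ 2 = ∑ i, ‖v i‖ₑ ^ 2 := by
  rw [← ofReal_norm, ← ENNReal.ofReal_pow (norm_nonneg _), EuclideanSpace.norm_sq_eq,
    ENNReal.ofReal_sum_of_nonneg fun i _ => sq_nonneg _]
  refine Finset.sum_congr rfl fun i _ => ?_
  rw [ENNReal.ofReal_pow (norm_nonneg _), ofReal_norm]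

theorem lintegral_sq_mean_influence_le (h : SpectralModel P Θ ψ G H χ W c)
    (hθ₀ : θ₀ ∈ interior Θ) (h0 : ∀ j, ∫ ω, spectralScore ψ χ c θ₀ j (W 0 ω) ∂P = 0) {n : ℕ}
    (hn : 1 ≤ n) :
    ∫⁻ ω, ‖(n : ℝ)⁻¹ • ∑ l ∈ Finset.range n, influence ψ χ c θ₀ J (W l ω)‖ₑ ^ 2 ∂P
      ≤ (∑ i, ∫⁻ ω, ‖influence ψ χ c θ₀ J (W 0 ω) i‖ₑ ^ 2 ∂P) / n := by
  have hm : ∀ i, Measurable fun x => influence ψ χ c θ₀ J x i := fun i => by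
    simp only [influence_apply]
    exact (Finset.measurable_fun_sum _ fun j _ => (h.measurable_score hθ₀ j).const_mul _).neg
  have e : ∀ ω, ‖(n : ℝ)⁻¹ • ∑ l ∈ Finset.range n, influence ψ χ c θ₀ J (W l ω)‖ₑ ^ 2
      = ∑ i, ‖(n : ℝ)⁻¹ * ∑ l ∈ Finset.range n, influence ψ χ c θ₀ J (W l ω) i
        - ∫ ω, influence ψ χ c θ₀ J (W 0 ω) i ∂P‖ₑ ^ 2 := fun ω => by
    rw [enorm_sq_eq_sum]
    refine Finset.sum_congr rfl fun i _ => ?_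
    rw [h.integral_influence hθ₀ h0, sub_zero, PiLp.smul_apply, smul_eq_mul]
    congr 3
    simp
  simp only [e]
  rw [lintegral_finsetSum', ENNReal.div_eq_inv_mul, Finset.mul_sum]
  · refine Finset.sum_le_sum fun i _ => ?_
    rw [← ENNReal.div_eq_inv_mul]
    exact lintegral_sq_real_mean_sub_le h.indep h.ident (hm i) (h.memLp_influence hθ₀ i) hn
  · intro i _
    exact ((((Finset.measurable_fun_sum _ fun l _ => (hm i).comp (h.measurable_obs l)).const_mul
      _).sub_const _).enorm.pow_const 2).aemeasurable

/-- The probabilistic bounds of the spectral model are fed into the two deterministic comparison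
arguments. `S` and `Sn` need to agree with their spectral forms on `Θ` only, since both arguments
compare points of `Θ`. -/
theorem sqrtConsistent_and_tendstoInDistribution (h : SpectralModel P Θ ψ G H χ W c)
    (hΘ : IsCompact Θ) (hθ₀ : θ₀ ∈ interior Θ) (hk : IsSmoothing k C)
    (hbias : ∀ i, Tendsto (fun n : ℕ => ENNReal.ofReal (Real.sqrt n) *
      ∫⁻ u, G i u * ‖χ u‖ₑ * (‖k n u - 1‖ₑ * ‖obsMean P W (c i) u‖ₑ)) atTop (𝓝 0))
    {S : Param d → ℝ} (hS : ∀ θ ∈ Θ, S θ = spectralCrit P ψ χ W c θ) (hSc : ContinuousOn S Θ)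
    (hmin : ∀ θ ∈ Θ, θ ≠ θ₀ → S θ₀ < S θ) (hdiff : TwiceDifferentiable Θ S)
    (hB : ∀ i j, fderiv ℝ (fderiv ℝ S) θ₀ (EuclideanSpace.single i 1)
      (EuclideanSpace.single j 1) = J i j) (hJ : J.PosDef)
    {Sn : ℕ → Ω → Param d → ℝ} (hSn : ∀ n ω, ∀ θ ∈ Θ, Sn n ω θ = spectralCritEmp ψ χ W c k n ω θ)
    {θhat : ℕ → Ω → Param d} (hm : ∀ n, AEMeasurable (θhat n) P)
    (hmem : ∀ n, ∀ᵐ ω ∂P, θhat n ω ∈ Θ)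
    (hest : ∀ n, ∀ᵐ ω ∂P, ∀ θ ∈ Θ, Sn n ω (θhat n ω) ≤ Sn n ω θ) :
    SqrtConsistent P θ₀ θhat ∧
      TendstoInDistribution (fun (n : ℕ) ω => Real.sqrt n • (θhat n ω - θ₀)) atTop
        (id : Param d → Param d) (fun _ => P)
        (multivariateGaussian 0 (J⁻¹ * (Matrix.of fun i j => ∫ ω,
          spectralScore ψ χ c θ₀ i (W 0 ω) * spectralScore ψ χ c θ₀ j (W 0 ω) ∂P) * J⁻¹)) := by
  have hnhds : interior Θ ∈ 𝓝 θ₀ := isOpen_interior.mem_nhds hθ₀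
  have h0Θ := interior_subset hθ₀
  have hloc : IsLocalMin S θ₀ := by
    filter_upwards [hnhds] with θ hθ
    rcases eq_or_ne θ θ₀ with rfl | hne
    · exact le_rfl
    · exact (hmin θ (interior_subset hθ) hne).le
  have hloc' : IsLocalMin (spectralCrit P ψ χ W c) θ₀ := by
    filter_upwards [hloc, hnhds] with θ h1 hθ
    rwa [← hS θ (interior_subset hθ), ← hS θ₀ h0Θ]
  have hd : ∀ᶠ θ in 𝓝 θ₀, DifferentiableAt ℝ S θ := by
    filter_upwards [hnhds] with θ hθ using (hdiff θ hθ).1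
  have hd2 := (hdiff θ₀ hθ₀).2
  set B := fderiv ℝ (fderiv ℝ S) θ₀ with hBdef
  have hsymm : ∀ v w, B v w = B w v := second_derivative_symmetric_of_eventually
    (hd.mono fun θ h => h.hasFDerivAt) hd2.hasFDerivAt
  have hJs : J.IsSymm := Matrix.IsSymm.ext fun i j => by rw [← hB, ← hB, hsymm]
  have hJdet : IsUnit J.det := (Matrix.isUnit_iff_isUnit_det J).1 hJ.isUnit
  have hBpos : ∀ v, v ≠ 0 → 0 < B v v := fun v hv => by
    have h1 := hJ.dotProduct_mulVec_pos (x := fun i => v i) (fun h2 => hv (by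
      ext i
      exact congrFun h2 i))
    have e : B v v = dotProduct (star fun i => v i) (J.mulVec fun i => v i) := by
      rw [bilin_apply_eq_sum]
      simp only [hB, dotProduct, Matrix.mulVec, star_trivial, Finset.mul_sum]
      refine Finset.sum_congr rfl fun i _ => Finset.sum_congr rfl fun j _ => ?_
      ring
    rw [e]
    exact h1
  obtain ⟨a, ha, hBa⟩ := exists_pos_le_of_pos B hBpos
  have htaylor := fun ε (hε : 0 < ε) => taylor_two_of_isLocalMin hd hd2 hloc (ε := ε) hε
  -- The quadratic part is at least `a/2 · ‖θ - θ₀‖²`, so an error of `a/4` leaves growth with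
  -- constant `a/4`.
  obtain ⟨ρ₁, hρ₁, hty⟩ := htaylor (a / 4) (by positivity)
  obtain ⟨ρ₂, hρ₂, hball⟩ := Metric.isOpen_iff.1 isOpen_interior θ₀ hθ₀
  set ρ := min ρ₁ ρ₂ with hρ
  have hρ0 : 0 < ρ := lt_min hρ₁ hρ₂
  have hballρ : Metric.ball θ₀ ρ ⊆ interior Θ :=
    (Metric.ball_subset_ball (min_le_right _ _)).trans hball
  have hquad : ∀ θ ∈ Metric.ball θ₀ ρ, a / 4 * ‖θ - θ₀‖ ^ 2 ≤ S θ - S θ₀ := fun θ hθ => by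
    have h1 := (abs_le.1 (hty θ (Metric.ball_subset_ball (min_le_left _ _) hθ))).1
    have h2 := hBa (θ - θ₀)
    linarith
  obtain ⟨M, β, A₁, hA₁, hMm, hM2, hβ, hM⟩ := h.exists_uniform_bound hk
  obtain ⟨L, A₂, hA₂, hL2, hL⟩ := h.exists_lipschitz_bound hk hbias hballρ
  obtain ⟨A, hA, hrate⟩ := exists_lintegral_sq_norm_le hΘ h0Θ hSc hmin (by positivity) hρ0 hquad
    hmem hest hA₁ hA₂ hMm hM2 hL2 hβ
    (fun n ω θ hθ => by
      rw [hSn n ω θ hθ, hS θ hθ]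
      exact hM n ω θ hθ)
    (fun n _ ω θ hθ => by
      have hθΘ := interior_subset (hballρ hθ)
      rw [hSn n ω θ hθΘ, hS θ hθΘ, hSn n ω θ₀ h0Θ, hS θ₀ h0Θ]
      exact hL n ω θ hθ)
  refine ⟨sqrtConsistent_of_lintegral hm hA hrate, ?_⟩
  have hsc0 := h.integral_score_eq_zero hθ₀ hloc'
  set T : ℕ → Ω → Param d := fun n ω =>
    (n : ℝ)⁻¹ • ∑ l ∈ Finset.range n, influence ψ χ c θ₀ J (W l ω) with hT
  have hTm : ∀ n, Measurable (T n) := fun n => by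
    have h1 : Measurable fun ω => ∑ l ∈ Finset.range n, influence ψ χ c θ₀ J (W l ω) :=
      Finset.measurable_fun_sum _ fun l _ =>
        (h.measurable_influence hθ₀).comp (h.measurable_obs l)
    have h2 : Measurable fun x : Param d => (n : ℝ)⁻¹ • x := by fun_prop
    exact h2.comp h1
  have hclt := tendstoInDistribution_sqrt_smul_mean h.indep h.ident
    (h.measurable_influence (J := J) hθ₀) (h.memLp_influence hθ₀) (h.integral_influence hθ₀ hsc0)
  rw [h.second_moment_influence hθ₀ hJs] at hclt
  -- Slutsky: the limit law of `√n T_n` passes to the estimator once the scaled difference tends to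
  -- `0` in probability.
  refine tendstoInDistribution_of_tendstoInMeasure_sub _ _ hclt ?_ fun n => by
    have h2 : Measurable fun x : Param d => Real.sqrt n • (x - θ₀) := by fun_prop
    exact h2.comp_aemeasurable (hm n)
  rw [tendstoInMeasure_iff_norm]
  intro δ hδ
  have main := tendsto_meas_sqrt_mul_norm_sub hθ₀ hsymm ha hBa htaylor hest
    (fun n => ((hm n).sub_const θ₀).enorm) (T := T) (fun n => (hTm n).enorm.aemeasurable) hA
    (ENNReal.sum_ne_top.2 fun i _ => lintegral_sq_ne_top_of_memLp
      (h.memLp_influence (J := J) hθ₀ i)) hrate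
    (fun n hn => h.lintegral_sq_mean_influence_le hθ₀ hsc0 hn) ?_ hδ
  · refine main.congr fun n => ?_
    congr 1
    ext ω
    simp only [Set.mem_ofPred_eq, Pi.sub_apply, Pi.zero_apply, sub_zero, hT]
    rw [← smul_sub, norm_smul, Real.norm_of_nonneg (Real.sqrt_nonneg _)]
  · intro ε hε
    obtain ⟨ρ₃, hρ₃, N, hN⟩ := h.exists_remainder_bound hk hθ₀ hbias hε
    refine ⟨min ρ₂ ρ₃, lt_min hρ₂ hρ₃, N, fun n hn => ?_⟩
    obtain ⟨R, hRm, hRi, hR⟩ := hN n hn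
    refine ⟨R, hRm, hRi, fun ω θ hθ => ?_⟩
    have hθΘ := interior_subset (hball (Metric.ball_subset_ball (min_le_left _ _) hθ))
    have h1 := hR ω θ (Metric.ball_subset_ball (min_le_right _ _) hθ)
    rw [hSn n ω θ hθΘ, hS θ hθΘ, hSn n ω θ₀ h0Θ, hS θ₀ h0Θ]
    -- The influence function carries the sign `-J⁻¹`, so adding `B(T_n, ·)` subtracts exactly the
    -- linear term of the expansion.
    rw [bilin_mean_influence hB hJs hJdet]
    simp only [hsc0, sub_zero] at h1
    rwa [← sub_eq_add_neg]

end SpectralModel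

end EIV

namespace EIV

set_option linter.unusedSectionVars false

/-! ### The errors-in-variables model as a spectral model -/

theorem pairing_mul_obsEmp {Ω : Type*} {χ : ℝ → ℂ} {φ : ℝ → ℝ} {k : ℝ → ℂ} {W : ℕ → Ω → ℝ × ℝ}
    (c : ℝ → ℝ) (n : ℕ) (ω : Ω)
    (h : ∀ z : ℝ, Integrable fun u : ℝ =>
      fourier φ u * (χ u * (k u * Complex.exp (-(Complex.I * u * z))))) :
    pairing χ φ (fun u => k u * obsEmp W c n ω u) = (n : ℂ)⁻¹ * ∑ l ∈ Finset.range n,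
      (c (W l ω).1 : ℂ) * pairing χ φ
        (fun u => k u * Complex.exp (-(Complex.I * u * (W l ω).2))) := by
  simp only [pairing, ← integral_const_mul]
  rw [← integral_finsetSum _ fun l _ => (h _).const_mul _, ← integral_const_mul]
  refine integral_congr_ae (ae_of_all _ fun u => ?_)
  simp only [obsEmp, obs, Finset.mul_sum]
  refine Finset.sum_congr rfl fun l _ => ?_
  ring

section Model

variable {d : ℕ} {Ω : Type*} [MeasurableSpace Ω] {P : Measure Ω} [IsProbabilityMeasure P]
  {Θ : Set (Param d)} {θ₀ : Param d} {f w : Param d → ℝ → ℝ} {s2 : ℝ} {g p : ℝ → ℝ} {κ : ℝ → ℂ}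
  {X ξ ε : ℕ → Ω → ℝ}

theorem measurable_wf (hf : SmoothRegression Θ f) (hw : SmoothWeight Θ w) (k : ℕ) {θ : Param d}
    (hθ : θ ∈ Θ) : Measurable (wf w f k θ) :=
  (hw.measurable θ hθ).mul ((hf.measurable θ hθ).pow_const k)

theorem IsSample.exists_spectralModel (h : IsSample P g p X ξ ε) (hmom : ErrorMoments P f θ₀ s2 X ξ)
    (hp0 : ∀ t, fourier p t ≠ 0) (hf : SmoothRegression Θ f) (hw : SmoothWeight Θ w)
    (hratio : RatioConditions Θ f w p) (hΘ : IsCompact Θ) (hθ₀ : θ₀ ∈ interior Θ)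
    (hnc : ¬ Convex ℝ Θ → MemLp (supOver Θ (fun θ => ratio p (w θ))) 1) :
    ∃ H, SpectralModel P Θ (fun k : Fin 3 => wf w f k) (fun k => gradBound Θ f w k) H
      (deconvWeight p) (observations f θ₀ X ξ ε) (coef s2) := by
  have hk : ∀ k : Fin 3, (k : ℕ) ≤ 2 := fun k => by omega
  have hp := h.integrable_p
  have hp1 := h.enorm_fourier_p_le
  have hfm := hf.measurable θ₀ (interior_subset hθ₀)
  choose H hH using fun k : Fin 3 => exists_spectralWeight hf hw hratio hp hp0 hp1 hΘ hθ₀ hnc (hk k)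
  exact ⟨H, fun k => spectralFamily_wf hf hw hratio hp hp0 hp1 (hk k), hH,
    h.measurable_observations hfm, h.iIndepFun_observations hfm, h.identDistrib_observations hfm,
    measurable_coef s2, memLp_coef (hmom.fourth_reg.add hmom.fourth) s2⟩

/-- The bound is uniform in `θ`, while the null set may depend on `θ`; this is enough for dominated
convergence. -/
theorem exists_wf_bound (hf : SmoothRegression Θ f) (hw : SmoothWeight Θ w)
    (hratio : RatioConditions Θ f w p) (hp : Integrable p) (hp0 : ∀ t, fourier p t ≠ 0)
    (hp1 : ∀ u, ‖fourier p u‖ₑ ≤ 1) (hΘ : IsCompact Θ) (hθ₀ : θ₀ ∈ interior Θ)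
    (hnc : ¬ Convex ℝ Θ → MemLp (supOver Θ (fun θ => ratio p (w θ))) 1) {k : ℕ} (hk : k ≤ 2) :
    ∃ B, ∀ θ ∈ Θ, ∀ᵐ x, |wf w f k θ x| ≤ B := by
  obtain ⟨H, -, hHi, hle⟩ := exists_ratio_dominated hf hw hratio hp hp0 hp1 hΘ hθ₀ hnc hk
  refine ⟨_, fun θ hθ => (ae_abs_le_of_enorm_fourier_le (hratio.integrable k hk θ hθ) hHi ?_).2⟩
  filter_upwards [hle θ hθ] with u hu
  rw [fourier_eq_ratio_mul (hp0 u), enorm_mul]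
  exact ((mul_le_mul_right (hp1 u) _).trans_eq (mul_one _)).trans hu

theorem IsSample.contrast_eq_spectralCrit (h : IsSample P g p X ξ ε) (hp0 : ∀ t, fourier p t ≠ 0)
    (hf : SmoothRegression Θ f) (hw : SmoothWeight Θ w) (hθ₀ : θ₀ ∈ interior Θ)
    {G H : Fin 3 → ℝ → ℝ≥0∞}
    (hM : SpectralModel P Θ (fun k : Fin 3 => wf w f k) G H (deconvWeight p)
      (observations f θ₀ X ξ ε) (coef s2)) {θ : Param d} (hθ : θ ∈ Θ) :
    contrast P f w s2 X (response f θ₀ X ξ) θ = spectralCrit P (fun k : Fin 3 => wf w f k)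
      (deconvWeight p) (observations f θ₀ X ξ ε) (coef s2) θ := by
  have hfm := hf.measurable θ₀ (interior_subset hθ₀)
  have hci : ∀ k, Integrable (fun ω => coef s2 k (response f θ₀ X ξ 0 ω)) P := fun k =>
    (hM.memLp_coef k).integrable (by norm_num)
  have hint : ∀ k : Fin 3, Integrable
      (fun ω => coef s2 k (response f θ₀ X ξ 0 ω) * wf w f k θ (X 0 ω)) P := fun k =>
    h.integrable_mul (hci k) (measurable_wf hf hw k hθ)
      (ae_abs_le_of_enorm_fourier_le ((hM.family k).integrable θ hθ)
        ((hM.family k).integrable_fourier θ hθ).2.ne (ae_of_all _ fun u => le_rfl)).2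
  have e : ∀ k : Fin 3, pairing (deconvWeight p) (wf w f k θ)
      (obsMean P (observations f θ₀ X ξ ε) (coef s2 k))
      = ((∫ ω, coef s2 k (response f θ₀ X ξ 0 ω) * wf w f k θ (X 0 ω) ∂P : ℝ) : ℂ) := fun k =>
    (h.integral_mul_eq_pairing hfm hp0 (measurable_coef s2 k) (hci k)
      ((hM.family k).integrable θ hθ) ((hM.family k).integrable_fourier θ hθ)).symm
  rw [spectralCrit, Finset.sum_congr rfl fun k _ => e k, ← Complex.ofReal_sum, Complex.ofReal_re,
    ← integral_finsetSum _ fun k _ => hint k, contrast]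
  simp only [sum_coef_mul_wf]

/-- The assumed differentiability concerns the interior only, and separation needs continuity up to
the boundary. It follows by dominated convergence: the functions `w f^k` are bounded uniformly in
`θ` and the coefficients at `Y` are integrable. -/
theorem IsSample.continuousOn_contrast (h : IsSample P g p X ξ ε)
    (hmom : ErrorMoments P f θ₀ s2 X ξ) (hp0 : ∀ t, fourier p t ≠ 0) (hf : SmoothRegression Θ f)
    (hw : SmoothWeight Θ w) (hratio : RatioConditions Θ f w p) (hΘ : IsCompact Θ)
    (hθ₀ : θ₀ ∈ interior Θ)
    (hnc : ¬ Convex ℝ Θ → MemLp (supOver Θ (fun θ => ratio p (w θ))) 1) :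
    ContinuousOn (contrast P f w s2 X (response f θ₀ X ξ)) Θ := by
  have hfm := hf.measurable θ₀ (interior_subset hθ₀)
  choose B hB using fun k : Fin 3 => exists_wf_bound hf hw hratio h.integrable_p hp0
    h.enorm_fourier_p_le hΘ hθ₀ hnc (show (k : ℕ) ≤ 2 by omega)
  have hci : ∀ k, Integrable (fun ω => coef s2 k (response f θ₀ X ξ 0 ω)) P := fun k =>
    (memLp_coef (hmom.fourth_reg.add hmom.fourth) s2 k).integrable (by norm_num)
  have hm : ∀ k : Fin 3, ∀ θ ∈ Θ, Measurable fun ω =>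
      coef s2 k (response f θ₀ X ξ 0 ω) * wf w f k θ (X 0 ω) := fun k θ hθ =>
    ((measurable_coef s2 k).comp (h.measurable_response hfm 0)).mul
      ((measurable_wf hf hw k hθ).comp (h.measurable_design 0))
  have e : contrast P f w s2 X (response f θ₀ X ξ) = fun θ =>
      ∫ ω, ∑ k : Fin 3, coef s2 k (response f θ₀ X ξ 0 ω) * wf w f k θ (X 0 ω) ∂P := by
    funext θ
    simp only [sum_coef_mul_wf, contrast]
  rw [e]
  intro θ hθ
  refine continuousWithinAt_of_dominated (bound := fun ω =>
    ∑ k : Fin 3, |coef s2 k (response f θ₀ X ξ 0 ω)| * B k) ?_ ?_ ?_ ?_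
  · filter_upwards [self_mem_nhdsWithin] with η hη
    exact (Finset.measurable_fun_sum _ fun k _ => hm k η hη).aestronglyMeasurable
  · filter_upwards [self_mem_nhdsWithin] with η hη
    filter_upwards [ae_all_iff.2 fun k => h.ae_design (hB k η hη)] with ω hω
    rw [Real.norm_eq_abs]
    refine (Finset.abs_sum_le_sum_abs _ _).trans (Finset.sum_le_sum fun k _ => ?_)
    rw [abs_mul]
    exact mul_le_mul_of_nonneg_left (hω k) (abs_nonneg _)
  · exact integrable_finsetSum _ fun k _ => (hci k).abs.mul_const _
  · refine ae_of_all _ fun ω => tendsto_finsetSum _ fun k _ => ?_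
    exact (((hw.continuousOn _).mul ((hf.continuousOn _).pow k)) θ hθ).const_mul _

theorem IsSample.empContrast_eq_spectralCritEmp (h : IsSample P g p X ξ ε)
    (hp0 : ∀ t, fourier p t ≠ 0) (hκ : IsKernelTransform κ) {C : ℕ → ℝ}
    (hC : IsBandwidth Θ f w κ C) {G H : Fin 3 → ℝ → ℝ≥0∞}
    (hM : SpectralModel P Θ (fun k : Fin 3 => wf w f k) G H (deconvWeight p)
      (observations f θ₀ X ξ ε) (coef s2)) (n : ℕ) (ω : Ω) {θ : Param d} (hθ : θ ∈ Θ) :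
    empContrast f w s2 κ p (C n) n (fun i => response f θ₀ X ξ i ω) (fun i => observed X ε i ω) θ
      = spectralCritEmp (fun k : Fin 3 => wf w f k) (deconvWeight p) (observations f θ₀ X ξ ε)
        (coef s2) (fun n u => κ (-u / C n)) n ω θ := by
  have hχ := continuous_deconvWeight h.integrable_p hp0
  have hk := isSmoothing_of_isBandwidth hκ hC
  have h1 : ∀ k : Fin 3, ∀ z, _ := fun k z =>
    hκ.integral_mul_deconvKernel hχ (hC.pos n) z ((hM.family k).integrable θ hθ)
  have h2 : ∀ y z : ℝ, ∫ x : ℝ, ((y - f θ x) ^ 2 - s2) * w θ x * deconvKernel κ p (C n) (x - z)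
      = ∑ k : Fin 3, coef s2 k y * (pairing (deconvWeight p) (wf w f k θ)
        (fun u => κ (-u / C n) * Complex.exp (-(Complex.I * u * z)))).re := fun y z => by
    simp only [← (h1 _ z).2, ← integral_const_mul]
    rw [← integral_finsetSum _ fun k _ => ((h1 k z).1).const_mul _]
    refine integral_congr_ae (ae_of_all _ fun x => ?_)
    dsimp only
    rw [← sum_coef_mul_wf, Finset.sum_mul]
    simp only [mul_assoc]
  have h3 : ∀ k : Fin 3, pairing (deconvWeight p) (wf w f k θ)
      (fun u => κ (-u / C n) * obsEmp (observations f θ₀ X ξ ε) (coef s2 k) n ω u) = _ := fun k =>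
    pairing_mul_obsEmp (k := fun u => κ (-u / C n)) (coef s2 k) n ω fun z =>
      (hM.weight k).integrable (hM.family k) hθ ((hk.isBddMeas n).mul (.cexp z))
  simp only [empContrast, spectralCritEmp, h2, h3]
  rw [← Finset.mul_sum, Finset.sum_comm, ← Complex.ofReal_natCast, ← Complex.ofReal_inv,
    Complex.re_ofReal_mul, Complex.re_sum]
  simp only [Complex.re_sum, Complex.re_ofReal_mul, observations]

/-- For fixed `y` the differentiated function is a combination of the three families with the
coefficients `coef s2 k y`, so derivative, transform and pairing act term by term. -/
theorem SpectralModel.score_eq_spectralScore {G H : Fin 3 → ℝ → ℝ≥0∞} {W : ℕ → Ω → ℝ × ℝ}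
    (hM : SpectralModel P Θ (fun k : Fin 3 => wf w f k) G H (deconvWeight p) W (coef s2))
    (hθ₀ : θ₀ ∈ interior Θ) (y z : ℝ) (j : Fin d) :
    score f w θ₀ s2 p y z j = spectralScore (fun k : Fin 3 => wf w f k) (deconvWeight p) (coef s2)
      θ₀ j (y, z) := by
  have e1 : (fun (θ : Param d) (x : ℝ) => f θ x ^ 2 * w θ x - 2 * y * (f θ x * w θ x)
      + (y ^ 2 - s2) * w θ x) = fun θ x => ∑ k : Fin 3, coef s2 k y * wf w f k θ x := by
    funext θ x
    rw [sum_coef_mul_wf]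
    ring
  have e2 : pderiv j (fun θ x => ∑ k : Fin 3, coef s2 k y * wf w f k θ x) θ₀
      = fun x => ∑ k : Fin 3, coef s2 k y * pderiv j (wf w f k) θ₀ x := by
    funext x
    have h1 := HasFDerivAt.fun_sum (u := Finset.univ) fun (k : Fin 3) _ =>
      ((hM.family k).hasFDerivAt hθ₀ x).const_mul (coef s2 k y)
    rw [pderiv, h1.fderiv]
    simp [pderiv]
  have hi : ∀ k : Fin 3, _ := fun k =>
    (hM.weight k).integrable_pderiv (hM.family k) hθ₀ j (IsBddMeas.cexp z)
  rw [score, spectralScore, e1, e2]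
  congr 1
  simp only [pairing, ← integral_const_mul]
  rw [← integral_finsetSum _ fun k _ => (hi k).const_mul _]
  refine integral_congr_ae (ae_of_all _ fun u => ?_)
  dsimp only
  rw [fourier_sum_mul _ _ fun k _ => (hM.family k).integrable_pderiv j θ₀ hθ₀, deconvWeight]
  simp only [Finset.sum_mul, Finset.mul_sum, Finset.sum_div]
  refine Finset.sum_congr rfl fun k _ => ?_
  ring

end Model

end EIV

/-! ### Consistency and asymptotic normality of the estimator -/

theorem theorem6p2 {d : ℕ} {Ω : Type*} [MeasurableSpace Ω] (P : Measure Ω)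
    [IsProbabilityMeasure P]
    (Θ : Set (EIV.Param d)) (hΘ : IsCompact Θ)
    (θ₀ : EIV.Param d) (hθ₀ : θ₀ ∈ interior Θ)
    (f w : EIV.Param d → ℝ → ℝ) (s2 : ℝ) (g p : ℝ → ℝ) (κ : ℝ → ℂ)
    (X ξ ε Y Z : ℕ → Ω → ℝ)
    (hsample : EIV.IsSample P g p X ξ ε)
    (hY : Y = EIV.response f θ₀ X ξ) (hZ : Z = EIV.observed X ε)
    (hmom : EIV.ErrorMoments P f θ₀ s2 X ξ)
    (hnoise : EIV.NoiseCondition p)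
    (hκ : EIV.IsKernelTransform κ)
    (hf : EIV.SmoothRegression Θ f) (hw : EIV.SmoothWeight Θ w)
    (hwmom : EIV.WeightedMoments P Θ f w X Y)
    (hdesign : EIV.DesignL2 f θ₀ g)
    (hwint : EIV.WeightIntegrability Θ f w)
    (hident : EIV.Identifiability P Θ f w θ₀ s2 X Y)
    (hratio : EIV.RatioConditions Θ f w p)
    (hnonconvex : ¬ Convex ℝ Θ →
      MemLp (EIV.supOver Θ (fun θ => EIV.ratio p (w θ))) 1) :
    (∃ C : ℕ → ℝ, EIV.IsBandwidth Θ f w κ C) ∧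
    (∀ j, MemLp (fun ω => EIV.score f w θ₀ s2 p (Y 0 ω) (Z 0 ω) j) 2 P) ∧
    ∀ C : ℕ → ℝ, EIV.IsBandwidth Θ f w κ C →
      ∀ θhat : ℕ → Ω → EIV.Param d, EIV.IsEstimator P Θ f w s2 κ p C Y Z θhat →
        EIV.SqrtConsistent P θ₀ θhat ∧
        TendstoInDistribution (fun (n : ℕ) ω => Real.sqrt n • (θhat n ω - θ₀)) atTop
          (id : EIV.Param d → EIV.Param d) (fun _ => P)
          (multivariateGaussian 0 (EIV.asympCov P f w θ₀ s2 p X Y Z)) := by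
  subst hY hZ
  have hp := hsample.integrable_p
  have hp0 := hnoise.2
  have hfm := hf.measurable θ₀ (interior_subset hθ₀)
  obtain ⟨H, hM⟩ := hsample.exists_spectralModel hmom hp0 hf hw hratio hΘ hθ₀ hnonconvex
  have hscore : ∀ ω j, EIV.score f w θ₀ s2 p (EIV.response f θ₀ X ξ 0 ω) (EIV.observed X ε 0 ω) j
      = EIV.spectralScore (fun k : Fin 3 => EIV.wf w f k) (EIV.deconvWeight p) (EIV.coef s2) θ₀ j
        (EIV.observations f θ₀ X ξ ε 0 ω) := fun ω j => hM.score_eq_spectralScore hθ₀ _ _ j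
  refine ⟨EIV.exists_isBandwidth hf hw hratio hp hp0 hsample.enorm_fourier_p_le hκ, fun j => ?_,
    fun C hC θhat hest => ?_⟩
  · simp only [hscore]
    exact hM.memLp_score hθ₀ j
  -- The constant `A` of `tendsto_bias` is `E|c_k(Y)|`, finite because the coefficients are square
  -- integrable.
  · have hbias := fun k : Fin 3 => EIV.tendsto_bias hratio hp hp0 hκ hC
      (show (k : ℕ) ≤ 2 by omega)
      (((hM.memLp_coef k).integrable (by norm_num)).2.ne)
      (hsample.enorm_obsMean_le hfm (EIV.measurable_coef s2 k))
    have h1 := hM.sqrtConsistent_and_tendstoInDistribution hΘ hθ₀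
      (EIV.isSmoothing_of_isBandwidth hκ hC) hbias
      (fun θ hθ => hsample.contrast_eq_spectralCrit hp0 hf hw hθ₀ hM hθ)
      (hsample.continuousOn_contrast hmom hp0 hf hw hratio hΘ hθ₀ hnonconvex)
      hident.unique_min hident.differentiable hident.hessian hident.posDef
      (fun n ω θ hθ => hsample.empContrast_eq_spectralCritEmp hp0 hκ hC hM n ω hθ)
      hest.aemeasurable hest.mem hest.isMin
    simpa only [EIV.asympCov, EIV.scoreMatrix, hscore] using h1
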